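/- Let $(M,g)$ be a smooth Riemannian manifold without boundary, second countable but not assumed complete or connected, with volume measure $\mu_g$. Let $\overline M$ be the metric completion of $M$ for the Riemannian distance and $\partial_C M:=\overline M\setminus M$ its Cauchy boundary. Let $V\to M$ be a smooth real or complex vector bundle of finite rank with a smooth (Hermitian) metric $h$ and a smooth connection $\nabla$ that is compatible with $h$. Let $L^2(V)$ and $L^2(T^*M\otimes V)$ be the Hilbert spaces of square integrable measurable sections with respect to $\mu_g$ and the fibre metrics induced by $g$ and $h$. Let $\nabla_c$ be $\nabla$ with domain $C_c^\infty(V)$, let $\nabla_2$ be $\nabla$ with domain $\{u\in C^\infty(V)\cap L^2(V):\nabla u\in L^2(T^*M\otimes V)\}$, both regarded as operators from $L^2(V)$ to $L^2(T^*M\otimes V)$, and let $\nabla_N:=\overline{\nabla_2}$. The Gaffney Laplacian is the operator $\Delta_G:=(\nabla_c)^*\,\nabla_N$ on $L^2(V)$ with domain $\{u\in\mathcal D(\nabla_N):\nabla_N u\in\mathcal D((\nabla_c)^*)\}$. Let $W^{1,2}(M)$ be the closure of $\{u\in C^\infty(M)\cap L^2(M): du\in L^2(T^*M)\}$ in the norm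 $\|u\|_2+\|du\|_2$. For open $\Omega\subset\overline M$ put $$\mathrm{Cap}(\Omega):=\inf\Big\{\int_M(|u|^2+|du|^2)\,d\mu_g:\ u\in W^{1,2}(M),\ 0\le u\le 1\text{ a.e.},\ u=1\text{ a.e. on }\Omega\cap M\Big\},$$ with $\inf\emptyset=\infty$, and for arbitrary $\Sigma\subset\overline M$ put $\mathrm{Cap}(\Sigma):=\inf\{\mathrm{Cap}(\Omega):\Omega\subset\overline M\text{ open},\ \Sigma\subset\Omega\}$. The set $\Sigma$ is called polar if $\mathrm{Cap}(\Sigma)=0$. If the Cauchy boundary $\partial_C M$ is polar, then the Gaffney Laplacian $\Delta_G$ is densely defined and self-adjoint on $L^2(V)$. -/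

import Mathlib

open Bundle Manifold MeasureTheory Set Filter Topology
open scoped ContDiff ENNReal Matrix

noncomputable section
namespace GaffneyLap

section Field
variable {𝕜 : Type*} [RCLike 𝕜] {M : Type*} [MeasurableSpace M] {μ : Measure M}
  {W : M → Type*} [∀ x, NormedAddCommGroup (W x)] [∀ x, InnerProductSpace 𝕜 (W x)]

variable (𝕜 μ W) in
/-- A measurable field of inner product spaces over `(M, μ)`: a family of inner product spaces
`W x` together with the linear space of those sections that are declared to be measurable. The
pointwise norm of a measurable section is measurable, and almost everywhere limits of measurable
sections are measurable. -/
structure MeasurableField where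
  sections : Submodule 𝕜 (Π x, W x)
  aestronglyMeasurable_norm : ∀ s ∈ sections, AEStronglyMeasurable (fun x ↦ ‖s x‖) μ
  mem_of_tendsto : ∀ (f : ℕ → Π x, W x) (g : Π x, W x), (∀ k, f k ∈ sections) →
    (∀ᵐ x ∂μ, Tendsto (fun k ↦ f k x) atTop (𝓝 (g x))) → g ∈ sections

namespace MeasurableField
variable (S : MeasurableField 𝕜 μ W)

lemma aestronglyMeasurable_inner {s t : Π x, W x} (hs : s ∈ S.sections) (ht : t ∈ S.sections) :
    AEStronglyMeasurable (fun x ↦ inner 𝕜 (s x) (t x)) μ := by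
  have h (u : Π x, W x) (hu : u ∈ S.sections) :
      AEStronglyMeasurable (fun x ↦ ((‖u x‖ : ℝ) : 𝕜) ^ 2) μ :=
    (RCLike.continuous_ofReal.comp_aestronglyMeasurable (S.aestronglyMeasurable_norm u hu)).pow 2
  have hI (c : 𝕜) : c • t ∈ S.sections := S.sections.smul_mem c ht
  simp_rw [inner_eq_sum_norm_sq_div_four (𝕜 := 𝕜)]
  have h1 := h _ (S.sections.add_mem hs ht)
  have h2 := h _ (S.sections.sub_mem hs ht)
  have h3 := h _ (S.sections.sub_mem hs (hI RCLike.I))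
  have h4 := h _ (S.sections.add_mem hs (hI RCLike.I))
  exact (((h1.sub h2).add ((h3.sub h4).mul_const RCLike.I)).div₀ aestronglyMeasurable_const)

/-- The measurable sections `s` with `∫ ‖s x‖² dμ < ∞`. -/
def squareIntegrable : Submodule 𝕜 (Π x, W x) where
  carrier := {s | s ∈ S.sections ∧ Integrable (fun x ↦ ‖s x‖ ^ 2) μ}
  zero_mem' := ⟨S.sections.zero_mem, by simp⟩
  add_mem' := by
    rintro s t ⟨hs, hs2⟩ ⟨ht, ht2⟩
    have hst := S.sections.add_mem hs ht
    refine ⟨hst, ((hs2.add ht2).const_mul 2).mono'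
      ((S.aestronglyMeasurable_norm _ hst).pow 2) (ae_of_all _ fun x ↦ ?_)⟩
    have := norm_add_le (s x) (t x)
    simp only [Pi.add_apply, norm_pow, norm_norm]
    nlinarith [norm_nonneg (s x + t x), sq_nonneg (‖s x‖ - ‖t x‖)]
  smul_mem' := by
    rintro c s ⟨hs, hs2⟩
    refine ⟨S.sections.smul_mem c hs, ?_⟩
    simpa [norm_smul, mul_pow] using hs2.const_mul (‖c‖ ^ 2)

/-- The square integrable measurable sections as a type, on which the `L²` inner product (degenerate
on sections vanishing almost everywhere) is put below. -/
def L2Section : Type _ := S.squareIntegrable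

instance : AddCommGroup S.L2Section := inferInstanceAs (AddCommGroup S.squareIntegrable)
instance : Module 𝕜 S.L2Section := inferInstanceAs (Module 𝕜 S.squareIntegrable)

variable {S} in
/-- The underlying section. -/
def L2Section.toFun (s : S.L2Section) : Π x, W x := Subtype.val (p := (· ∈ S.squareIntegrable)) s

instance : CoeFun S.L2Section (fun _ ↦ Π x, W x) := ⟨L2Section.toFun⟩

/-- A square integrable section as an element of `L2Section`. -/
def ofMem (s : Π x, W x) (hs : s ∈ S.squareIntegrable) : S.L2Section :=
  Subtype.mk (p := (· ∈ S.squareIntegrable)) s hs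

variable {S} in
lemma L2Section.mem (s : S.L2Section) : (s : Π x, W x) ∈ S.squareIntegrable :=
  Subtype.property (p := (· ∈ S.squareIntegrable)) s

variable {S} in
@[ext] lemma L2Section.ext {s t : S.L2Section} (h : ∀ x, s x = t x) : s = t :=
  Subtype.ext (p := (· ∈ S.squareIntegrable)) (funext h)

@[simp] lemma ofMem_apply (s : Π x, W x) (hs : s ∈ S.squareIntegrable) (x : M) :
    S.ofMem s hs x = s x := rfl
@[simp] lemma add_apply (s t : S.L2Section) (x : M) : (s + t) x = s x + t x := rfl
@[simp] lemma sub_apply (s t : S.L2Section) (x : M) : (s - t) x = s x - t x := rfl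
@[simp] lemma smul_apply (c : 𝕜) (s : S.L2Section) (x : M) : (c • s) x = c • s x := rfl
@[simp] lemma zero_apply (x : M) : (0 : S.L2Section) x = 0 := rfl

lemma integrable_inner (s t : S.L2Section) : Integrable (fun x ↦ inner 𝕜 (s x) (t x)) μ := by
  refine (s.mem.2.add t.mem.2).mono' (S.aestronglyMeasurable_inner s.mem.1 t.mem.1)
    (ae_of_all _ fun x ↦ (norm_inner_le_norm _ _).trans ?_)
  simp only [Pi.add_apply]
  nlinarith [sq_nonneg (‖s x‖ - ‖t x‖), sq_nonneg ‖s x‖, sq_nonneg ‖t x‖]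

/-- The `L²` inner product `⟪s, t⟫ = ∫ ⟪s x, t x⟫ dμ`. -/
@[reducible] def innerCore : PreInnerProductSpace.Core 𝕜 S.L2Section where
  inner s t := ∫ x, inner 𝕜 (s x) (t x) ∂μ
  conj_inner_symm s t := by
    rw [← integral_conj]
    exact integral_congr_ae (ae_of_all _ fun x ↦ inner_conj_symm _ _)
  re_inner_nonneg s := by
    rw [← integral_re (S.integrable_inner s s)]
    exact integral_nonneg fun x ↦ inner_self_nonneg
  add_left s t u := by
    rw [← integral_add (S.integrable_inner s u) (S.integrable_inner t u)]
    exact integral_congr_ae (ae_of_all _ fun x ↦ inner_add_left _ _ _)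
  smul_left s t c := by
    rw [← integral_const_mul]
    exact integral_congr_ae (ae_of_all _ fun x ↦ inner_smul_left _ _ _)

instance : SeminormedAddCommGroup S.L2Section :=
  @InnerProductSpace.Core.toSeminormedAddCommGroup 𝕜 _ _ _ _ S.innerCore

instance : InnerProductSpace 𝕜 S.L2Section := InnerProductSpace.ofCore S.innerCore

lemma inner_def (s t : S.L2Section) : inner 𝕜 s t = ∫ x, inner 𝕜 (s x) (t x) ∂μ := rfl

lemma norm_sq (s : S.L2Section) : ‖s‖ ^ 2 = ∫ x, ‖s x‖ ^ 2 ∂μ := by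
  rw [norm_sq_eq_re_inner (𝕜 := 𝕜), inner_def, ← integral_re (S.integrable_inner s s)]
  simp

lemma dist_sq (s t : S.L2Section) : dist s t ^ 2 = ∫ x, ‖s x - t x‖ ^ 2 ∂μ := by
  rw [dist_eq_norm, norm_sq]; rfl

lemma exists_ae_tendsto [∀ x, CompleteSpace (W x)] (u : ℕ → S.L2Section)
    (hu : ∀ k, dist (u k) (u (k + 1)) ≤ (1 / 2 : ℝ) ^ k) :
    ∃ g : Π x, W x, ∀ᵐ x ∂μ, Tendsto (fun k ↦ u k x) atTop (𝓝 (g x)) := by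
  have hint (k : ℕ) : Integrable (fun x ↦ ‖u k x - u (k + 1) x‖ ^ 2) μ := (u k - u (k + 1)).mem.2
  have hfin : ∀ᵐ x ∂μ, ∑' k, ENNReal.ofReal (2 ^ k * ‖u k x - u (k + 1) x‖ ^ 2) < ⊤ := by
    refine ae_lt_top' (AEMeasurable.tsum fun k ↦
      ((hint k).aemeasurable.const_mul _).ennreal_ofReal) ?_
    rw [lintegral_tsum fun k ↦ ((hint k).aemeasurable.const_mul _).ennreal_ofReal]
    have hk (k : ℕ) : ∫⁻ x, ENNReal.ofReal (2 ^ k * ‖u k x - u (k + 1) x‖ ^ 2) ∂μ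
        ≤ ENNReal.ofReal ((1 / 2 : ℝ) ^ k) := by
      rw [← ofReal_integral_eq_lintegral_ofReal ((hint k).const_mul _)
        (ae_of_all _ fun x ↦ by positivity), integral_const_mul, ← S.dist_sq]
      refine ENNReal.ofReal_le_ofReal ?_
      have : dist (u k) (u (k + 1)) ^ 2 ≤ ((1 / 2 : ℝ) ^ k) ^ 2 := by gcongr; exact hu k
      calc (2 : ℝ) ^ k * dist (u k) (u (k + 1)) ^ 2 ≤ 2 ^ k * ((1 / 2 : ℝ) ^ k) ^ 2 := by gcongr
        _ = (1 / 2 : ℝ) ^ k := by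
          rw [pow_two, ← mul_assoc, ← mul_pow]; norm_num
    refine ((ENNReal.tsum_le_tsum hk).trans_lt ?_).ne
    rw [← ENNReal.ofReal_tsum_of_nonneg (fun k ↦ by positivity) summable_geometric_two]
    exact ENNReal.ofReal_lt_top
  have hcau : ∀ᵐ x ∂μ, ∃ y, Tendsto (fun k ↦ u k x) atTop (𝓝 y) := by
    filter_upwards [hfin] with x hx
    set C := (∑' k, ENNReal.ofReal (2 ^ k * ‖u k x - u (k + 1) x‖ ^ 2)).toReal with hC
    have hb (k : ℕ) : 2 ^ k * ‖u k x - u (k + 1) x‖ ^ 2 ≤ C := by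
      have := ENNReal.le_tsum (f := fun k ↦ ENNReal.ofReal (2 ^ k * ‖u k x - u (k + 1) x‖ ^ 2)) k
      have := ENNReal.toReal_mono hx.ne this
      rwa [ENNReal.toReal_ofReal (by positivity)] at this
    have hr : √(1 / 2 : ℝ) < 1 := by
      rw [Real.sqrt_lt' one_pos]; norm_num
    refine cauchySeq_tendsto_of_complete
      (cauchySeq_of_le_geometric (√(1 / 2)) (√C) hr fun k ↦ ?_)
    rw [dist_eq_norm]
    refine le_of_sq_le_sq ?_ (by positivity)
    have hC0 : 0 ≤ C := ENNReal.toReal_nonneg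
    rw [mul_pow, ← pow_mul, mul_comm k 2, pow_mul, Real.sq_sqrt hC0,
      Real.sq_sqrt (by norm_num : (0 : ℝ) ≤ 1 / 2)]
    have h2 : (2 : ℝ) ^ k * (1 / 2) ^ k = 1 := by rw [← mul_pow]; norm_num
    have := hb k
    calc ‖u k x - u (k + 1) x‖ ^ 2 = (2 ^ k * (1 / 2) ^ k) * ‖u k x - u (k + 1) x‖ ^ 2 := by
          rw [h2, one_mul]
      _ = (2 ^ k * ‖u k x - u (k + 1) x‖ ^ 2) * (1 / 2) ^ k := by ring
      _ ≤ C * (1 / 2) ^ k := by gcongr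
  classical
  refine ⟨fun x ↦ if h : ∃ y, Tendsto (fun k ↦ u k x) atTop (𝓝 y) then h.choose else 0, ?_⟩
  filter_upwards [hcau] with x hx
  simpa only [dif_pos hx] using hx.choose_spec

instance [∀ x, CompleteSpace (W x)] : CompleteSpace S.L2Section := by
  refine Metric.complete_of_convergent_controlled_sequences (fun k ↦ (1 / 2 : ℝ) ^ k)
    (fun k ↦ by positivity) fun u hu ↦ ?_
  obtain ⟨g, hg⟩ := S.exists_ae_tendsto u fun k ↦ (hu k k (k + 1) le_rfl k.le_succ).le
  have hgS : g ∈ S.sections := S.mem_of_tendsto (fun k ↦ u k) g (fun k ↦ (u k).mem.1) hg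
  have hbound (k : ℕ) : ∫⁻ x, ENNReal.ofReal (‖u k x - g x‖ ^ 2) ∂μ
      ≤ ENNReal.ofReal (((1 / 2 : ℝ) ^ k) ^ 2) := by
    have hle : ∀ᵐ x ∂μ, ENNReal.ofReal (‖u k x - g x‖ ^ 2)
        ≤ liminf (fun m ↦ ENNReal.ofReal (‖u k x - u m x‖ ^ 2)) atTop := by
      filter_upwards [hg] with x hx
      exact (((ENNReal.continuous_ofReal.tendsto _).comp
        ((tendsto_const_nhds.sub hx).norm.pow 2)).liminf_eq).ge
    refine (lintegral_mono_ae hle).trans ((lintegral_liminf_le' fun m ↦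
      ((u k - u m).mem.2.aemeasurable).ennreal_ofReal).trans ?_)
    refine liminf_le_of_frequently_le' (Eventually.frequently ?_)
    filter_upwards [eventually_ge_atTop k] with m hm
    rw [← ofReal_integral_eq_lintegral_ofReal (u k - u m).mem.2 (ae_of_all _ fun x ↦ by positivity)]
    refine ENNReal.ofReal_le_ofReal ?_
    simp only [sub_apply]
    rw [← S.dist_sq]
    gcongr
    exact (hu k k m le_rfl hm).le
  have hint (k : ℕ) : Integrable (fun x ↦ ‖u k x - g x‖ ^ 2) μ := by
    have hm : AEStronglyMeasurable (fun x ↦ ‖u k x - g x‖ ^ 2) μ :=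
      (S.aestronglyMeasurable_norm _ (S.sections.sub_mem (u k).mem.1 hgS)).pow 2
    refine ⟨hm, ?_⟩
    rw [hasFiniteIntegral_iff_ofReal (ae_of_all _ fun x ↦ by positivity)]
    exact (hbound k).trans_lt ENNReal.ofReal_lt_top
  have hd (k : ℕ) : (⇑(u k) - g : Π x, W x) ∈ S.squareIntegrable :=
    ⟨S.sections.sub_mem (u k).mem.1 hgS, hint k⟩
  have hgmem : g ∈ S.squareIntegrable := by
    have := S.squareIntegrable.sub_mem (u 0).mem (hd 0)
    rwa [sub_sub_cancel] at this
  refine ⟨S.ofMem g hgmem, ?_⟩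
  rw [tendsto_iff_dist_tendsto_zero]
  refine squeeze_zero (fun _ ↦ dist_nonneg) (fun k ↦ ?_)
    (tendsto_pow_atTop_nhds_zero_of_lt_one (r := (1 / 2 : ℝ)) (by norm_num) (by norm_num))
  refine le_of_sq_le_sq ?_ (by positivity)
  rw [S.dist_sq]
  have := hbound k
  rwa [← ofReal_integral_eq_lintegral_ofReal (hint k) (ae_of_all _ fun x ↦ by positivity),
    ENNReal.ofReal_le_ofReal_iff (by positivity)] at this

/-- The Hilbert space `L²`: square integrable sections modulo equality almost everywhere (which is
the same as `L²`-distance zero). -/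
abbrev L2 : Type _ := SeparationQuotient S.L2Section

end MeasurableField
end Field

section Volume
variable (n : ℕ) (M : Type*) [TopologicalSpace M] [ChartedSpace (EuclideanSpace ℝ (Fin n)) M]
  [MeasurableSpace M]
  [RiemannianBundle (fun x : M ↦ TangentSpace (𝓡 n) x)]

variable {M} in
/-- The matrix `g_{ij}(y) = g(∂_i, ∂_j)` of the Riemannian metric in the chart at `p`, where `∂_i` is
the `i`-th coordinate vector field of that chart. -/
def chartGram (p : M) (y : EuclideanSpace ℝ (Fin n)) : Matrix (Fin n) (Fin n) ℝ :=
  let φ := (extChartAt (𝓡 n) p).symm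
  Matrix.of fun i j ↦ inner ℝ
    (mfderiv 𝓘(ℝ, EuclideanSpace ℝ (Fin n)) (𝓡 n) φ y (EuclideanSpace.single i (1 : ℝ)))
    (mfderiv 𝓘(ℝ, EuclideanSpace ℝ (Fin n)) (𝓡 n) φ y (EuclideanSpace.single j (1 : ℝ)))

variable {M} in
/-- The measure `√(det g_{ij}) dy¹ ⋯ dyⁿ` of the chart at `p`, as a measure on `M` that is
concentrated on the domain of the chart. -/
def chartVolume (p : M) : Measure M :=
  (((volume : Measure (EuclideanSpace ℝ (Fin n))).restrict (extChartAt (𝓡 n) p).target).withDensity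
    fun y ↦ ENNReal.ofReal √(chartGram n p y).det).map (extChartAt (𝓡 n) p).symm

/-- The Riemannian volume measure: the least measure dominating all the chart measures
`√(det g_{ij}) dy¹ ⋯ dyⁿ`. As these agree on overlaps of charts, it is the measure that restricts to
`√(det g_{ij}) dy¹ ⋯ dyⁿ` on each chart domain. -/
def riemannianVolume : Measure M := ⨆ p : M, chartVolume n p

end Volume

section Bundle
variable {M : Type*} [TopologicalSpace M] [MeasurableSpace M] (μ : Measure M)
  (F : Type*) [NormedAddCommGroup F] [NormedSpace ℝ F]
  {V : M → Type*} [TopologicalSpace (TotalSpace F V)] [∀ x, TopologicalSpace (V x)]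
  [FiberBundle F V]

/-- A section is measurable if its coefficients in every trivialization of the bundle are (Lebesgue,
i.e. `μ`-almost everywhere) measurable. -/
def IsMeasurableSection (s : Π x, V x) : Prop :=
  ∀ (e : Trivialization F (π F V)) [MemTrivializationAtlas e],
    AEStronglyMeasurable (fun x ↦ (e ⟨x, s x⟩).2) (μ.restrict e.baseSet)
end Bundle

lemma aestronglyMeasurable_of_nhds {M : Type*} [TopologicalSpace M] [SecondCountableTopology M]
    [MeasurableSpace M] {μ : Measure M} {f : M → ℝ} (U : M → Set M) (hU : ∀ p, U p ∈ 𝓝 p)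
    (h : ∀ p, AEStronglyMeasurable f (μ.restrict (U p))) : AEStronglyMeasurable f μ := by
  obtain ⟨t, htc, ht⟩ := TopologicalSpace.countable_cover_nhds hU
  have := htc.to_subtype
  rw [← Measure.restrict_univ (μ := μ), ← ht, biUnion_eq_iUnion, aestronglyMeasurable_iUnion_iff]
  exact fun p ↦ h p

section SectionField
variable (𝕜 : Type*) [RCLike 𝕜] {M : Type*} [TopologicalSpace M] [MeasurableSpace M] [BorelSpace M] (μ : Measure M)
  (F : Type*) [NormedAddCommGroup F] [NormedSpace ℝ F] [NormedSpace 𝕜 F] [IsScalarTower ℝ 𝕜 F]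
  [FiniteDimensional ℝ F]
  (V : M → Type*) [TopologicalSpace (TotalSpace F V)] [∀ x, NormedAddCommGroup (V x)]
  [∀ x, InnerProductSpace ℝ (V x)] [∀ x, InnerProductSpace 𝕜 (V x)]
  [∀ x, IsScalarTower ℝ 𝕜 (V x)]
  [FiberBundle F V] [VectorBundle ℝ F V] [VectorBundle 𝕜 F V] [IsContinuousRiemannianBundle F V]

variable {μ F V}

lemma aestronglyMeasurable_norm_restrict (e : Trivialization F (π F V)) [MemTrivializationAtlas e]
    {U : Set M} (hU : MeasurableSet U) (hUe : U ⊆ e.baseSet) {s : Π x, V x}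
    (hs : AEStronglyMeasurable (fun x ↦ (e ⟨x, s x⟩).2) (μ.restrict U)) :
    AEStronglyMeasurable (fun x ↦ ‖s x‖) (μ.restrict U) := by
  borelize F
  have : SecondCountableTopology F := by
    have := FiniteDimensional.proper_real F
    infer_instance
  let N : M × F → ℝ := fun p ↦ ‖(e.toOpenPartialHomeomorph.symm p).2‖
  have hnorm : Continuous fun q : TotalSpace F V ↦ ‖q.2‖ := by
    have h : Continuous fun q : TotalSpace F V ↦ inner ℝ q.2 q.2 :=
      Continuous.inner_bundle (F := F) (E := V) (b := fun q : TotalSpace F V ↦ q.1)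
        (v := fun q ↦ q.2) (w := fun q ↦ q.2) continuous_id continuous_id
    simpa only [norm_eq_sqrt_real_inner] using h.sqrt
  have hN : ContinuousOn N (e.baseSet ×ˢ univ) := by
    rw [← e.target_eq]
    exact hnorm.comp_continuousOn e.toOpenPartialHomeomorph.continuousOn_symm
  have hmeas : MeasurableSet (e.baseSet ×ˢ (univ : Set F)) :=
    (e.open_baseSet.prod isOpen_univ).measurableSet
  classical
  have hN' : Measurable ((e.baseSet ×ˢ (univ : Set F)).piecewise N fun _ ↦ 0) :=
    hN.measurable_piecewise continuousOn_const hmeas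
  have hc : AEMeasurable (fun x ↦ (x, (e ⟨x, s x⟩).2)) (μ.restrict U) :=
    aemeasurable_id.prodMk hs.aemeasurable
  refine ((hN'.comp_aemeasurable hc).congr ?_).aestronglyMeasurable
  filter_upwards [ae_restrict_mem hU] with x hx
  have hxe : x ∈ e.baseSet := hUe hx
  simp only [Function.comp_apply]
  rw [piecewise_eq_of_mem _ _ _ (by simpa using hxe)]
  have : e.toOpenPartialHomeomorph.symm (x, (e ⟨x, s x⟩).2) = ⟨x, s x⟩ := by
    have h1 : ((x, (e ⟨x, s x⟩).2) : M × F) = e ⟨x, s x⟩ := e.mk_proj_snd' (x := ⟨x, s x⟩) hxe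
    rw [h1]
    exact e.left_inv (e.mem_source.2 hxe)
  change ‖(e.toOpenPartialHomeomorph.symm (x, (e ⟨x, s x⟩).2)).2‖ = ‖s x‖
  rw [this]

end SectionField

lemma finiteDimensional_fiber (F : Type*) [NormedAddCommGroup F] [NormedSpace ℝ F]
    [FiniteDimensional ℝ F] {M : Type*} [TopologicalSpace M] {V : M → Type*}
    [TopologicalSpace (TotalSpace F V)] [∀ x, NormedAddCommGroup (V x)]
    [∀ x, NormedSpace ℝ (V x)] [FiberBundle F V] [VectorBundle ℝ F V] (x : M) :
    FiniteDimensional ℝ (V x) := by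
  have e := (trivializationAt F V x).continuousLinearEquivAt ℝ x
    (FiberBundle.mem_baseSet_trivializationAt' x)
  exact e.symm.toLinearEquiv.finiteDimensional

lemma completeSpace_fiber (F : Type*) [NormedAddCommGroup F] [NormedSpace ℝ F]
    [FiniteDimensional ℝ F] {M : Type*} [TopologicalSpace M] {V : M → Type*}
    [TopologicalSpace (TotalSpace F V)] [∀ x, NormedAddCommGroup (V x)]
    [∀ x, NormedSpace ℝ (V x)] [FiberBundle F V] [VectorBundle ℝ F V] (x : M) :
    CompleteSpace (V x) :=
  have := finiteDimensional_fiber F (V := V) x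
  FiniteDimensional.complete ℝ (V x)


lemma sum_norm_sq_eq_trace {T V ι κ : Type*} [Fintype ι] [Fintype κ] [DecidableEq ι]
    [NormedAddCommGroup T] [InnerProductSpace ℝ T] [NormedAddCommGroup V] [InnerProductSpace ℝ V]
    (A : T →L[ℝ] V) (e : OrthonormalBasis κ ℝ T) (b : Module.Basis ι ℝ T) :
    ∑ k, ‖A (e k)‖ ^ 2 =
      ((Matrix.of fun i j ↦ inner ℝ (b i) (b j))⁻¹ *
        (Matrix.of fun i j ↦ inner ℝ (A (b i)) (A (b j)))).trace := by
  classical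
  set C := e.toBasis.toMatrix b
  set D := b.toMatrix e.toBasis
  set L : Matrix κ κ ℝ := Matrix.of fun k l ↦ inner ℝ (A (e k)) (A (e l))
  have hCD : C * D = 1 := Module.Basis.toMatrix_mul_toMatrix_flip _ _
  have hDC : D * C = 1 := Module.Basis.toMatrix_mul_toMatrix_flip _ _
  have hC (k : κ) (i : ι) : C k i = inner ℝ (e k) (b i) := by
    simp [C, Module.Basis.toMatrix_apply, OrthonormalBasis.repr_apply_apply]
  have hb (i : ι) : A (b i) = ∑ k, C k i • A (e k) := by
    conv_lhs => rw [← e.sum_repr' (b i)]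
    simp [hC]
  have hG : (Matrix.of fun i j ↦ inner ℝ (b i) (b j)) = Cᵀ * C := by
    ext i j
    simp only [Matrix.of_apply, Matrix.mul_apply, Matrix.transpose_apply, hC]
    rw [← e.sum_inner_mul_inner]
    simp_rw [real_inner_comm]
  have hK : (Matrix.of fun i j ↦ inner ℝ (A (b i)) (A (b j))) = Cᵀ * L * C := by
    ext i j
    simp only [Matrix.of_apply, Matrix.mul_apply, Matrix.transpose_apply, hb, L, sum_inner,
      inner_sum, real_inner_smul_left, real_inner_smul_right, Finset.sum_mul]
    refine Finset.sum_congr rfl fun _ _ ↦ Finset.sum_congr rfl fun _ _ ↦ by ring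
  have hinv : (Cᵀ * C)⁻¹ = D * Dᵀ := by
    refine Matrix.inv_eq_right_inv ?_
    rw [Matrix.mul_assoc, ← Matrix.mul_assoc C, hCD, Matrix.one_mul, ← Matrix.transpose_mul, hDC,
      Matrix.transpose_one]
  rw [hG, hK, hinv]
  have : D * Dᵀ * (Cᵀ * L * C) = D * (L * C) := by
    calc D * Dᵀ * (Cᵀ * L * C) = D * ((Dᵀ * Cᵀ) * (L * C)) := by simp only [Matrix.mul_assoc]
      _ = _ := by rw [← Matrix.transpose_mul, hCD, Matrix.transpose_one, Matrix.one_mul]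
  rw [this, Matrix.trace_mul_comm, Matrix.mul_assoc, hCD, Matrix.mul_one]
  simp [Matrix.trace, L]

section FormField
variable (n : ℕ) {M : Type*} [TopologicalSpace M] [ChartedSpace (EuclideanSpace ℝ (Fin n)) M]
  [RiemannianBundle (fun x : M ↦ TangentSpace (𝓡 n) x)]
  (V : M → Type*) [∀ x, NormedAddCommGroup (V x)]
  [∀ x, InnerProductSpace ℝ (V x)]

/-- The fibre at `x` of `T*M ⊗ V`, that is, the space of linear maps `T_x M → V_x`. It gets its own
name because it carries the tensor product (Hilbert-Schmidt) inner product of `g` and `h` and not the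
operator norm. -/
def CotangentTensor (x : M) : Type _ := TangentSpace (𝓡 n) x →L[ℝ] V x

instance (x : M) : AddCommGroup (CotangentTensor n V x) :=
  inferInstanceAs (AddCommGroup (TangentSpace (𝓡 n) x →L[ℝ] V x))

instance (𝕜 : Type*) [RCLike 𝕜] [∀ x, InnerProductSpace 𝕜 (V x)] [∀ x, IsScalarTower ℝ 𝕜 (V x)]
    (x : M) : Module 𝕜 (CotangentTensor n V x) :=
  inferInstanceAs (Module 𝕜 (TangentSpace (𝓡 n) x →L[ℝ] V x))

variable {n V} in
/-- An element of the fibre of `T*M ⊗ V` as a linear map. -/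
def CotangentTensor.toCLM {x : M} (A : CotangentTensor n V x) : TangentSpace (𝓡 n) x →L[ℝ] V x := A

variable {n V} in
/-- A linear map as an element of the fibre of `T*M ⊗ V`. -/
def CotangentTensor.ofCLM {x : M} (A : TangentSpace (𝓡 n) x →L[ℝ] V x) : CotangentTensor n V x := A

instance (x : M) : FiniteDimensional ℝ (TangentSpace (𝓡 n) x) :=
  inferInstanceAs (FiniteDimensional ℝ (EuclideanSpace ℝ (Fin n)))


/-- The inner product `⟪A, B⟫ = ∑ i, h(A e_i, B e_i)` of `T*_x M ⊗ V_x`, where `e_i` is an orthonormal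
basis of `(T_x M, g_x)`. -/
@[reducible] def CotangentTensor.innerCore (x : M) :
    InnerProductSpace.Core ℝ (CotangentTensor n V x) where
  inner A B := ∑ i, inner ℝ (A.toCLM (stdOrthonormalBasis ℝ (TangentSpace (𝓡 n) x) i))
    (B.toCLM (stdOrthonormalBasis ℝ (TangentSpace (𝓡 n) x) i))
  conj_inner_symm A B := by simp [real_inner_comm]
  re_inner_nonneg A := by
    rw [RCLike.re_to_real]
    exact Finset.sum_nonneg fun i _ ↦ real_inner_self_nonneg
  add_left A B C := by
    rw [← Finset.sum_add_distrib]
    exact Finset.sum_congr rfl fun i _ ↦ inner_add_left _ _ _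
  smul_left A B c := by
    rw [Finset.mul_sum]
    exact Finset.sum_congr rfl fun i _ ↦ inner_smul_left _ _ _
  definite A hA := by
    have h := (Finset.sum_eq_zero_iff_of_nonneg fun i _ ↦ real_inner_self_nonneg).1 hA
    have h0 : A.toCLM.toLinearMap = 0 :=
      (stdOrthonormalBasis ℝ (TangentSpace (𝓡 n) x)).toBasis.ext fun i ↦ by
        simpa using h i (Finset.mem_univ i)
    exact ContinuousLinearMap.coe_injective h0

instance (x : M) : NormedAddCommGroup (CotangentTensor n V x) :=
  @InnerProductSpace.Core.toNormedAddCommGroup ℝ _ _ _ _ (CotangentTensor.innerCore n V x)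

variable {n V} in
lemma CotangentTensor.norm_sq {x : M} (A : CotangentTensor n V x) :
    ‖A‖ ^ 2 = ∑ i, ‖A.toCLM (stdOrthonormalBasis ℝ (TangentSpace (𝓡 n) x) i)‖ ^ 2 := by
  have h : ‖A‖ = √(RCLike.re (∑ i, inner ℝ
    (A.toCLM (stdOrthonormalBasis ℝ (TangentSpace (𝓡 n) x) i))
    (A.toCLM (stdOrthonormalBasis ℝ (TangentSpace (𝓡 n) x) i)))) := rfl
  rw [h, RCLike.re_to_real, Real.sq_sqrt (Finset.sum_nonneg fun i _ ↦ real_inner_self_nonneg)]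
  simp

/-- The same inner product `⟪A, B⟫ = ∑ i, h(A e_i, B e_i)` with values in `𝕜`. -/
instance (𝕜 : Type*) [RCLike 𝕜] [∀ x, InnerProductSpace 𝕜 (V x)] [∀ x, IsScalarTower ℝ 𝕜 (V x)]
    (x : M) : InnerProductSpace 𝕜 (CotangentTensor n V x) where
  norm_smul_le c A := by
    refine le_of_sq_le_sq ?_ (by positivity)
    rw [mul_pow, CotangentTensor.norm_sq, CotangentTensor.norm_sq, Finset.mul_sum]
    refine Finset.sum_le_sum fun i _ ↦ le_of_eq ?_
    rw [← mul_pow, ← norm_smul]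
    rfl
  inner A B := ∑ i, inner 𝕜 (A.toCLM (stdOrthonormalBasis ℝ (TangentSpace (𝓡 n) x) i))
    (B.toCLM (stdOrthonormalBasis ℝ (TangentSpace (𝓡 n) x) i))
  norm_sq_eq_re_inner A := by
    rw [CotangentTensor.norm_sq, map_sum]
    exact Finset.sum_congr rfl fun i _ ↦ by simp
  conj_inner_symm A B := by simp [inner_conj_symm]
  add_left A B C := by
    rw [← Finset.sum_add_distrib]
    exact Finset.sum_congr rfl fun i _ ↦ inner_add_left _ _ _
  smul_left A B c := by
    rw [Finset.mul_sum]
    exact Finset.sum_congr rfl fun i _ ↦ inner_smul_left _ _ _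

end FormField

lemma aestronglyMeasurable_inner_restrict {M : Type*} [TopologicalSpace M] [MeasurableSpace M]
    [BorelSpace M] {μ : Measure M} {F : Type*} [NormedAddCommGroup F] [NormedSpace ℝ F]
    [FiniteDimensional ℝ F] (V : M → Type*) [TopologicalSpace (TotalSpace F V)]
    [∀ x, NormedAddCommGroup (V x)] [∀ x, InnerProductSpace ℝ (V x)] [FiberBundle F V]
    [VectorBundle ℝ F V] [IsContinuousRiemannianBundle F V] (e : Trivialization F (π F V)) [MemTrivializationAtlas e]
    {U : Set M} (hU : MeasurableSet U) (hUe : U ⊆ e.baseSet) {s t : Π x, V x}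
    (hs : AEStronglyMeasurable (fun x ↦ e.continuousLinearMapAt ℝ x (s x)) (μ.restrict U))
    (ht : AEStronglyMeasurable (fun x ↦ e.continuousLinearMapAt ℝ x (t x)) (μ.restrict U)) :
    AEStronglyMeasurable (fun x ↦ inner ℝ (s x) (t x)) (μ.restrict U) := by
  have key (u : Π x, V x)
      (hu : AEStronglyMeasurable (fun x ↦ e.continuousLinearMapAt ℝ x (u x)) (μ.restrict U)) :
      AEStronglyMeasurable (fun x ↦ ‖u x‖) (μ.restrict U) := by
    refine aestronglyMeasurable_norm_restrict e hU hUe (hu.congr ?_)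
    filter_upwards [ae_restrict_mem hU] with x hx
    rw [Trivialization.continuousLinearMapAt_apply, Trivialization.coe_linearMapAt_of_mem e (hUe hx)]
  have h1 := key (s + t) (by simpa [Pi.add_def] using hs.add ht)
  have h2 := key (s - t) (by simpa [Pi.sub_def] using hs.sub ht)
  have h : (fun x ↦ inner ℝ (s x) (t x)) =
      fun x ↦ (‖(s + t) x‖ ^ 2 - ‖(s - t) x‖ ^ 2) / 4 := by
    funext x
    rw [Pi.add_apply, Pi.sub_apply, norm_add_sq_real, norm_sub_sq_real]
    ring
  rw [h]
  exact ((h1.pow 2).sub (h2.pow 2)).div₀ aestronglyMeasurable_const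

section FormFieldMeas
variable (𝕜 : Type*) [RCLike 𝕜] (n : ℕ) {M : Type*} [TopologicalSpace M]
  [ChartedSpace (EuclideanSpace ℝ (Fin n)) M] [IsManifold (𝓡 n) ∞ M]
  [MeasurableSpace M] (μ : Measure M)
  (F : Type*) [NormedAddCommGroup F] [NormedSpace ℝ F] [NormedSpace 𝕜 F] [IsScalarTower ℝ 𝕜 F]
  (V : M → Type*) [TopologicalSpace (TotalSpace F V)] [∀ x, NormedAddCommGroup (V x)]
  [∀ x, InnerProductSpace ℝ (V x)] [∀ x, InnerProductSpace 𝕜 (V x)]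
  [∀ x, IsScalarTower ℝ 𝕜 (V x)]
  [FiberBundle F V] [VectorBundle ℝ F V] [VectorBundle 𝕜 F V]

/-- Measurability of sections of `T*M ⊗ V = Hom(TM, V)`, through the trivializations of that bundle. -/
def IsMeasurableForm (α : Π x : M, CotangentTensor n V x) : Prop :=
  IsMeasurableSection μ (EuclideanSpace ℝ (Fin n) →L[ℝ] F)
    (V := fun x ↦ TangentSpace (𝓡 n) x →L[ℝ] V x) fun x ↦ (α x).toCLM

variable {n μ F V}

lemma isMeasurableForm_iff (α : Π x : M, CotangentTensor n V x) :
    IsMeasurableForm n μ F V α ↔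
      ∀ (e₁ : Trivialization (EuclideanSpace ℝ (Fin n))
          (π (EuclideanSpace ℝ (Fin n)) (fun x : M ↦ TangentSpace (𝓡 n) x)))
        (e₂ : Trivialization F (π F V)) [MemTrivializationAtlas e₁] [MemTrivializationAtlas e₂],
        AEStronglyMeasurable (fun x ↦ (e₂.continuousLinearMapAt ℝ x).comp
          ((α x).toCLM.comp (e₁.symmL ℝ x))) (μ.restrict (e₁.baseSet ∩ e₂.baseSet)) := by
  constructor
  · intro h e₁ e₂ _ _
    exact h (e₁.continuousLinearMap (RingHom.id ℝ) e₂)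
  · intro h e he
    obtain ⟨e', ⟨e₁, e₂, h₁, h₂, rfl⟩, rfl⟩ := he.out
    exact h e₁ e₂

variable [BorelSpace M] [SecondCountableTopology M] [FiniteDimensional ℝ F]
  [RiemannianBundle (fun x : M ↦ TangentSpace (𝓡 n) x)]
  [IsContinuousRiemannianBundle (EuclideanSpace ℝ (Fin n)) (fun x : M ↦ TangentSpace (𝓡 n) x)]
  [IsContinuousRiemannianBundle F V]

lemma aestronglyMeasurable_norm_form (α : Π x : M, CotangentTensor n V x)
    (hα : IsMeasurableForm n μ F V α) : AEStronglyMeasurable (fun x ↦ ‖α x‖) μ := by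
  rw [isMeasurableForm_iff] at hα
  let E := EuclideanSpace ℝ (Fin n)
  let e₁ (p : M) := trivializationAt E (fun x : M ↦ TangentSpace (𝓡 n) x) p
  let e₂ (p : M) := trivializationAt F V p
  refine aestronglyMeasurable_of_nhds (fun p ↦ (e₁ p).baseSet ∩ (e₂ p).baseSet)
    (fun p ↦ (((e₁ p).open_baseSet.inter (e₂ p).open_baseSet).mem_nhds
        ⟨FiberBundle.mem_baseSet_trivializationAt' p,
          FiberBundle.mem_baseSet_trivializationAt' p⟩)) fun p ↦ ?_
  set U := (e₁ p).baseSet ∩ (e₂ p).baseSet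
  have hU : MeasurableSet U := ((e₁ p).open_baseSet.inter (e₂ p).open_baseSet).measurableSet
  let b (i : Fin n) (x : M) : TangentSpace (𝓡 n) x :=
    (e₁ p).symmL ℝ x (EuclideanSpace.single i (1 : ℝ))
  have hG (i j : Fin n) :
      AEStronglyMeasurable (fun x ↦ inner ℝ (b i x) (b j x)) (μ.restrict U) := by
    have hb (i : Fin n) : AEStronglyMeasurable
        (fun x ↦ (e₁ p).continuousLinearMapAt ℝ x (b i x)) (μ.restrict U) := by
      refine (aestronglyMeasurable_const (b := (EuclideanSpace.single i (1 : ℝ) : E))).congr ?_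
      filter_upwards [ae_restrict_mem hU] with x hx
      exact ((e₁ p).continuousLinearMapAt_symmL hx.1 _).symm
    exact aestronglyMeasurable_inner_restrict _ (e₁ p) hU inter_subset_left (hb i) (hb j)
  have hK (i j : Fin n) : AEStronglyMeasurable
      (fun x ↦ inner ℝ ((α x).toCLM (b i x)) ((α x).toCLM (b j x))) (μ.restrict U) := by
    have hb (i : Fin n) : AEStronglyMeasurable
        (fun x ↦ (e₂ p).continuousLinearMapAt ℝ x ((α x).toCLM (b i x))) (μ.restrict U) :=
      (ContinuousLinearMap.apply ℝ F (EuclideanSpace.single i (1 : ℝ))).continuous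
        |>.comp_aestronglyMeasurable (hα (e₁ p) (e₂ p))
    exact aestronglyMeasurable_inner_restrict _ (e₂ p) hU inter_subset_right (hb i) (hb j)
  let G (x : M) : Matrix (Fin n) (Fin n) ℝ := Matrix.of fun i j ↦ inner ℝ (b i x) (b j x)
  let K (x : M) : Matrix (Fin n) (Fin n) ℝ :=
    Matrix.of fun i j ↦ inner ℝ ((α x).toCLM (b i x)) ((α x).toCLM (b j x))
  have hGm : AEMeasurable (fun x i j ↦ G x i j) (μ.restrict U) :=
    aemeasurable_pi_lambda _ fun i ↦ aemeasurable_pi_lambda _ fun j ↦ (hG i j).aemeasurable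
  have hof : Continuous fun m : Fin n → Fin n → ℝ ↦ Matrix.of m := continuous_id
  have hdet : AEMeasurable (fun x ↦ (G x).det) (μ.restrict U) :=
    hof.matrix_det.measurable.comp_aemeasurable hGm
  have hadj (i j : Fin n) : AEMeasurable (fun x ↦ (G x).adjugate i j) (μ.restrict U) :=
    (hof.matrix_adjugate.matrix_elem i j).measurable.comp_aemeasurable hGm
  have htr : AEMeasurable (fun x ↦ ((G x)⁻¹ * K x).trace) (μ.restrict U) := by
    simp only [Matrix.trace, Matrix.diag, Matrix.mul_apply, Matrix.inv_def, Ring.inverse_eq_inv',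
      Matrix.smul_apply, smul_eq_mul]
    refine Finset.aemeasurable_fun_sum _ fun i _ ↦ Finset.aemeasurable_fun_sum _ fun j _ ↦ ?_
    exact (hdet.inv.mul (hadj i j)).mul (hK j i).aemeasurable
  refine (htr.sqrt.congr ?_).aestronglyMeasurable
  filter_upwards [ae_restrict_mem hU] with x hx
  let bas : Module.Basis (Fin n) ℝ (TangentSpace (𝓡 n) x) :=
    (EuclideanSpace.basisFun (Fin n) ℝ).toBasis.map
      ((e₁ p).continuousLinearEquivAt ℝ x hx.1).symm.toLinearEquiv
  have hbas (i : Fin n) : bas i = b i x := by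
    simp [bas, b, (e₁ p).symmL_apply hx.1]
  have h := sum_norm_sq_eq_trace (α x).toCLM (stdOrthonormalBasis ℝ (TangentSpace (𝓡 n) x)) bas
  rw [← CotangentTensor.norm_sq] at h
  simp only [hbas] at h
  change √(((G x)⁻¹ * K x).trace) = ‖α x‖
  rw [← Real.sqrt_sq (norm_nonneg (α x)), h]

end FormFieldMeas

lemma isContinuousRiemannianBundle (n : ℕ) {M : Type*} [TopologicalSpace M]
    [ChartedSpace (EuclideanSpace ℝ (Fin n)) M]
    (F : Type*) [NormedAddCommGroup F] [NormedSpace ℝ F]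
    (V : M → Type*) [TopologicalSpace (TotalSpace F V)] [∀ x, NormedAddCommGroup (V x)]
    [∀ x, InnerProductSpace ℝ (V x)] [FiberBundle F V] [VectorBundle ℝ F V]
    [h : IsContMDiffRiemannianBundle (𝓡 n) ∞ F V] : IsContinuousRiemannianBundle F V := by
  obtain ⟨g, hg, hg'⟩ := h.exists_contMDiff
  exact ⟨g, hg.continuous, hg'⟩

/-- The composition `g ∘ f` of unbounded operators, with its natural domain
`{x ∈ dom f | f x ∈ dom g}`. -/
def compUnbounded {R A B C : Type*} [Ring R] [AddCommGroup A] [Module R A] [AddCommGroup B]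
    [Module R B] [AddCommGroup C] [Module R C] (g : B →ₗ.[R] C) (f : A →ₗ.[R] B) : A →ₗ.[R] C :=
  g.comp (f.domRestrict ((g.domain.comap f.toFun).map f.domain.subtype)) fun x ↦ by
    obtain ⟨y, hy, hyx⟩ := Submodule.mem_map.1 x.2.1
    rw [LinearPMap.domRestrict_apply (y := y) hyx.symm]
    exact hy

section Operators
variable (𝕜 : Type*) [RCLike 𝕜] (n : ℕ) {M : Type*} [TopologicalSpace M]
  [ChartedSpace (EuclideanSpace ℝ (Fin n)) M] [IsManifold (𝓡 n) ∞ M]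
  [SecondCountableTopology M] [MeasurableSpace M] [BorelSpace M] (μ : Measure M)
  [RiemannianBundle (fun x : M ↦ TangentSpace (𝓡 n) x)]
  [IsContMDiffRiemannianBundle (𝓡 n) ∞ (EuclideanSpace ℝ (Fin n))
    (fun x : M ↦ TangentSpace (𝓡 n) x)]
  (F : Type*) [NormedAddCommGroup F] [NormedSpace ℝ F] [NormedSpace 𝕜 F] [IsScalarTower ℝ 𝕜 F]
  [FiniteDimensional ℝ F]
  (V : M → Type*) [TopologicalSpace (TotalSpace F V)] [∀ x, NormedAddCommGroup (V x)]
  [∀ x, InnerProductSpace ℝ (V x)] [∀ x, InnerProductSpace 𝕜 (V x)]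
  [∀ x, IsScalarTower ℝ 𝕜 (V x)]
  [FiberBundle F V] [VectorBundle ℝ F V] [VectorBundle 𝕜 F V]
  [IsContMDiffRiemannianBundle (𝓡 n) ∞ F V]

/-- The measurable sections of `V`. -/
def sectionField : MeasurableField 𝕜 μ V where
  sections :=
    { carrier := {s | IsMeasurableSection μ F s}
      zero_mem' := fun e _ ↦ by
        refine (aestronglyMeasurable_const (b := (0 : F))).congr ?_
        filter_upwards [ae_restrict_mem e.open_baseSet.measurableSet] with x hx
        exact ((e.linear ℝ hx).map_zero).symm
      add_mem' := fun {s t} hs ht e _ ↦ by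
        refine ((hs e).add (ht e)).congr ?_
        filter_upwards [ae_restrict_mem e.open_baseSet.measurableSet] with x hx
        exact ((e.linear ℝ hx).map_add (s x) (t x)).symm
      smul_mem' := fun c s hs e _ ↦ by
        refine ((hs e).const_smul c).congr ?_
        filter_upwards [ae_restrict_mem e.open_baseSet.measurableSet] with x hx
        exact ((e.linear 𝕜 hx).map_smul c (s x)).symm }
  aestronglyMeasurable_norm s hs :=
    have := isContinuousRiemannianBundle n F V
    aestronglyMeasurable_of_nhds (fun p ↦ (trivializationAt F V p).baseSet)
      (fun p ↦ (trivializationAt F V p).open_baseSet.mem_nhds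
        (FiberBundle.mem_baseSet_trivializationAt' p))
      fun p ↦ aestronglyMeasurable_norm_restrict _
        (trivializationAt F V p).open_baseSet.measurableSet subset_rfl (hs _)
  mem_of_tendsto f g hf hg e _ := by
    refine aestronglyMeasurable_of_tendsto_ae atTop (fun k ↦ hf k e) ?_
    filter_upwards [ae_restrict_of_ae hg, ae_restrict_mem e.open_baseSet.measurableSet] with x hx hxe
    have hc := ((e.continuousLinearMapAt ℝ x).continuous.tendsto (g x)).comp hx
    simpa only [Function.comp_def, Trivialization.continuousLinearMapAt_apply,
      Trivialization.coe_linearMapAt_of_mem e hxe] using hc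

/-- The measurable sections of `T*M ⊗ V`. -/
def formField : MeasurableField 𝕜 μ (CotangentTensor n V) where
  sections :=
    { carrier := {α | IsMeasurableForm n μ F V α}
      zero_mem' := (isMeasurableForm_iff _).2 fun e₁ e₂ _ _ ↦ by
        refine (aestronglyMeasurable_const
          (b := (0 : EuclideanSpace ℝ (Fin n) →L[ℝ] F))).congr (ae_of_all _ fun x ↦ ?_)
        ext v
        exact (map_zero (e₂.continuousLinearMapAt ℝ x)).symm
      add_mem' := fun {α β} hα hβ ↦ (isMeasurableForm_iff _).2 fun e₁ e₂ _ _ ↦ by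
        refine (((isMeasurableForm_iff α).1 hα e₁ e₂).add
          ((isMeasurableForm_iff β).1 hβ e₁ e₂)).congr (ae_of_all _ fun x ↦ ?_)
        ext v
        exact (map_add (e₂.continuousLinearMapAt ℝ x) _ _).symm
      smul_mem' := fun c α hα ↦ (isMeasurableForm_iff _).2 fun e₁ e₂ _ _ ↦ by
        refine (((isMeasurableForm_iff α).1 hα e₁ e₂).const_smul c).congr ?_
        filter_upwards [ae_restrict_mem (e₁.open_baseSet.inter e₂.open_baseSet).measurableSet]
          with x hx
        ext v
        change c • e₂.continuousLinearMapAt ℝ x ((α x).toCLM (e₁.symmL ℝ x v)) =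
          e₂.continuousLinearMapAt ℝ x (c • (α x).toCLM (e₁.symmL ℝ x v))
        simp only [Trivialization.continuousLinearMapAt_apply,
          Trivialization.coe_linearMapAt_of_mem e₂ hx.2]
        exact ((e₂.linear 𝕜 hx.2).map_smul c _).symm }
  aestronglyMeasurable_norm α hα :=
    have := isContinuousRiemannianBundle n F V
    have := isContinuousRiemannianBundle n (EuclideanSpace ℝ (Fin n))
      (fun x : M ↦ TangentSpace (𝓡 n) x)
    aestronglyMeasurable_norm_form α hα
  mem_of_tendsto f α hf hα := (isMeasurableForm_iff _).2 fun e₁ e₂ _ _ ↦ by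
    refine aestronglyMeasurable_of_tendsto_ae atTop
      (fun k ↦ (isMeasurableForm_iff (f k)).1 (hf k) e₁ e₂) (ae_restrict_of_ae ?_)
    filter_upwards [hα] with x hx
    have := finiteDimensional_fiber F (V := V) x
    have : FiniteDimensional ℝ (CotangentTensor n V x) :=
      inferInstanceAs (FiniteDimensional ℝ (TangentSpace (𝓡 n) x →L[ℝ] V x))
    let Φ : CotangentTensor n V x →ₗ[ℝ] (EuclideanSpace ℝ (Fin n) →L[ℝ] F) :=
      { toFun A := (e₂.continuousLinearMapAt ℝ x).comp (A.toCLM.comp (e₁.symmL ℝ x))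
        map_add' A B := by
          ext v
          exact map_add (e₂.continuousLinearMapAt ℝ x) _ _
        map_smul' c A := by
          ext v
          exact map_smul (e₂.continuousLinearMapAt ℝ x) c _ }
    exact (Φ.continuous_of_finiteDimensional.tendsto _).comp hx

instance : CompleteSpace (sectionField 𝕜 n μ F V).L2Section :=
  have := completeSpace_fiber F (V := V)
  inferInstance

/-- The complex (or real, if `𝕜 = ℝ`) Hilbert space `L²(V)`. -/
abbrev L2Sections : Type _ := (sectionField 𝕜 n (riemannianVolume n M) F V).L2

/-- The Hilbert space `L²(T*M ⊗ V)`. -/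
abbrev L2Forms : Type _ := (formField 𝕜 n (riemannianVolume n M) F V).L2

/-- The smooth sections of `V`. -/
def smoothSections : Submodule 𝕜 (Π x, V x) where
  carrier := {s | ContMDiff (𝓡 n) ((𝓡 n).prod 𝓘(ℝ, F)) ∞ fun x ↦ TotalSpace.mk' F x (s x)}
  zero_mem' := contMDiff_zeroSection ℝ V
  add_mem' hs ht := hs.add_section ht
  smul_mem' c s hs x₀ := by
    have h := (contMDiffAt_section x₀).1 (hs x₀)
    let L : F →L[ℝ] F := c • ContinuousLinearMap.id ℝ F
    refine (contMDiffAt_section x₀).2 ((L.contMDiff.contMDiffAt.comp x₀ h).congr_of_eventuallyEq ?_)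
    filter_upwards [(trivializationAt F V x₀).open_baseSet.mem_nhds
      (FiberBundle.mem_baseSet_trivializationAt' x₀)] with x hx
    exact ((trivializationAt F V x₀).linear 𝕜 hx).map_smul c (s x)

/-- The sections of `V` with compact support. -/
def compactlySupportedSections : Submodule 𝕜 (Π x, V x) where
  carrier := {s | IsCompact (closure {x | s x ≠ 0})}
  zero_mem' := by simp
  add_mem' {s t} hs ht := (hs.union ht).of_isClosed_subset isClosed_closure <| by
    rw [← closure_union]
    refine closure_mono fun x hx ↦ ?_
    by_contra h
    simp only [mem_union, mem_ofPred_eq, not_or, not_not] at h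
    exact hx (by simp [h.1, h.2])
  smul_mem' c s hs := hs.of_isClosed_subset isClosed_closure <|
    closure_mono fun x hx h ↦ hx (by simp [h])

variable {F V}

/-- The connection is `𝕜`-linear. This holds for every connection if `𝕜 = ℝ`, and it is part of the
notion of a connection on a complex vector bundle if `𝕜 = ℂ`. -/
class IsLinearConnection (cov : CovariantDerivative (𝓡 n) F V) : Prop where
  map_smul (c : 𝕜) (s : Π x, V x) (hs : s ∈ smoothSections 𝕜 n F V) : cov (c • s) = c • cov s

variable (cov : CovariantDerivative (𝓡 n) F V) [IsLinearConnection 𝕜 n cov]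

/-- The graph of `∇`, as a relation between `L²(V)` and `L²(T*M ⊗ V)`, on those smooth sections
`u ∈ D` for which both `u` and `∇u` are square integrable. -/
def connectionGraph (D : Submodule 𝕜 (Π x, V x)) :
    Submodule 𝕜 (L2Sections 𝕜 n F V × L2Forms 𝕜 n F V) where
  carrier := {p | ∃ (u : (sectionField 𝕜 n (riemannianVolume n M) F V).L2Section)
    (α : (formField 𝕜 n (riemannianVolume n M) F V).L2Section),
    (u : Π x, V x) ∈ smoothSections 𝕜 n F V ∧ (u : Π x, V x) ∈ D ∧
    (∀ x, (α x).toCLM = cov u x) ∧ p = (SeparationQuotient.mk u, SeparationQuotient.mk α)}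
  zero_mem' := ⟨0, 0, Submodule.zero_mem _, Submodule.zero_mem _,
    fun x ↦ (congrFun cov.zero x).symm, rfl⟩
  add_mem' := by
    rintro _ _ ⟨u, α, hu, huD, hα, rfl⟩ ⟨v, β, hv, hvD, hβ, rfl⟩
    refine ⟨u + v, α + β, Submodule.add_mem _ hu hv, Submodule.add_mem _ huD hvD, fun x ↦ ?_, rfl⟩
    have h := cov.isCovariantDerivativeOnUniv.add (x := x)
      ((hu x).mdifferentiableAt (by simp)) ((hv x).mdifferentiableAt (by simp))
    exact (congrArg₂ (· + ·) (hα x) (hβ x)).trans h.symm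
  smul_mem' := by
    rintro c _ ⟨u, α, hu, huD, hα, rfl⟩
    refine ⟨c • u, c • α, Submodule.smul_mem _ c hu, Submodule.smul_mem _ c huD, fun x ↦ ?_, rfl⟩
    have h := congrFun (IsLinearConnection.map_smul (cov := cov) c u hu) x
    exact (congrArg (c • ·) (hα x)).trans h.symm

/-- `∇_c`: the connection with domain the smooth compactly supported sections. -/
def nablaC : L2Sections 𝕜 n F V →ₗ.[𝕜] L2Forms 𝕜 n F V :=
  (connectionGraph 𝕜 n cov (compactlySupportedSections 𝕜 V)).toLinearPMap

/-- `∇_2`: the connection with domain the smooth sections `u ∈ L²(V)` with `∇u ∈ L²(T*M ⊗ V)`. -/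
def nabla2 : L2Sections 𝕜 n F V →ₗ.[𝕜] L2Forms 𝕜 n F V :=
  (connectionGraph 𝕜 n cov ⊤).toLinearPMap

/-- `∇_N`: the closure of `∇_2`. Its domain is the Sobolev space `W^{1,2}(V)`. -/
def nablaN : L2Sections 𝕜 n F V →ₗ.[𝕜] L2Forms 𝕜 n F V := (nabla2 𝕜 n cov).closure

/-- The Gaffney Laplacian `Δ_G = (∇_c)^* ∇_N = -div_D ∇_N` on `L²(V)`, where
`div_D = (-∇_c)^*`. -/
def gaffneyLaplacian : L2Sections 𝕜 n F V →ₗ.[𝕜] L2Sections 𝕜 n F V :=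
  compUnbounded (nablaC 𝕜 n cov).adjoint (nablaN 𝕜 n cov)

end Operators

instance {n : ℕ} {M : Type*} [TopologicalSpace M]
    [ChartedSpace (EuclideanSpace ℝ (Fin n)) M] [IsManifold (𝓡 n) ∞ M]
    {F : Type*} [NormedAddCommGroup F] [NormedSpace ℝ F]
    {V : M → Type*} [TopologicalSpace (TotalSpace F V)] [∀ x, NormedAddCommGroup (V x)]
    [∀ x, InnerProductSpace ℝ (V x)] [FiberBundle F V] [VectorBundle ℝ F V]
    (cov : CovariantDerivative (𝓡 n) F V) : IsLinearConnection ℝ n cov where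
  map_smul c s hs := funext fun x ↦
    cov.isCovariantDerivativeOnUniv.smul_const c ((hs x).mdifferentiableAt (by simp))

lemma mdifferentiableAt_of_trivial_section {n : ℕ} {M : Type*} [TopologicalSpace M]
    [ChartedSpace (EuclideanSpace ℝ (Fin n)) M]
    {f : Π x : M, Bundle.Trivial M ℝ x} {x : M}
    (hf : MDifferentiableAt (𝓡 n) ((𝓡 n).prod 𝓘(ℝ, ℝ)) (fun x ↦ TotalSpace.mk' ℝ x (f x)) x) :
    MDifferentiableAt (𝓡 n) 𝓘(ℝ, ℝ) (fun x ↦ (f x : ℝ)) x :=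
  (mdifferentiableAt_section (𝓡 n) (F := ℝ) (E := Bundle.Trivial M ℝ) (s := f)).1 hf

section Capacity
variable (n : ℕ) (M : Type*)

/-- The exterior derivative of functions, as a connection on the trivial line bundle. -/
def trivialConnection [TopologicalSpace M] [ChartedSpace (EuclideanSpace ℝ (Fin n)) M] :
    CovariantDerivative (𝓡 n) ℝ (Bundle.Trivial M ℝ) where
  toFun f x := mvfderiv (𝓡 n) (fun y ↦ (f y : ℝ)) x
  isCovariantDerivativeOnUniv :=
    { add := fun hf hg _ ↦ mvfderiv_add (mdifferentiableAt_of_trivial_section hf)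
        (mdifferentiableAt_of_trivial_section hg)
      leibniz := fun hf ha _ ↦ mvfderiv_smul ha (mdifferentiableAt_of_trivial_section hf) }

/-- The Cauchy boundary `∂_C M`: the points that the metric completion adds to `M`. -/
def cauchyBoundary [UniformSpace M] : Set (UniformSpace.Completion M) :=
  (range ((↑) : M → UniformSpace.Completion M))ᶜ

variable {M} [UniformSpace M]
  [ChartedSpace (EuclideanSpace ℝ (Fin n)) M] [IsManifold (𝓡 n) ∞ M]
  [SecondCountableTopology M] [MeasurableSpace M] [BorelSpace M]
  [RiemannianBundle (fun x : M ↦ TangentSpace (𝓡 n) x)]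
  [IsContMDiffRiemannianBundle (𝓡 n) ∞ (EuclideanSpace ℝ (Fin n))
    (fun x : M ↦ TangentSpace (𝓡 n) x)]

/-- `d`, as a closed operator from `L²(M)` to `L²(T*M)` whose domain is `W^{1,2}(M)`. -/
def dN : L2Sections ℝ n ℝ (Bundle.Trivial M ℝ) →ₗ.[ℝ] L2Forms ℝ n ℝ (Bundle.Trivial M ℝ) :=
  nablaN ℝ n (trivialConnection n M)

/-- The functions `u ∈ W^{1,2}(M)` with `0 ≤ u ≤ 1` and `u = 1` on `Ω ∩ M` (almost everywhere), as
elements of the domain of `d`. -/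
def testFunctions (Ω : Set (UniformSpace.Completion M)) : Set (dN n (M := M)).domain :=
  {u | ∃ f : (sectionField ℝ n (riemannianVolume n M) ℝ (Bundle.Trivial M ℝ)).L2Section,
    SeparationQuotient.mk f = (u : L2Sections ℝ n ℝ (Bundle.Trivial M ℝ)) ∧
    (∀ᵐ x ∂(riemannianVolume n M), 0 ≤ (f x : ℝ) ∧ (f x : ℝ) ≤ 1) ∧
    ∀ᵐ x : M ∂(riemannianVolume n M), (x : UniformSpace.Completion M) ∈ Ω → (f x : ℝ) = 1}

/-- The `1`-capacity of an open set, `inf ∫ |u|² + |du|²` over the test functions; it is `∞` if there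
are none. -/
def capacityOpen (Ω : Set (UniformSpace.Completion M)) : ℝ≥0∞ :=
  ⨅ u ∈ testFunctions n Ω,
    ENNReal.ofReal (‖(u : L2Sections ℝ n ℝ (Bundle.Trivial M ℝ))‖ ^ 2 + ‖dN n u‖ ^ 2)

/-- The `1`-capacity of an arbitrary subset of the completion. -/
def capacity (A : Set (UniformSpace.Completion M)) : ℝ≥0∞ :=
  ⨅ (Ω : Set (UniformSpace.Completion M)) (_ : IsOpen Ω) (_ : A ⊆ Ω), capacityOpen n Ω

/-- A set is polar if it has zero capacity. -/
def IsPolar (A : Set (UniformSpace.Completion M)) : Prop := capacity n A = 0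

end Capacity

end GaffneyLap
end

/-!
# Self-adjointness of the Gaffney Laplacian

By von Neumann's theorem (`isSelfAdjoint_compUnbounded_adjoint_closure`), the operator `A^* Ā` is
self-adjoint for every densely defined closable operator `A`. Applied to `A = ∇_c`, this gives the
self-adjointness of `Δ_G = (∇_c)^* ∇_N` once `∇_N` is known to be the closure of `∇_c`, that is, once
the smooth compactly supported sections are a core for `∇_N` (`nablaN_eq_closure_nablaC`). The
density of the domain of `∇_c` (`dense_domain_nablaC`) is the fundamental lemma of the calculus of
variations, and `∇_2`, hence `∇_c`, is closable (`isClosable_nabla2`) because `∇` can be integrated by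
parts along coordinate vector fields (`exists_integral_mvfderiv_eq`).

It remains to approximate a smooth section `u` with `u` and `∇u` square integrable. Closed subspaces
are weakly closed, so `L²` approximation of `u` by compactly supported sections `w` whose `∇w` merely
stays bounded is enough (`exists_mem_of_forall_norm_le`). The same principle allows `u` to be replaced
by its truncations `R² u / (R² + |u|²)` (`norm_covForm_truncate_le`), so that `u` may be assumed to be
bounded.

For a bounded section `v` the approximations are `w = χ φ(f) v` (`exists_mem_graph_nablaC_of_bounded`):

* Polarity provides an open neighbourhood `Ω` of the Cauchy boundary with a test function `e` of small
  norm that is `1` on `Ω`, and smooth functions `f` of small norm that are as close to `e` in `L²` as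
  desired (`exists_smooth_test`).
* `φ = profile` is a smooth function with `φ(0) = 1` and `φ(1) = 0`. So `φ(f)` is close to `1` on most
  of `M`, and close to `0` on `Ω`.
* `χ` is a compactly supported smooth function that is `1` on a large compact set outside `Ω`, and
  whose gradient is bounded by a universal constant outside `Ω` (`exists_smooth_cutoff`).

The gradient of `χ` on `Ω` is bounded, but not uniformly. Since it is multiplied with `φ(f)`, whose `L²`
norm on `Ω` is controlled by `f - e`, choosing `f` after `χ` makes its contribution small.

The cutoff functions come from a version of the Hopf–Rinow theorem for incomplete manifolds
(`ChainReach.totallyBounded`). Let `O` be the trace on `M` of a smaller neighbourhood of the Cauchy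
boundary. Totally bounded sets that avoid `O` are relatively compact, as their closure in the metric
completion does not meet the Cauchy boundary. Measure distances from a compact set `C` along chains
each step of which is shorter than the distance to `O`: as `M` is a length space, the points within
bounded chain distance of `C` form a relatively compact set. The chain distance is locally
`1`-Lipschitz outside the closure of `O`, so a function of it is a Lipschitz cutoff
(`exists_lipschitz_cutoff`), which is then smoothed with a partition of unity and convolution in
charts (`exists_nhds_smooth_approx`).
-/

open scoped NNReal Uniformity
set_option linter.unusedSectionVars false

noncomputable section
namespace GaffneyLap

/-! ### Closed operators in Hilbert spaces -/

section HilbertSpace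
variable {𝕜 : Type*} [RCLike 𝕜] {H K : Type*} [NormedAddCommGroup H] [InnerProductSpace 𝕜 H]
  [NormedAddCommGroup K] [InnerProductSpace 𝕜 K]

/-- A closed subspace of `H × K` is weakly sequentially closed in the second variable: if `x` is the
limit of first components while the second components stay bounded, then `x` is a first component.
The second components can be chosen of nearly minimal norm, and then the parallelogram law makes them
a Cauchy sequence. -/
lemma exists_mem_of_forall_norm_le [CompleteSpace K] {G : Submodule 𝕜 (H × K)}
    (hG : IsClosed (G : Set (H × K))) {x : H} {C : ℝ}
    (h : ∀ ε > 0, ∃ p ∈ G, ‖p.1 - x‖ < ε ∧ ‖p.2‖ ≤ C) : ∃ y, (x, y) ∈ G := by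
  let S (k : ℕ) : Set ℝ := {r | ∃ p ∈ G, ‖p.1 - x‖ < 1 / ((k : ℝ) + 1) ∧ ‖p.2‖ = r}
  let c (k : ℕ) : ℝ := sInf (S k)
  let ε (k : ℕ) : ℝ := 1 / ((k : ℝ) + 1)
  have hε (k : ℕ) : 0 < ε k := by positivity
  have hεanti {k m : ℕ} (hkm : k ≤ m) : ε m ≤ ε k := by
    simp only [ε]
    gcongr
  have hbdd (k : ℕ) : BddBelow (S k) := ⟨0, by rintro _ ⟨p, -, -, rfl⟩; positivity⟩
  have hne (k : ℕ) : (S k).Nonempty := by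
    obtain ⟨p, hp, h1, -⟩ := h (ε k) (hε k)
    exact ⟨_, p, hp, h1, rfl⟩
  have hcC (k : ℕ) : c k ≤ C := by
    obtain ⟨p, hp, h1, h2⟩ := h (ε k) (hε k)
    exact (csInf_le (hbdd k) ⟨p, hp, h1, rfl⟩).trans h2
  have hc0 (k : ℕ) : 0 ≤ c k := le_csInf (hne k) (by rintro _ ⟨p, -, -, rfl⟩; positivity)
  have hmono : Monotone c := fun k m hkm ↦ csInf_le_csInf (hbdd k) (hne m) <| by
    rintro _ ⟨p, hp, h1, rfl⟩
    exact ⟨p, hp, h1.trans_le (hεanti hkm), rfl⟩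
  have hcbdd : BddAbove (range c) := ⟨C, by rintro _ ⟨k, rfl⟩; exact hcC k⟩
  set c' := ⨆ k, c k
  have hlim : Tendsto c atTop (𝓝 c') := tendsto_atTop_ciSup hmono hcbdd
  have hcc' (k : ℕ) : c k ≤ c' := le_ciSup hcbdd k
  have hex (k : ℕ) : ∃ p ∈ G, ‖p.1 - x‖ < ε k ∧ ‖p.2‖ ≤ c k + ε k := by
    obtain ⟨_, ⟨p, hp, h1, rfl⟩, h2⟩ := exists_lt_of_csInf_lt (hne k)
      (lt_add_of_pos_right (c k) (hε k))
    exact ⟨p, hp, h1, h2.le⟩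
  choose p hpG hp1 hp2 using hex
  have hε0 : Tendsto ε atTop (𝓝 0) := tendsto_one_div_add_atTop_nhds_zero_nat
  have hcau : CauchySeq fun k ↦ (p k).2 := by
    refine cauchySeq_of_le_tendsto_0 (fun k ↦ 2 * √(4 * ((c' + ε k) ^ 2 - c k ^ 2))) ?_ ?_
    · intro m l k hm hl
      have key (m : ℕ) (hm : k ≤ m) :
          ‖(p k).2 - (p m).2‖ ≤ √(4 * ((c' + ε k) ^ 2 - c k ^ 2)) := by
        refine Real.le_sqrt_of_sq_le ?_
        have hmid : c k ≤ ‖(2⁻¹ : 𝕜) • ((p k).2 + (p m).2)‖ := by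
          refine csInf_le (hbdd k) ⟨(2⁻¹ : 𝕜) • (p k + p m),
            G.smul_mem _ (G.add_mem (hpG k) (hpG m)), ?_, rfl⟩
          have : ((2⁻¹ : 𝕜) • (p k + p m)).1 - x
              = (2⁻¹ : 𝕜) • (((p k).1 - x) + ((p m).1 - x)) := by
            have h2 : x = (2⁻¹ : 𝕜) • (x + x) := by
              rw [← two_smul 𝕜 x, smul_smul]; norm_num
            conv_lhs => rw [h2]
            simp only [Prod.smul_fst, Prod.fst_add, ← smul_sub]
            congr 1; abel
          rw [this, norm_smul]
          have h3 := norm_add_le ((p k).1 - x) ((p m).1 - x)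
          have h4 := hp1 k
          have h5 := (hp1 m).trans_le (hεanti hm)
          have : ‖(2⁻¹ : 𝕜)‖ = 2⁻¹ := by simp
          rw [this]
          change _ < ε k
          linarith
        rw [norm_smul, norm_inv, RCLike.norm_ofNat] at hmid
        have hpar := parallelogram_law_with_norm 𝕜 (p k).2 (p m).2
        have h1 : ‖(p k).2‖ ≤ c' + ε k := (hp2 k).trans (by gcongr; exact hcc' k)
        have h2 : ‖(p m).2‖ ≤ c' + ε k := (hp2 m).trans (add_le_add (hcc' m) (hεanti hm))
        have h1' : ‖(p k).2‖ * ‖(p k).2‖ ≤ (c' + ε k) ^ 2 := by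
          rw [← pow_two]; gcongr
        have h2' : ‖(p m).2‖ * ‖(p m).2‖ ≤ (c' + ε k) ^ 2 := by
          rw [← pow_two]; gcongr
        have h3 : (2 * c k) ^ 2 ≤ ‖(p k).2 + (p m).2‖ ^ 2 := by
          have := hc0 k
          gcongr; linarith
        nlinarith
      calc dist (p m).2 (p l).2 ≤ dist (p k).2 (p m).2 + dist (p k).2 (p l).2 :=
            dist_triangle_left _ _ _
        _ ≤ _ := by
          rw [dist_eq_norm, dist_eq_norm, two_mul]
          exact add_le_add (key m hm) (key l hl)
    · have : Tendsto (fun k ↦ 2 * √(4 * ((c' + ε k) ^ 2 - c k ^ 2))) atTop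
          (𝓝 (2 * √(4 * ((c' + 0) ^ 2 - c' ^ 2)))) :=
        ((((tendsto_const_nhds.add hε0).pow 2).sub (hlim.pow 2)).const_mul 4).sqrt.const_mul 2
      simpa using this
  obtain ⟨y, hy⟩ := cauchySeq_tendsto_of_complete hcau
  refine ⟨y, hG.mem_of_tendsto (b := atTop) (f := p) ?_ (Eventually.of_forall hpG)⟩
  refine Tendsto.prodMk_nhds ?_ hy
  rw [tendsto_iff_norm_sub_tendsto_zero]
  exact squeeze_zero (fun _ ↦ norm_nonneg _) (fun k ↦ (hp1 k).le) hε0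

variable {A : H →ₗ.[𝕜] K} {T : H →ₗ.[𝕜] H}

/-- If `1 + T` is onto, a symmetric `T` has no proper symmetric extension: for `y` in the domain of
`T^*` the solution `x` of `x + T x = y + T^* y` satisfies `y - x ⊥ ran (1 + T)`. -/
lemma isSelfAdjoint_of_symmetric_of_surjective [CompleteSpace H] (hdense : Dense (T.domain : Set H))
    (hsymm : ∀ x y : T.domain, inner 𝕜 (T x) (y : H) = inner 𝕜 (x : H) (T y))
    (hsurj : ∀ h : H, ∃ x : T.domain, (x : H) + T x = h) : IsSelfAdjoint T := by
  rw [LinearPMap.isSelfAdjoint_def]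
  have hle : T ≤ T.adjoint := LinearPMap.IsFormalAdjoint.le_adjoint hdense fun x y ↦ hsymm x y
  refine (LinearPMap.eq_of_le_of_domain_eq hle (le_antisymm hle.1 fun y hy ↦ ?_)).symm
  obtain ⟨x, hx⟩ := hsurj (y + T.adjoint ⟨y, hy⟩)
  have hxy : y - x = 0 := by
    obtain ⟨z, hz⟩ := hsurj (y - x)
    have h1 : inner 𝕜 (T.adjoint ⟨y, hy⟩) (z : H) = inner 𝕜 y (T z) :=
      LinearPMap.adjoint_isFormalAdjoint hdense ⟨y, hy⟩ z
    have h2 := hsymm x z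
    rw [← inner_self_eq_zero (𝕜 := 𝕜)]
    nth_rewrite 2 [← hz]
    have h3 : inner 𝕜 ((x : H) + T x) (z : H) = inner 𝕜 (y + T.adjoint ⟨y, hy⟩) (z : H) := by
      rw [hx]
    rw [inner_add_left, inner_add_left, h1, h2] at h3
    rw [inner_sub_left, inner_add_right, inner_add_right]
    linear_combination -h3
  rw [sub_eq_zero.1 hxy]
  exact x.2

lemma mem_domain_compUnbounded {B : H →ₗ.[𝕜] K} {C : K →ₗ.[𝕜] H} {x : H} :
    x ∈ (compUnbounded C B).domain ↔ ∃ hx : x ∈ B.domain, B ⟨x, hx⟩ ∈ C.domain := by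
  have : (compUnbounded C B).domain =
      (B.domRestrict ((C.domain.comap B.toFun).map B.domain.subtype)).domain := rfl
  rw [this, LinearPMap.domRestrict_domain]
  constructor
  · rintro ⟨h1, h2⟩
    obtain ⟨y, hy, rfl⟩ := Submodule.mem_map.1 h1
    exact ⟨y.2, hy⟩
  · rintro ⟨h1, h2⟩
    exact ⟨Submodule.mem_map.2 ⟨⟨x, h1⟩, h2, rfl⟩, h1⟩

lemma compUnbounded_apply {B : H →ₗ.[𝕜] K} {C : K →ₗ.[𝕜] H} {x : H}
    (hx : x ∈ (compUnbounded C B).domain) (h1 : x ∈ B.domain) (h2 : B ⟨x, h1⟩ ∈ C.domain) :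
    compUnbounded C B ⟨x, hx⟩ = C ⟨B ⟨x, h1⟩, h2⟩ := rfl

/-- Von Neumann's theorem: `A^* Ā` is self-adjoint. Decomposing `(h, 0)` along the closed graph of
`Ā` and its orthogonal complement solves `x + A^* Ā x = h`. -/
theorem isSelfAdjoint_compUnbounded_adjoint_closure [CompleteSpace H] [CompleteSpace K]
    (hA : Dense (A.domain : Set H)) (hcl : A.IsClosable) :
    IsSelfAdjoint (compUnbounded A.adjoint A.closure) := by
  set B := A.closure
  have hAB : A ≤ B := A.le_closure
  -- Green's formula extends from the domain of `A` to that of its closure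
  have hgreen (z : A.adjoint.domain) (x : B.domain) :
      inner 𝕜 (A.adjoint z) (x : H) = inner 𝕜 (z : K) (B x) := by
    have hx : ((x : H), B x) ∈ A.graph.topologicalClosure := by
      rw [hcl.graph_closure_eq_closure_graph]
      exact LinearPMap.mem_graph _ x
    have hclosed : IsClosed {p : H × K | inner 𝕜 (A.adjoint z) p.1 = inner 𝕜 (z : K) p.2} :=
      isClosed_eq (by fun_prop) (by fun_prop)
    refine closure_minimal ?_ hclosed hx
    intro p hp
    obtain ⟨y, hy1, hy2⟩ := (LinearPMap.mem_graph_iff _).1 hp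
    simp only [mem_ofPred_eq, ← hy1, ← hy2]
    exact LinearPMap.adjoint_isFormalAdjoint hA z y
  have hsurj (h : H) : ∃ x : (compUnbounded A.adjoint B).domain,
      (x : H) + compUnbounded A.adjoint B x = h := by
    let L : WithLp 2 (H × K) ≃L[𝕜] H × K := WithLp.prodContinuousLinearEquiv 2 𝕜 H K
    let G : Submodule 𝕜 (WithLp 2 (H × K)) := B.graph.comap (L : WithLp 2 (H × K) →ₗ[𝕜] H × K)
    have hGcl : IsClosed (G : Set (WithLp 2 (H × K))) :=
      (hcl.closure_isClosed : IsClosed (B.graph : Set (H × K))).preimage L.continuous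
    have : CompleteSpace G := hGcl.completeSpace_coe
    obtain ⟨g, hg, w, hw, hgw⟩ := G.exists_add_mem_mem_orthogonal (WithLp.toLp 2 (h, (0 : K)))
    obtain ⟨x, hx1, hx2⟩ := (LinearPMap.mem_graph_iff _).1 (show L g ∈ B.graph from hg)
    have hx1' : (x : H) = g.fst := hx1
    have hx2' : B x = g.snd := hx2
    have e1 : h = (x : H) + w.fst := by
      have := congrArg WithLp.fst hgw
      simpa [hx1'] using this
    have e2 : w.snd = -B x := by
      have := congrArg WithLp.snd hgw
      rw [hx2']
      have h0 : (0 : K) = g.snd + w.snd := by simpa using this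
      exact (neg_eq_of_add_eq_zero_right h0.symm).symm
    have hperp (y : A.domain) : inner 𝕜 w.fst (y : H) = inner 𝕜 (B x) (A y) := by
      have hy : (WithLp.toLp 2 ((y : H), A y)) ∈ G :=
        LinearPMap.le_graph_of_le hAB (LinearPMap.mem_graph A y)
      have := (Submodule.mem_orthogonal' _ _).1 hw _ hy
      rw [WithLp.prod_inner_apply] at this
      change inner 𝕜 w.fst (y : H) + inner 𝕜 w.snd (A y) = 0 at this
      rw [e2, inner_neg_left] at this
      exact add_neg_eq_zero.1 this
    have hmem : B x ∈ A.adjoint.domain := LinearPMap.mem_adjoint_domain_of_exists _ ⟨w.fst, hperp⟩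
    have hxd : (x : H) ∈ (compUnbounded A.adjoint B).domain :=
      mem_domain_compUnbounded.2 ⟨x.2, hmem⟩
    refine ⟨⟨x, hxd⟩, ?_⟩
    rw [compUnbounded_apply hxd x.2 hmem, e1,
      LinearPMap.adjoint_apply_eq hA ⟨B x, hmem⟩ (x₀ := w.fst) hperp]
  have hform (x : (compUnbounded A.adjoint B).domain) (y : H) (hy : y ∈ B.domain) :
      inner 𝕜 (compUnbounded A.adjoint B x) y =
        inner 𝕜 (B ⟨x, (mem_domain_compUnbounded.1 x.2).1⟩) (B ⟨y, hy⟩) :=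
    hgreen ⟨_, (mem_domain_compUnbounded.1 x.2).2⟩ ⟨y, hy⟩
  refine isSelfAdjoint_of_symmetric_of_surjective ?_ (fun x y ↦ ?_) hsurj
  -- if `h = x + A^* Ā x` is orthogonal to the domain, pairing it with `x` gives `‖x‖² + ‖Ā x‖² = 0`
  · rw [Submodule.dense_iff_topologicalClosure_eq_top, Submodule.topologicalClosure_eq_top_iff,
      Submodule.eq_bot_iff]
    intro h hh
    obtain ⟨x, hx⟩ := hsurj h
    have h0 : inner 𝕜 h (x : H) = 0 := (Submodule.mem_orthogonal' _ _).1 hh _ x.2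
    rw [← hx, inner_add_left, hform x x (mem_domain_compUnbounded.1 x.2).1] at h0
    have h1 := congrArg RCLike.re h0
    rw [map_add, ← norm_sq_eq_re_inner, ← norm_sq_eq_re_inner, map_zero] at h1
    have hx0 : (x : H) = 0 := by
      rw [← norm_eq_zero]
      nlinarith [sq_nonneg ‖(x : H)‖, sq_nonneg ‖B ⟨x, (mem_domain_compUnbounded.1 x.2).1⟩‖]
    have : x = 0 := Subtype.ext hx0
    rw [← hx, this]
    simp
  · rw [hform x y (mem_domain_compUnbounded.1 y.2).1, ← inner_conj_symm (x : H),
      hform y x (mem_domain_compUnbounded.1 x.2).1, inner_conj_symm]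

end HilbertSpace

/-! ### Chains of variable step size and a Hopf–Rinow theorem -/

section Chains
variable {M : Type*} [EMetricSpace M]

/-- `ChainReach s C t x`: the point `x` can be reached from the set `C` by a finite chain of total
length less than `t` in which every step starting at a point `z` is shorter than `s z`. -/
inductive ChainReach (s : M → ℝ≥0∞) (C : Set M) : ℝ≥0 → M → Prop
  | base {t : ℝ≥0} {x : M} (hx : x ∈ C) (ht : 0 < t) : ChainReach s C t x
  | step {t u : ℝ≥0} {x y : M} (h : ChainReach s C t x) (hs : edist x y < s x)
      (hu : edist x y < u) : ChainReach s C (t + u) y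

namespace ChainReach
variable {s : M → ℝ≥0∞} {C : Set M} {t : ℝ≥0} {x : M}

lemma mono {t' : ℝ≥0} (h : ChainReach s C t x) (htt' : t ≤ t') : ChainReach s C t' x := by
  cases h with
  | base hx ht => exact base hx (ht.trans_le htt')
  | step h hs hu =>
    rename_i t u z
    have hle : t ≤ t' := le_self_add.trans htt'
    rw [← add_tsub_cancel_of_le hle]
    refine step h hs (hu.trans_le ?_)
    exact_mod_cast le_tsub_of_add_le_left htt'

lemma pos (h : ChainReach s C t x) : 0 < t := by
  induction h with
  | base hx ht => exact ht
  | step h hs hu ih => exact add_pos_of_pos_of_nonneg ih zero_le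

lemma exists_edist_lt (h : ChainReach s C t x) : ∃ c ∈ C, edist c x < t := by
  induction h with
  | base hx ht => exact ⟨_, hx, by simpa using ht⟩
  | step h hs hu ih =>
    obtain ⟨c, hc, hcx⟩ := ih
    refine ⟨c, hc, (edist_triangle _ _ _).trans_lt (ENNReal.add_lt_add hcx hu)⟩

/-- In a length space the last step of a chain can be cut at any prescribed length. -/
lemma exists_reach_of_le_add (hlen : ∀ (x y : M) (a b : ℝ≥0∞), 0 < a → 0 < b →
      edist x y < a + b → ∃ z, edist x z < a ∧ edist z y < b)
    {R η : ℝ≥0} (hR : 0 < R) (hη : 0 < η) (h : ChainReach s C t x) (ht : t ≤ R + η) :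
    ∃ y, ChainReach s C R y ∧ edist y x < η := by
  induction h generalizing η with
  | base hx ht => exact ⟨_, base hx hR, by simpa using hη⟩
  | @step t u x y h hs hu ih =>
    rcases le_or_gt (t + u) R with h1 | h1
    · exact ⟨y, (step h hs hu).mono h1, by simpa using hη⟩
    rcases lt_trichotomy t R with h2 | h2 | h2
    · have ha : 0 < R - t := tsub_pos_of_lt h2
      have hb : 0 < t + u - R := tsub_pos_of_lt h1
      have hab : (R - t) + (t + u - R) = u := by
        rw [← NNReal.coe_inj]
        push_cast [NNReal.coe_sub h2.le, NNReal.coe_sub h1.le]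
        ring
      have hbη : t + u - R ≤ η := tsub_le_iff_left.2 ht
      obtain ⟨z, hz1, hz2⟩ := hlen x y (min ((R - t : ℝ≥0) : ℝ≥0∞) (s x)) (t + u - R : ℝ≥0)
        (lt_min (by exact_mod_cast ha) (zero_le.trans_lt hs)) (by exact_mod_cast hb) (by
          rw [min_add]
          refine lt_min ?_ (hs.trans_le le_self_add)
          rw [← ENNReal.coe_add, hab]
          exact hu)
      have hz := step h (hz1.trans_le (min_le_right _ _)) (hz1.trans_le (min_le_left _ _))
      rw [add_tsub_cancel_of_le h2.le] at hz
      exact ⟨z, hz, hz2.trans_le (by exact_mod_cast hbη)⟩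
    · subst h2
      exact ⟨x, h, hu.trans_le (by exact_mod_cast (add_le_add_iff_left _).1 ht)⟩
    · obtain ⟨z, hz, hzx⟩ := ih (η := t - R) (tsub_pos_of_lt h2) (by rw [add_tsub_cancel_of_le h2.le])
      refine ⟨z, hz, (edist_triangle _ x _).trans_lt ((ENNReal.add_lt_add hzx hu).trans_le ?_)⟩
      rw [← ENNReal.coe_add]
      refine ENNReal.coe_le_coe.2 ?_
      rw [← NNReal.coe_le_coe] at ht ⊢
      push_cast [NNReal.coe_sub h2.le] at ht ⊢
      linarith

/-- If the steps are shorter than the distance to `O`, then chains never end in `O`. -/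
lemma mem_or_notMem {O : Set M} (h : ChainReach (fun x ↦ Metric.infEDist x O) C t x) :
    x ∈ C ∨ x ∉ O := by
  cases h with
  | base hx ht => exact Or.inl hx
  | step h hs hu => exact Or.inr fun hy ↦ (Metric.infEDist_le_edist_of_mem hy).not_gt hs

/-- Hopf–Rinow: if totally bounded sets that avoid `O` are relatively compact, then the points that
can be reached from a compact set by chains of bounded length avoiding `O` form a relatively compact
set. -/
lemma totallyBounded [LocallyCompactSpace M] (hlen : ∀ (x y : M) (a b : ℝ≥0∞), 0 < a → 0 < b →
      edist x y < a + b → ∃ z, edist x z < a ∧ edist z y < b)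
    {O : Set M} (hO : ∀ A : Set M, TotallyBounded A → Disjoint A O → IsCompact (closure A))
    (hC : IsCompact C) (R : ℝ≥0) :
    TotallyBounded {x | ChainReach (fun x ↦ Metric.infEDist x O) C R x} ∧
      IsCompact (closure {x | ChainReach (fun x ↦ Metric.infEDist x O) C R x}) := by
  set s : M → ℝ≥0∞ := fun x ↦ Metric.infEDist x O
  have hcpt (R : ℝ≥0) (hR : TotallyBounded {x | ChainReach s C R x}) :
      IsCompact (closure {x | ChainReach s C R x}) := by
    have h1 := (hO ({x | ChainReach s C R x} \ C) (hR.subset sdiff_subset)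
      (disjoint_left.2 fun x hx hxO ↦ (mem_or_notMem hx.1).elim hx.2 fun h ↦ h hxO)).union hC
    refine h1.of_isClosed_subset isClosed_closure (closure_minimal ?_ h1.isClosed)
    intro x hx
    by_cases hxC : x ∈ C
    · exact Or.inr hxC
    · exact Or.inl (subset_closure ⟨hx, hxC⟩)
  have hnhds (K : Set M) (hK : IsCompact K) : ∃ δ : ℝ≥0, 0 < δ ∧
      TotallyBounded {x | ∃ y ∈ K, edist y x < δ} := by
    obtain ⟨K', hK', hKK'⟩ := exists_compact_superset hK
    obtain ⟨δ, hδ, hδK⟩ := hK.exists_thickening_subset_open isOpen_interior hKK'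
    refine ⟨⟨δ, hδ.le⟩, hδ, hK'.totallyBounded.subset ?_⟩
    rintro x ⟨y, hy, hyx⟩
    refine interior_subset (hδK ?_)
    rw [Metric.mem_thickening_iff_exists_edist_lt]
    refine ⟨y, hy, ?_⟩
    rw [edist_comm]
    convert hyx
    exact ENNReal.ofReal_eq_coe_nnreal hδ.le
  suffices h : ∀ R : ℝ≥0, TotallyBounded {x | ChainReach s C R x} from ⟨h R, hcpt R (h R)⟩
  by_contra! hcon
  obtain ⟨R₁, hR₁⟩ := hcon
  -- otherwise the lengths `R` with a totally bounded set have a supremum `R₀`; it is attained, as the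
  -- points reached within `R₀` are close to those reached within `R₀ - η`, and it can be exceeded, as
  -- compact sets have totally bounded neighbourhoods
  let S : Set ℝ≥0 := {R | TotallyBounded {x | ChainReach s C R x}}
  have hdown {R R' : ℝ≥0} (h : R ≤ R') (hR' : R' ∈ S) : R ∈ S :=
    TotallyBounded.subset (fun x hx ↦ ChainReach.mono hx h) hR'
  have h0 : (0 : ℝ≥0) ∈ S := by
    have : {x | ChainReach s C 0 x} = ∅ := eq_empty_of_forall_notMem fun x hx ↦ lt_irrefl _ hx.pos
    simp [S, this]
  have hbdd : BddAbove S := ⟨R₁, fun R hR ↦ le_of_not_gt fun h ↦ hR₁ (hdown h.le hR)⟩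
  set R₀ := sSup S
  have hlt (R : ℝ≥0) (hR : R < R₀) : R ∈ S := by
    obtain ⟨R', hR', h⟩ := exists_lt_of_lt_csSup ⟨0, h0⟩ hR
    exact hdown h.le hR'
  have hR₀ : R₀ ∈ S := by
    rcases eq_zero_or_pos R₀ with h | hpos
    · rwa [h]
    refine EMetric.totallyBounded_iff.2 fun ε hε ↦ ?_
    obtain ⟨η, hη0, hη⟩ : ∃ η : ℝ≥0, 0 < η ∧ (η : ℝ≥0∞) < ε / 2 := by
      obtain ⟨η, h1, h2⟩ := ENNReal.lt_iff_exists_nnreal_btwn.1 (ENNReal.half_pos hε.ne')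
      exact ⟨η, by exact_mod_cast h1, h2⟩
    let η' := min η (R₀ / 2)
    have hη' : 0 < η' := lt_min hη0 (half_pos hpos)
    have hη'R : η' < R₀ := (min_le_right _ _).trans_lt (NNReal.half_lt_self hpos.ne')
    obtain ⟨T, hT, hTs⟩ := EMetric.totallyBounded_iff.1
      (hlt (R₀ - η') (tsub_lt_self hpos hη')) (ε / 2) (ENNReal.half_pos hε.ne')
    refine ⟨T, hT, fun x hx ↦ ?_⟩
    obtain ⟨y, hy, hyx⟩ := exists_reach_of_le_add hlen (R := R₀ - η') (η := η')
      (tsub_pos_of_lt hη'R) hη' hx (by rw [tsub_add_cancel_of_le hη'R.le])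
    have hyT := hTs hy
    simp only [mem_iUnion, Metric.mem_eball] at hyT ⊢
    obtain ⟨z, hz, hyz⟩ := hyT
    refine ⟨z, hz, (edist_triangle _ y _).trans_lt ?_⟩
    rw [← ENNReal.add_halves ε]
    refine ENNReal.add_lt_add ?_ hyz
    rw [edist_comm]
    refine hyx.trans (lt_of_le_of_lt ?_ hη)
    exact_mod_cast min_le_left _ _
  have hstep : ∃ δ : ℝ≥0, 0 < δ ∧ R₀ + δ ∈ S := by
    rcases eq_zero_or_pos R₀ with h | hpos
    · obtain ⟨δ, hδ, hδS⟩ := hnhds C hC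
      refine ⟨δ, hδ, ?_⟩
      rw [h, zero_add]
      exact hδS.subset fun x hx ↦ exists_edist_lt hx
    · obtain ⟨δ, hδ, hδS⟩ := hnhds _ (hcpt R₀ hR₀)
      refine ⟨δ, hδ, hδS.subset fun x hx ↦ ?_⟩
      obtain ⟨y, hy, hyx⟩ := exists_reach_of_le_add hlen hpos hδ hx le_rfl
      exact ⟨y, subset_closure hy, hyx⟩
  obtain ⟨δ, hδ, hδS⟩ := hstep
  exact (lt_add_of_pos_right R₀ hδ).not_ge (le_csSup hbdd hδS)

end ChainReach

/-- The infimum of the lengths of the chains from `C` to `x` with steps bounded by `s`. -/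
def chainDist (s : M → ℝ≥0∞) (C : Set M) (x : M) : ℝ≥0∞ :=
  ⨅ (t : ℝ≥0) (_ : ChainReach s C t x), (t : ℝ≥0∞)

lemma chainDist_le {s : M → ℝ≥0∞} {C : Set M} {x : M} {t : ℝ≥0} (h : ChainReach s C t x) :
    chainDist s C x ≤ t :=
  (iInf_le _ t).trans (iInf_le _ h)

lemma chainDist_le_add {s : M → ℝ≥0∞} {C : Set M} {x y : M} (h : edist x y < s x) :
    chainDist s C y ≤ chainDist s C x + edist x y := by
  rw [chainDist, chainDist, ENNReal.iInf_add]
  refine le_iInf fun t ↦ ?_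
  rw [ENNReal.iInf_add]
  refine le_iInf fun ht ↦ ENNReal.le_of_forall_pos_le_add fun ε hε hlt ↦ ?_
  have hfin : edist x y ≠ ⊤ := h.ne_top
  have hu : edist x y < ((edist x y).toNNReal + ε : ℝ≥0) := by
    rw [ENNReal.coe_add, ENNReal.coe_toNNReal hfin]
    exact ENNReal.lt_add_right hfin (by exact_mod_cast hε.ne')
  calc (⨅ (t : ℝ≥0) (_ : ChainReach s C t y), (t : ℝ≥0∞))
      ≤ ((t + ((edist x y).toNNReal + ε) : ℝ≥0) : ℝ≥0∞) := chainDist_le (ChainReach.step ht h hu)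
    _ = t + edist x y + ε := by
      rw [ENNReal.coe_add, ENNReal.coe_add, ENNReal.coe_toNNReal hfin, add_assoc]

/-- Cutoff functions that are locally `1`-Lipschitz away from the closure of `O`: the function
`1 - min f 1`, where `f` is the distance from `C` along chains whose steps are shorter than the
distance to `O`. Two nearby points outside the closure of `O` are joined by one such step. -/
lemma exists_lipschitz_cutoff [LocallyCompactSpace M]
    (hlen : ∀ (x y : M) (a b : ℝ≥0∞), 0 < a → 0 < b →
      edist x y < a + b → ∃ z, edist x z < a ∧ edist z y < b)
    {O : Set M} (hO : ∀ A : Set M, TotallyBounded A → Disjoint A O → IsCompact (closure A))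
    {C : Set M} (hC : IsCompact C) :
    ∃ h : M → ℝ, (∀ x, h x ∈ Icc 0 1) ∧ (∀ x ∈ C, h x = 1) ∧ IsCompact (closure {x | h x ≠ 0}) ∧
      ∀ x ∉ closure O, ∃ U ∈ 𝓝 x, ∀ u ∈ U, ∀ v ∈ U, ENNReal.ofReal |h u - h v| ≤ edist u v := by
  set s : M → ℝ≥0∞ := fun x ↦ Metric.infEDist x O with hs
  let f := chainDist s C
  have hmin (x : M) : min (f x) 1 ≠ ⊤ := ((min_le_right _ _).trans_lt ENNReal.one_lt_top).ne
  refine ⟨fun x ↦ 1 - (min (f x) 1).toReal, fun x ↦ ?_, fun x hx ↦ ?_, ?_, fun x hx ↦ ?_⟩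
  · refine ⟨?_, by simp⟩
    rw [sub_nonneg]
    exact ENNReal.toReal_mono ENNReal.one_ne_top (min_le_right (f x) 1)
  · have : f x = 0 := by
      refine le_antisymm (ENNReal.le_of_forall_pos_le_add fun ε hε _ ↦ ?_) zero_le
      rw [zero_add]
      exact chainDist_le (ChainReach.base hx hε)
    simp [this]
  · refine (ChainReach.totallyBounded hlen hO hC 1).2.of_isClosed_subset isClosed_closure
      (closure_mono fun x hx ↦ ?_)
    have hx1 : f x < 1 := by
      by_contra! h1
      exact hx (by simp [min_eq_right h1])
    obtain ⟨t, ht⟩ := iInf_lt_iff.1 hx1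
    obtain ⟨hr, ht1⟩ := iInf_lt_iff.1 ht
    exact hr.mono (by exact_mod_cast ht1.le)
  · have hsx : 0 < s x := by
      rw [pos_iff_ne_zero]
      exact fun h ↦ hx (Metric.mem_closure_iff_infEDist_zero.2 h)
    obtain ⟨r, hr0, hr⟩ := ENNReal.lt_iff_exists_nnreal_btwn.1 (ENNReal.div_pos hsx.ne'
      (by norm_num : (3 : ℝ≥0∞) ≠ ⊤))
    have hr3 : (r : ℝ≥0∞) + 2 * r ≤ s x := by
      calc (r : ℝ≥0∞) + 2 * r = r * 3 := by ring
        _ ≤ s x / 3 * 3 := by gcongr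
        _ = s x := ENNReal.div_mul_cancel (by norm_num) (by norm_num)
    refine ⟨Metric.eball x r, Metric.eball_mem_nhds x hr0, ?_⟩
    have key (u v : M) (hu : u ∈ Metric.eball x r) (hv : v ∈ Metric.eball x r) :
        (min (f v) 1).toReal ≤ (min (f u) 1).toReal + (edist u v).toReal := by
      have huv : edist u v < 2 * r := by
        rw [two_mul]
        exact (edist_triangle_right u v x).trans_lt (ENNReal.add_lt_add hu hv)
      have hfin : edist u v ≠ ⊤ := huv.ne_top
      have hsu : edist u v < s u := by
        refine huv.trans_le (le_of_not_gt fun hlt ↦ ?_)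
        have h1 : s x ≤ s u + edist x u := Metric.infEDist_le_infEDist_add_edist
        have h2 : s u + edist x u < 2 * r + r := by
          rw [edist_comm]
          exact ENNReal.add_lt_add hlt hu
        rw [add_comm] at hr3
        exact (hr3.trans h1).not_gt h2
      rw [← ENNReal.toReal_add (hmin u) hfin]
      refine ENNReal.toReal_mono (ENNReal.add_ne_top.2 ⟨hmin u, hfin⟩) ?_
      rw [min_add]
      exact le_min ((min_le_left _ _).trans (chainDist_le_add hsu))
        ((min_le_right _ _).trans le_self_add)
    intro u hu v hv
    have hfin : edist u v ≠ ⊤ :=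
      ((edist_triangle_right u v x).trans_lt (ENNReal.add_lt_add hu hv)).ne_top
    refine (ENNReal.ofReal_le_iff_le_toReal hfin).2 (abs_sub_le_iff.2 ⟨?_, ?_⟩)
    · have := key u v hu hv
      linarith
    · have := key v u hv hu
      rw [edist_comm] at this
      linarith

end Chains

/-- A Riemannian manifold is a length space: cutting a short path gives approximate intermediate
points. -/
lemma exists_edist_lt_edist_lt (n : ℕ) {M : Type*} [EMetricSpace M] [ChartedSpace (EuclideanSpace ℝ (Fin n)) M]
    [RiemannianBundle (fun x : M ↦ TangentSpace (𝓡 n) x)]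
    [IsRiemannianManifold (𝓡 n) M]
    (x y : M) (a b : ℝ≥0∞) (ha : 0 < a) (hb : 0 < b)
    (hab : edist x y < a + b) : ∃ z, edist x z < a ∧ edist z y < b := by
  by_cases hxa : edist x y < a
  · exact ⟨y, hxa, by simpa using hb⟩
  have ha' : a ≠ ⊤ := fun h ↦ hxa (h ▸ hab.ne_top.lt_top)
  rw [IsRiemannianManifold.out (I := 𝓡 n) x y] at hab
  obtain ⟨γ, hγ0, hγ1, hγ, hl⟩ := exists_lt_of_riemannianEDist_lt hab
  have hsub {c d : ℝ} (hc : 0 ≤ c) (hcd : c ≤ d) (hd : d ≤ 1) :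
      edist (γ c) (γ d) ≤ pathELength (𝓡 n) γ c d := by
    rw [IsRiemannianManifold.out (I := 𝓡 n)]
    exact riemannianEDist_le_pathELength (hγ.mono (Icc_subset_Icc hc hd)) rfl rfl hcd
  have hl' : pathELength (𝓡 n) γ 0 1 ≠ ⊤ := hl.ne_top
  obtain ⟨ε, hε0, hε⟩ : ∃ ε > 0, pathELength (𝓡 n) γ 0 1 + ε ≤ a + b :=
    ⟨a + b - pathELength (𝓡 n) γ 0 1, tsub_pos_of_lt hl, by rw [add_tsub_cancel_of_le hl.le]⟩
  obtain ⟨δ, hδ0, hδ⟩ := exists_pos_setLIntegral_lt_of_measure_lt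
    (μ := volume.restrict (Icc (0 : ℝ) 1)) (f := fun t ↦ ‖mfderiv 𝓘(ℝ) (𝓡 n) γ t 1‖ₑ)
    (by rwa [← pathELength_eq_lintegral_mfderiv_Icc]) hε0.ne'
  obtain ⟨N, hN0, hN⟩ : ∃ N : ℕ, 0 < N ∧ ENNReal.ofReal (1 / N) < δ := by
    obtain ⟨r, hr0, hr⟩ := ENNReal.lt_iff_exists_nnreal_btwn.1 hδ0
    obtain ⟨N, hN⟩ := exists_nat_one_div_lt (show (0 : ℝ) < r by exact_mod_cast hr0)
    refine ⟨N + 1, N.succ_pos, lt_of_le_of_lt ?_ hr⟩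
    rw [ENNReal.ofReal_le_iff_le_toReal ENNReal.coe_ne_top]
    push_cast
    exact hN.le
  have hN' : (0 : ℝ) < N := by exact_mod_cast hN0
  -- the last of the points `k / N` before which the path is shorter than `a`
  have hex : ∃ k : ℕ, a ≤ pathELength (𝓡 n) γ 0 (k / N) := by
    refine ⟨N, ?_⟩
    rw [div_self hN'.ne']
    refine (not_lt.1 hxa).trans ?_
    rw [← hγ0, ← hγ1]
    exact hsub le_rfl zero_le_one le_rfl
  classical
  set k := Nat.find hex with hk
  have hk1 : a ≤ pathELength (𝓡 n) γ 0 (k / N) := Nat.find_spec hex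
  have hk0 : k ≠ 0 := by
    intro h
    rw [h] at hk1
    simp at hk1
    exact ha.ne' hk1
  obtain ⟨m, hm⟩ := Nat.exists_eq_succ_of_ne_zero hk0
  have hm1 : pathELength (𝓡 n) γ 0 (m / N) < a :=
    not_le.1 (Nat.find_min hex (by rw [← hk, hm]; exact Nat.lt_succ_self m))
  have hkN : (k : ℝ) / N ≤ 1 := by
    rw [div_le_one hN']
    have : k ≤ N := by
      refine Nat.find_min' hex ?_
      rw [div_self hN'.ne']
      refine (not_lt.1 hxa).trans ?_
      rw [← hγ0, ← hγ1]
      exact hsub le_rfl zero_le_one le_rfl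
    exact_mod_cast this
  have hmk : (m : ℝ) / N ≤ k / N := by
    rw [hm]; gcongr; simp
  have hm0 : (0 : ℝ) ≤ m / N := by positivity
  refine ⟨γ (m / N), ?_, ?_⟩
  · rw [← hγ0]
    exact (hsub le_rfl hm0 (hmk.trans hkN)).trans_lt hm1
  · rw [← hγ1]
    refine (hsub hm0 (hmk.trans hkN) le_rfl).trans_lt ?_
    have hsmall : pathELength (𝓡 n) γ (m / N) (k / N) < ε := by
      have := hδ (Icc (m / N) (k / N)) (by
        refine (Measure.restrict_apply_le _ _).trans_lt ?_
        rw [Real.volume_Icc, hm]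
        convert hN using 2
        push_cast
        ring)
      rwa [Measure.restrict_restrict measurableSet_Icc, inter_eq_left.2
        (Icc_subset_Icc hm0 hkN), ← pathELength_eq_lintegral_mfderiv_Icc] at this
    rw [← pathELength_add hmk hkN]
    rw [← pathELength_add (hm0.trans hmk) hkN] at hε
    have h1 : a + (pathELength (𝓡 n) γ (k / N) 1 + ε) ≤ a + b := by
      rw [← add_assoc]
      exact (add_le_add_left (add_le_add_left hk1 _) _).trans hε
    have h2 := (ENNReal.add_le_add_iff_left ha').1 h1
    rw [add_comm]
    refine lt_of_lt_of_le (ENNReal.add_lt_add_left ?_ hsmall) h2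
    exact ((pathELength_mono (hm0.trans hmk) le_rfl).trans_lt hl'.lt_top).ne

/-! ### The metric completion -/

section Completion
open UniformSpace

lemma isCountablyGenerated_uniformity_completion (X : Type*) [UniformSpace X]
    [(𝓤 X).IsCountablyGenerated] : (𝓤 (Completion X)).IsCountablyGenerated := by
  obtain ⟨b, hb⟩ := (𝓤 X).exists_antitone_basis
  have : (𝓤 (CauchyFilter X)).IsCountablyGenerated :=
    (CauchyFilter.basis_uniformity hb.1).isCountablyGenerated
  exact inferInstanceAs ((𝓤 (CauchyFilter X)).map
    (Prod.map SeparationQuotient.mk SeparationQuotient.mk)).IsCountablyGenerated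

variable {M : Type*} [EMetricSpace M]

lemma isClosed_cauchyBoundary [LocallyCompactSpace M] : IsClosed (cauchyBoundary M) := by
  rw [cauchyBoundary, isClosed_compl_iff, isOpen_iff_mem_nhds]
  rintro _ ⟨x, rfl⟩
  obtain ⟨K, hK, hKx⟩ := exists_compact_mem_nhds x
  have hind : IsInducing ((↑) : M → Completion M) := (Completion.isUniformInducing_coe M).isInducing
  rw [hind.nhds_eq_comap, mem_comap] at hKx
  obtain ⟨t, ht, htK⟩ := hKx
  obtain ⟨V, hVt, hV, hxV⟩ := _root_.mem_nhds_iff.1 ht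
  refine mem_of_superset (hV.mem_nhds hxV) ?_
  have hcl : IsClosed (((↑) : M → Completion M) '' K) :=
    (hK.image (Completion.continuous_coe M)).isClosed
  have h1 : V ⊆ closure (V ∩ range ((↑) : M → Completion M)) :=
    Completion.denseRange_coe.open_subset_closure_inter hV
  refine h1.trans ((closure_minimal ?_ hcl).trans (image_subset_range _ _))
  rintro _ ⟨hy, ⟨y, rfl⟩⟩
  exact ⟨y, htK (hVt hy), rfl⟩

/-- An open neighbourhood of the Cauchy boundary contains a smaller one, which is all that prevents
totally bounded subsets of `M` from being relatively compact. -/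
lemma exists_subset_of_cauchyBoundary_subset [LocallyCompactSpace M] {Ω : Set (Completion M)}
    (hΩ : IsOpen Ω) (hb : cauchyBoundary M ⊆ Ω) :
    ∃ O : Set M, (∀ x ∈ closure O, (x : Completion M) ∈ Ω) ∧
      ∀ A : Set M, TotallyBounded A → Disjoint A O → IsCompact (closure A) := by
  have := isCountablyGenerated_uniformity_completion M
  obtain ⟨Ω', hΩ', hb', hcl⟩ := normal_exists_closure_subset isClosed_cauchyBoundary hΩ hb
  have hind : IsInducing ((↑) : M → Completion M) := (Completion.isUniformInducing_coe M).isInducing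
  refine ⟨(↑) ⁻¹' Ω', fun x hx ↦ hcl ?_, fun A hA hAO ↦ ?_⟩
  · exact (Completion.continuous_coe M).closure_preimage_subset _ hx
  · have h1 : IsCompact (closure (((↑) : M → Completion M) '' A)) :=
      (TotallyBounded.closure (hA.image (Completion.uniformContinuous_coe M))).isCompact_of_isClosed
        isClosed_closure
    rw [hind.closure_eq_preimage_closure_image]
    refine hind.isCompact_preimage' h1 ?_
    have h2 : closure (((↑) : M → Completion M) '' A) ⊆ Ω'ᶜ := by
      refine closure_minimal ?_ hΩ'.isClosed_compl
      rintro _ ⟨x, hx, rfl⟩ hx'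
      exact disjoint_left.1 hAO hx hx'
    intro y hy
    by_contra hy'
    exact h2 hy (hb' hy')

end Completion

/-! ### Smoothing Lipschitz functions -/

section Mollify
open ContinuousLinearMap Convolution
variable {E : Type*} [NormedAddCommGroup E] [NormedSpace ℝ E] [FiniteDimensional ℝ E]
  [MeasurableSpace E] [BorelSpace E] {T : Type*} [SeminormedAddCommGroup T] [NormedSpace ℝ T]

/-- Convolution with a bump function does not increase the Lipschitz constant, even for the
pull-back `v ↦ ‖L v‖` of another norm. -/
lemma exists_contDiff_abs_sub_le_of_lipschitz (L : E →L[ℝ] T) {k : E → ℝ} {a : E} {r : ℝ} (hr : 0 < r)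
    (hk : ∀ y ∈ Metric.ball a (2 * r), ∀ z ∈ Metric.ball a (2 * r), |k y - k z| ≤ ‖L (y - z)‖)
    {ε : ℝ} (hε : 0 < ε) :
    ∃ g : E → ℝ, ContDiff ℝ ∞ g ∧ (∀ y ∈ Metric.ball a r, |g y - k y| ≤ ε) ∧
      ∀ y ∈ Metric.ball a r, ∀ v, |fderiv ℝ g y v| ≤ ‖L v‖ := by
  let μ : Measure E := Measure.addHaar
  set B := Metric.ball a (2 * r)
  let k' : E → ℝ := B.indicator k
  have hkB {y : E} (hy : y ∈ B) : k' y = k y := indicator_of_mem hy k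
  have hcont : ContinuousOn k B := by
    have : LipschitzOnWith ‖L‖₊ k B := LipschitzOnWith.of_dist_le_mul fun y hy z hz ↦ by
      rw [Real.dist_eq, dist_eq_norm]
      exact (hk y hy z hz).trans (L.le_opNorm _)
    exact this.continuousOn
  have hmeas : AEStronglyMeasurable k' μ :=
    (aestronglyMeasurable_indicator_iff measurableSet_ball).2
      (hcont.aestronglyMeasurable measurableSet_ball)
  have hbound (y : E) : ‖k' y‖ ≤ |k a| + ‖L‖ * (2 * r) := by
    by_cases hy : y ∈ B
    · rw [hkB hy, Real.norm_eq_abs]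
      have h1 := hk y hy a (Metric.mem_ball_self (by positivity))
      have h2 : ‖L (y - a)‖ ≤ ‖L‖ * (2 * r) := (L.le_opNorm _).trans (by
        gcongr
        rw [← dist_eq_norm]
        exact (Metric.mem_ball.1 hy).le)
      have := abs_sub_abs_le_abs_sub (k y) (k a)
      linarith
    · rw [show k' y = 0 from indicator_of_notMem hy k, norm_zero]
      positivity
  have hloc : LocallyIntegrable k' μ := by
    refine (locallyIntegrable_const (|k a| + ‖L‖ * (2 * r))).mono hmeas (ae_of_all _ fun y ↦ ?_)
    exact (hbound y).trans (le_abs_self _)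
  obtain ⟨δ, hδ0, hδr, hδ⟩ : ∃ δ > 0, δ ≤ r ∧ ‖L‖ * δ ≤ ε := by
    refine ⟨min r (ε / (‖L‖ + 1)), by positivity, min_le_left _ _, ?_⟩
    calc ‖L‖ * min r (ε / (‖L‖ + 1)) ≤ (‖L‖ + 1) * (ε / (‖L‖ + 1)) := by
          gcongr
          · linarith
          · exact min_le_right _ _
      _ = ε := by field_simp
  let φ : ContDiffBump (0 : E) := ⟨δ / 2, δ, by positivity, by linarith⟩
  let g : E → ℝ := φ.normed μ ⋆[lsmul ℝ ℝ, μ] k'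
  have hgs : ContDiff ℝ ∞ g :=
    φ.hasCompactSupport_normed.contDiff_convolution_left _ φ.contDiff_normed hloc
  have hsub {y z : E} (hy : y ∈ Metric.ball a r) (hz : dist z y < δ) : z ∈ B := by
    have := Metric.mem_ball.1 hy
    have h2 := dist_triangle z y a
    exact Metric.mem_ball.2 (by linarith)
  have hself {y : E} (hy : y ∈ Metric.ball a r) : y ∈ B := hsub hy (by simpa using hδ0)
  refine ⟨g, hgs, fun y hy ↦ ?_, fun y hy v ↦ ?_⟩
  · rw [← hkB (hself hy)]
    refine φ.dist_normed_convolution_le hmeas fun z hz ↦ ?_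
    have hz' : dist z y < δ := hz
    rw [Real.dist_eq, hkB (hself hy), hkB (hsub hy hz')]
    refine (hk z (hsub hy hz') y (hself hy)).trans ((L.le_opNorm _).trans (le_trans ?_ hδ))
    gcongr
    rw [← dist_eq_norm]
    exact hz'.le
  · have hlip (z : E) (hz : z ∈ Metric.ball a r) : |g z - g y| ≤ ‖L (z - y)‖ := by
      have hint (x : E) : Integrable (fun t ↦ φ.normed μ t • k' (x - t)) μ := by
        have := (φ.hasCompactSupport_normed (μ := μ)).convolutionExists_left (lsmul ℝ ℝ)
          (φ.continuous_normed (μ := μ)) hloc x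
        exact this
      have hg (x : E) : g x = ∫ t, φ.normed μ t • k' (x - t) ∂μ := rfl
      rw [hg, hg, ← integral_sub (hint z) (hint y), ← Real.norm_eq_abs]
      calc ‖∫ t, (φ.normed μ t • k' (z - t) - φ.normed μ t • k' (y - t)) ∂μ‖
          ≤ ∫ t, φ.normed μ t * ‖L (z - y)‖ ∂μ := by
            refine norm_integral_le_of_norm_le (φ.integrable_normed.mul_const _)
              (ae_of_all _ fun t ↦ ?_)
            rw [← smul_sub, norm_smul, Real.norm_of_nonneg (φ.nonneg_normed t)]
            by_cases ht : t ∈ Metric.ball (0 : E) δ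
            · refine mul_le_mul_of_nonneg_left ?_ (φ.nonneg_normed t)
              have h1 : z - t ∈ B := hsub hz (by simpa [dist_eq_norm] using ht)
              have h2 : y - t ∈ B := hsub hy (by simpa [dist_eq_norm] using ht)
              rw [hkB h1, hkB h2, Real.norm_eq_abs]
              simpa using hk _ h1 _ h2
            · have : φ.normed μ t = 0 := by
                rw [← Function.notMem_support, φ.support_normed_eq]
                exact ht
              simp [this]
        _ = ‖L (z - y)‖ := by rw [integral_mul_const, φ.integral_normed, one_mul]
    have hd : HasDerivAt (fun t : ℝ ↦ g (y + t • v)) (fderiv ℝ g y v) 0 := by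
      have h1 : HasFDerivAt g (fderiv ℝ g y) (y + (0 : ℝ) • v) := by
        simpa using (hgs.differentiable (by simp) y).hasFDerivAt
      have h2 : HasDerivAt (fun t : ℝ ↦ y + t • v) v 0 := by
        simpa using ((hasDerivAt_id (0 : ℝ)).smul_const v).const_add y
      exact h1.comp_hasDerivAt 0 h2
    refine hd.le_of_lip' (norm_nonneg _) ?_
    have hc : ContinuousAt (fun t : ℝ ↦ y + t • v) 0 := by fun_prop
    filter_upwards [hc.preimage_mem_nhds (by
      simpa using Metric.isOpen_ball.mem_nhds hy)] with t ht
    have := hlip _ ht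
    simpa [norm_smul, mul_comm] using this

end Mollify

/-! ### Charts and local smoothing -/

section TangentTrivialization
variable {n : ℕ} {M : Type*} [TopologicalSpace M] [ChartedSpace (EuclideanSpace ℝ (Fin n)) M]
  [IsManifold (𝓡 n) ∞ M]

/-- The trivialization of the tangent bundle over the chart at `p`. -/
abbrev tangentTriv (n : ℕ) {M : Type*} [TopologicalSpace M]
    [ChartedSpace (EuclideanSpace ℝ (Fin n)) M] [IsManifold (𝓡 n) ∞ M] (p : M) :=
  trivializationAt (EuclideanSpace ℝ (Fin n)) (fun x : M ↦ TangentSpace (𝓡 n) x) p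

lemma mem_baseSet_tangentTriv {p x : M} :
    x ∈ (tangentTriv n p).baseSet ↔ x ∈ (extChartAt (𝓡 n) p).source := by
  rw [extChartAt_source]
  rfl

lemma symmL_tangentTriv {p : M} {y : EuclideanSpace ℝ (Fin n)}
    (hy : y ∈ (extChartAt (𝓡 n) p).target) (v : EuclideanSpace ℝ (Fin n)) :
    mfderiv 𝓘(ℝ, EuclideanSpace ℝ (Fin n)) (𝓡 n) (extChartAt (𝓡 n) p).symm y v =
      (tangentTriv n p).symmL ℝ ((extChartAt (𝓡 n) p).symm y) v := by
  have hx : (extChartAt (𝓡 n) p).symm y ∈ (chartAt (EuclideanSpace ℝ (Fin n)) p).source := by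
    rw [← extChartAt_source (𝓡 n)]
    exact (extChartAt (𝓡 n) p).map_target hy
  have h := TangentBundle.symmL_trivializationAt (I := 𝓡 n) hx
  rw [(extChartAt (𝓡 n) p).right_inv hy] at h
  rw [ModelWithCorners.range_eq_univ, mfderivWithin_univ] at h
  exact (congrArg (fun A : EuclideanSpace ℝ (Fin n) →L[ℝ] _ ↦ A v) h).symm

end TangentTrivialization

section
variable {n : ℕ} {M : Type*} [EMetricSpace M] [ChartedSpace (EuclideanSpace ℝ (Fin n)) M]
  [IsManifold (𝓡 n) ∞ M] [RiemannianBundle (fun x : M ↦ TangentSpace (𝓡 n) x)]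
  [IsContMDiffRiemannianBundle (𝓡 n) ∞ (EuclideanSpace ℝ (Fin n))
    (fun x : M ↦ TangentSpace (𝓡 n) x)]
  [IsRiemannianManifold (𝓡 n) M]

/-- In the chart at `p`, the Riemannian distance is at most twice the distance of `g_p`. -/
lemma exists_ball_edist_symm_le (p : M) : ∃ r > 0, Metric.ball (extChartAt (𝓡 n) p p) r ⊆
      (extChartAt (𝓡 n) p).target ∧
    ∀ y ∈ Metric.ball (extChartAt (𝓡 n) p p) r, ∀ z ∈ Metric.ball (extChartAt (𝓡 n) p p) r,
      edist ((extChartAt (𝓡 n) p).symm y) ((extChartAt (𝓡 n) p).symm z) ≤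
        ENNReal.ofReal (2 * ‖(tangentTriv n p).symmL ℝ p (y - z)‖) := by
  have := isContinuousRiemannianBundle n (EuclideanSpace ℝ (Fin n))
    (fun x : M ↦ TangentSpace (𝓡 n) x)
  set φ := extChartAt (𝓡 n) p
  have h1 := eventually_norm_symmL_trivializationAt_comp_self_lt (EuclideanSpace ℝ (Fin n))
    (fun x : M ↦ TangentSpace (𝓡 n) x) p one_lt_two
  have hc : ContinuousAt φ.symm (φ p) := continuousAt_extChartAt_symm p
  have h2 : ∀ᶠ w in 𝓝 (φ p), w ∈ φ.target ∧ ‖((tangentTriv n p).symmL ℝ (φ.symm w)) ∘L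
      ((tangentTriv n p).continuousLinearMapAt ℝ p)‖ < 2 := by
    have h1' : ∀ᶠ y in 𝓝 (φ.symm (φ p)), ‖((tangentTriv n p).symmL ℝ y) ∘L
        ((tangentTriv n p).continuousLinearMapAt ℝ p)‖ < 2 := by
      rw [extChartAt_to_inv p]
      exact h1
    exact Filter.Eventually.and (extChartAt_target_mem_nhds p) (hc.eventually h1')
  obtain ⟨r, hr, hball⟩ := Metric.eventually_nhds_iff_ball.1 h2
  refine ⟨r, hr, fun w hw ↦ (hball w hw).1, fun y hy z hz ↦ ?_⟩
  have hspeed (w : EuclideanSpace ℝ (Fin n)) (hw : w ∈ Metric.ball (φ p) r) :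
      ‖mfderiv 𝓘(ℝ, EuclideanSpace ℝ (Fin n)) (𝓡 n) φ.symm w (z - y)‖ₑ ≤
        ENNReal.ofReal (2 * ‖(tangentTriv n p).symmL ℝ p (y - z)‖) := by
    obtain ⟨hw1, hw2⟩ := hball w hw
    rw [symmL_tangentTriv hw1, ← ofReal_norm]
    refine ENNReal.ofReal_le_ofReal ?_
    have hpb : p ∈ (tangentTriv n p).baseSet := FiberBundle.mem_baseSet_trivializationAt' p
    have h3 : (tangentTriv n p).symmL ℝ (φ.symm w) (z - y) =
        (((tangentTriv n p).symmL ℝ (φ.symm w)) ∘L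
          ((tangentTriv n p).continuousLinearMapAt ℝ p)) ((tangentTriv n p).symmL ℝ p (z - y)) := by
      rw [ContinuousLinearMap.comp_apply, Trivialization.continuousLinearMapAt_symmL _ hpb]
    rw [h3, show y - z = -(z - y) by abel, map_neg, norm_neg]
    exact (ContinuousLinearMap.le_opNorm _ _).trans (by gcongr)
  -- the coordinate segment from `y` to `z`
  let η : ℝ → EuclideanSpace ℝ (Fin n) := fun t ↦ y + t • (z - y)
  have hη : ∀ t ∈ Icc (0 : ℝ) 1, η t ∈ Metric.ball (φ p) r := fun t ht ↦
    (convex_ball (φ p) r).add_smul_sub_mem hy hz ht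
  have hηd (t : ℝ) : HasDerivAt η (z - y) t := by
    have h := ((hasDerivAt_id t).smul_const (z - y)).const_add y
    rw [one_smul] at h
    exact h
  have hηs : ContMDiffOn 𝓘(ℝ) 𝓘(ℝ, EuclideanSpace ℝ (Fin n)) 1 η (Icc 0 1) := by
    refine ContMDiff.contMDiffOn (contMDiff_iff_contDiff.2 ?_)
    fun_prop
  have hγs : ContMDiffOn 𝓘(ℝ) (𝓡 n) 1 (φ.symm ∘ η) (Icc 0 1) :=
    (contMDiffOn_extChartAt_symm (n := 1) p).comp hηs fun t ht ↦ (hball _ (hη t ht)).1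
  rw [IsRiemannianManifold.out (I := 𝓡 n)]
  refine (riemannianEDist_le_pathELength hγs (by simp [η]) (by simp [η]) zero_le_one).trans ?_
  rw [pathELength_eq_lintegral_mfderiv_Icc]
  have hle : ∀ t ∈ Icc (0 : ℝ) 1, ‖mfderiv 𝓘(ℝ) (𝓡 n) (φ.symm ∘ η) t 1‖ₑ ≤
      ENNReal.ofReal (2 * ‖(tangentTriv n p).symmL ℝ p (y - z)‖) := fun t ht ↦ by
    have hd1 : MDifferentiableAt 𝓘(ℝ, EuclideanSpace ℝ (Fin n)) (𝓡 n) φ.symm (η t) := by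
      have := mdifferentiableWithinAt_extChartAt_symm (I := 𝓡 n) (hball _ (hη t ht)).1
      rwa [ModelWithCorners.range_eq_univ, mdifferentiableWithinAt_univ] at this
    have hd2 : HasMFDerivAt 𝓘(ℝ) 𝓘(ℝ, EuclideanSpace ℝ (Fin n)) η t
        (ContinuousLinearMap.toSpanSingleton ℝ (z - y)) := (hηd t).hasFDerivAt.hasMFDerivAt
    rw [mfderiv_comp t hd1 hd2.mdifferentiableAt, hd2.mfderiv]
    have := hspeed _ (hη t ht)
    rw [← one_smul ℝ (z - y)] at this
    exact this
  refine (setLIntegral_mono' measurableSet_Icc hle).trans ?_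
  simp

/-- Near `p`, a function that is `1`-Lipschitz for the Riemannian distance is a uniform limit of
smooth functions with gradient bounded by `4`. -/
lemma exists_nhds_smooth_approx {h : M → ℝ} {p : M} (hh : ∃ U ∈ 𝓝 p, ∀ u ∈ U, ∀ v ∈ U,
      ENNReal.ofReal |h u - h v| ≤ edist u v) :
    ∃ W, IsOpen W ∧ p ∈ W ∧ ∀ ε > 0, ∃ g : M → ℝ, ContMDiffOn (𝓡 n) 𝓘(ℝ) ∞ g W ∧
      ∀ x ∈ W, |g x - h x| ≤ ε ∧ ∀ X, |mvfderiv (𝓡 n) g x X| ≤ 4 * ‖X‖ := by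
  have := isContinuousRiemannianBundle n (EuclideanSpace ℝ (Fin n))
    (fun x : M ↦ TangentSpace (𝓡 n) x)
  obtain ⟨U, hU, hUh⟩ := hh
  set φ := extChartAt (𝓡 n) p
  obtain ⟨r₁, hr₁, hball₁, hdist⟩ := exists_ball_edist_symm_le (n := n) p
  have hc : ContinuousAt φ.symm (φ p) := continuousAt_extChartAt_symm p
  obtain ⟨r₂, hr₂, hball₂⟩ := Metric.eventually_nhds_iff_ball.1
    (hc.eventually (by rw [extChartAt_to_inv p]; exact hU))
  obtain ⟨r, hr0, hr1, hr2⟩ : ∃ r > 0, 2 * r ≤ r₁ ∧ 2 * r ≤ r₂ :=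
    ⟨min r₁ r₂ / 2, by positivity, by linarith [min_le_left r₁ r₂], by linarith [min_le_right r₁ r₂]⟩
  obtain ⟨W', hW'sub, hW'o, hpW'⟩ := mem_nhds_iff.1
    (eventually_norm_symmL_trivializationAt_self_comp_lt (EuclideanSpace ℝ (Fin n))
    (fun x : M ↦ TangentSpace (𝓡 n) x) p one_lt_two)
  have hWo : IsOpen (φ.source ∩ φ ⁻¹' Metric.ball (φ p) r) :=
    isOpen_extChartAt_preimage' p Metric.isOpen_ball
  refine ⟨(φ.source ∩ φ ⁻¹' Metric.ball (φ p) r) ∩ W', hWo.inter hW'o,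
    ⟨⟨mem_extChartAt_source p, Metric.mem_ball_self hr0⟩, hpW'⟩, fun ε hε ↦ ?_⟩
  -- in the chart, `h` is Lipschitz with constant `2` for `g_p`, and comparing `g_p` with `g_x` costs
  -- another factor of `2`
  let L : EuclideanSpace ℝ (Fin n) →L[ℝ] TangentSpace (𝓡 n) p :=
    (2 : ℝ) • (tangentTriv n p).symmL ℝ p
  have hL (v : EuclideanSpace ℝ (Fin n)) : ‖L v‖ = 2 * ‖(tangentTriv n p).symmL ℝ p v‖ := by
    simp [L, norm_smul]
  obtain ⟨g, hg, hgh, hgL⟩ := exists_contDiff_abs_sub_le_of_lipschitz L (k := h ∘ φ.symm)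
    (a := φ p) hr0 (fun y hy z hz ↦ by
      have hy1 := Metric.ball_subset_ball hr1 hy
      have hz1 := Metric.ball_subset_ball hr1 hz
      have h1 := hUh _ (hball₂ y (Metric.ball_subset_ball hr2 hy)) _
        (hball₂ z (Metric.ball_subset_ball hr2 hz))
      have h2 := h1.trans (hdist y hy1 z hz1)
      rw [hL]
      exact (ENNReal.ofReal_le_ofReal_iff (by positivity)).1 h2) hε
  refine ⟨g ∘ φ, ?_, fun x hx ↦ ⟨?_, fun X ↦ ?_⟩⟩
  · refine (hg.contMDiff.comp_contMDiffOn (contMDiffOn_extChartAt (x := p))).mono fun x hx ↦ ?_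
    rw [← extChartAt_source (𝓡 n)]
    exact hx.1.1
  · have := hgh (φ x) hx.1.2
    simpa [φ.left_inv hx.1.1] using this
  · have hxs : x ∈ (chartAt (EuclideanSpace ℝ (Fin n)) p).source := by
      rw [← extChartAt_source (𝓡 n)]
      exact hx.1.1
    have hd1 : MDifferentiableAt (𝓡 n) 𝓘(ℝ, EuclideanSpace ℝ (Fin n)) φ x :=
      mdifferentiableAt_extChartAt hxs
    have hd2 : DifferentiableAt ℝ g (φ x) := hg.differentiable (by simp) _
    have h1 : mvfderiv (𝓡 n) (g ∘ φ) x X =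
        fderiv ℝ g (φ x) ((tangentTriv n p).continuousLinearMapAt ℝ x X) := by
      rw [TangentBundle.continuousLinearMapAt_trivializationAt hxs]
      rw [mvfderiv, mfderiv_comp x hd2.mdifferentiableAt hd1, mfderiv_eq_fderiv]
      rfl
    rw [h1]
    refine (hgL _ hx.1.2 _).trans ?_
    rw [hL]
    have h2 := hW'sub hx.2
    have h3 := ContinuousLinearMap.le_of_opNorm_le _ (le_of_lt h2) X
    rw [ContinuousLinearMap.comp_apply] at h3
    linarith
end

/-! ### Differentials of functions -/

section Coordinates
variable {n : ℕ} {M : Type*} [TopologicalSpace M] [ChartedSpace (EuclideanSpace ℝ (Fin n)) M]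
  [IsManifold (𝓡 n) ∞ M]

lemma fderiv_comp_extChartAt_symm {f : M → ℝ} {p : M} {y : EuclideanSpace ℝ (Fin n)}
    (hy : y ∈ (extChartAt (𝓡 n) p).target)
    (hf : MDifferentiableAt (𝓡 n) 𝓘(ℝ) f ((extChartAt (𝓡 n) p).symm y))
    (v : EuclideanSpace ℝ (Fin n)) :
    fderiv ℝ (f ∘ (extChartAt (𝓡 n) p).symm) y v =
      mvfderiv (𝓡 n) f ((extChartAt (𝓡 n) p).symm y)
        ((tangentTriv n p).symmL ℝ ((extChartAt (𝓡 n) p).symm y) v) := by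
  have hd : MDifferentiableAt 𝓘(ℝ, EuclideanSpace ℝ (Fin n)) (𝓡 n) (extChartAt (𝓡 n) p).symm y := by
    have := mdifferentiableWithinAt_extChartAt_symm (I := 𝓡 n) hy
    rwa [ModelWithCorners.range_eq_univ, mdifferentiableWithinAt_univ] at this
  rw [← symmL_tangentTriv hy, ← mfderiv_eq_fderiv, mfderiv_comp y hf hd]
  rfl

lemma contDiffOn_comp_extChartAt_symm {f : M → ℝ} (hf : ContMDiff (𝓡 n) 𝓘(ℝ) ∞ f) (p : M) :
    ContDiffOn ℝ ∞ (f ∘ (extChartAt (𝓡 n) p).symm) (extChartAt (𝓡 n) p).target :=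
  contMDiffOn_iff_contDiffOn.1 (hf.comp_contMDiffOn (contMDiffOn_extChartAt_symm p))

lemma mvfderiv_eq_zero_of_eventuallyEq_const {f : M → ℝ} {x : M} {c : ℝ}
    (h : f =ᶠ[𝓝 x] fun _ ↦ c) : mvfderiv (𝓡 n) f x = 0 := by
  ext X
  have h1 : mfderiv (𝓡 n) 𝓘(ℝ) f x = 0 := by
    rw [h.mfderiv_eq, mfderiv_const]
    rfl
  change (mfderiv (𝓡 n) 𝓘(ℝ) f x X : ℝ) = 0
  rw [h1]
  rfl

lemma mvfderiv_sum {ι : Type*} (t : Finset ι) {f : ι → M → ℝ} {x : M}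
    (hf : ∀ i ∈ t, MDifferentiableAt (𝓡 n) 𝓘(ℝ) (f i) x) :
    MDifferentiableAt (𝓡 n) 𝓘(ℝ) (∑ i ∈ t, f i) x ∧
      mvfderiv (𝓡 n) (∑ i ∈ t, f i) x = ∑ i ∈ t, mvfderiv (𝓡 n) (f i) x := by
  classical
  induction t using Finset.induction_on with
  | empty => exact ⟨mdifferentiableAt_const, by simp [mvfderiv_zero]⟩
  | insert i t hi ih =>
    obtain ⟨h1, h2⟩ := ih fun j hj ↦ hf j (Finset.mem_insert_of_mem hj)
    have h3 := hf i (Finset.mem_insert_self _ _)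
    rw [Finset.sum_insert hi, Finset.sum_insert hi, mvfderiv_add h3 h1, h2]
    exact ⟨h3.add h1, rfl⟩

lemma mvfderiv_eq_zero_of_isLocalMax {f : M → ℝ} {x : M} (hf : MDifferentiableAt (𝓡 n) 𝓘(ℝ) f x)
    (hx : IsLocalMax f x) : mvfderiv (𝓡 n) f x = 0 := by
  set φ := extChartAt (𝓡 n) x
  ext X
  have hxb : x ∈ (tangentTriv n x).baseSet := FiberBundle.mem_baseSet_trivializationAt' x
  have hxs := mem_extChartAt_source (I := 𝓡 n) x
  have h3 := fderiv_comp_extChartAt_symm (f := f) (φ.map_source hxs)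
    (by rwa [φ.left_inv hxs]) ((tangentTriv n x).continuousLinearMapAt ℝ x X)
  rw [φ.left_inv hxs, Trivialization.symmL_continuousLinearMapAt _ hxb] at h3
  have hloc : IsLocalMax (f ∘ φ.symm) (φ x) := by
    have hc : ContinuousAt φ.symm (φ x) := continuousAt_extChartAt_symm x
    have : ∀ᶠ z in 𝓝 (φ.symm (φ x)), f z ≤ f x := by rw [φ.left_inv hxs]; exact hx
    filter_upwards [hc.eventually this] with y hy
    simpa [φ.left_inv hxs] using hy
  rw [← h3, hloc.fderiv_eq_zero]
  rfl

variable [RiemannianBundle (fun x : M ↦ TangentSpace (𝓡 n) x)]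
  [IsContMDiffRiemannianBundle (𝓡 n) ∞ (EuclideanSpace ℝ (Fin n))
    (fun x : M ↦ TangentSpace (𝓡 n) x)]

lemma eventually_abs_mvfderiv_le {f : M → ℝ} (hf : ContMDiff (𝓡 n) 𝓘(ℝ) ∞ f) (p : M) :
    ∃ C, ∀ᶠ x in 𝓝 p, ∀ X, |mvfderiv (𝓡 n) f x X| ≤ C * ‖X‖ := by
  have := isContinuousRiemannianBundle n (EuclideanSpace ℝ (Fin n))
    (fun x : M ↦ TangentSpace (𝓡 n) x)
  set φ := extChartAt (𝓡 n) p
  obtain ⟨C₁, hC₁, h1⟩ := eventually_norm_trivializationAt_lt (EuclideanSpace ℝ (Fin n))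
    (fun x : M ↦ TangentSpace (𝓡 n) x) p
  have hcd := contDiffOn_comp_extChartAt_symm hf p
  have hcont : ContinuousAt (fun y ↦ ‖fderiv ℝ (f ∘ φ.symm) y‖) (φ p) :=
    ((hcd.continuousOn_fderiv_of_isOpen (isOpen_extChartAt_target p) (by simp)).continuousAt
      (extChartAt_target_mem_nhds p)).norm
  have h2 : ∀ᶠ y in 𝓝 (φ p), ‖fderiv ℝ (f ∘ φ.symm) y‖ < ‖fderiv ℝ (f ∘ φ.symm) (φ p)‖ + 1 :=
    hcont.eventually (gt_mem_nhds (lt_add_one _))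
  refine ⟨(‖fderiv ℝ (f ∘ φ.symm) (φ p)‖ + 1) * C₁, ?_⟩
  filter_upwards [h1, (continuousAt_extChartAt (I := 𝓡 n) p).eventually h2,
    extChartAt_source_mem_nhds (I := 𝓡 n) p] with x hx1 hx2 hx X
  have hxb : x ∈ (tangentTriv n p).baseSet := mem_baseSet_tangentTriv.2 hx
  have h3 := fderiv_comp_extChartAt_symm (f := f) (φ.map_source hx)
    (hf.mdifferentiableAt (by simp)) ((tangentTriv n p).continuousLinearMapAt ℝ x X)
  rw [φ.left_inv hx, Trivialization.symmL_continuousLinearMapAt _ hxb] at h3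
  rw [← h3, ← Real.norm_eq_abs]
  refine (ContinuousLinearMap.le_opNorm _ _).trans ?_
  rw [mul_assoc]
  exact mul_le_mul hx2.le (ContinuousLinearMap.le_of_opNorm_le _ hx1.le X) (norm_nonneg _)
    (by positivity)

lemma exists_abs_mvfderiv_le {f : M → ℝ} (hf : ContMDiff (𝓡 n) 𝓘(ℝ) ∞ f)
    (hc : HasCompactSupport f) : ∃ C, 0 ≤ C ∧ ∀ x X, |mvfderiv (𝓡 n) f x X| ≤ C * ‖X‖ := by
  choose C hC using eventually_abs_mvfderiv_le hf
  obtain ⟨t, -, ht⟩ := hc.isCompact.elim_nhds_subcover (fun p ↦ {x | ∀ X, |mvfderiv (𝓡 n) f x X|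
    ≤ C p * ‖X‖}) fun p _ ↦ hC p
  refine ⟨∑ p ∈ t, |C p|, Finset.sum_nonneg fun _ _ ↦ abs_nonneg _, fun x X ↦ ?_⟩
  by_cases hx : x ∈ tsupport f
  · obtain ⟨p, hp⟩ := mem_iUnion.1 (ht hx)
    obtain ⟨hpt, hp⟩ := mem_iUnion.1 hp
    refine (hp X).trans ?_
    gcongr
    exact (le_abs_self _).trans (Finset.single_le_sum (f := fun p ↦ |C p|)
      (fun _ _ ↦ abs_nonneg _) hpt)
  · have h0 : f =ᶠ[𝓝 x] fun _ ↦ 0 := by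
      rw [notMem_tsupport_iff_eventuallyEq] at hx
      exact hx
    rw [mvfderiv_eq_zero_of_eventuallyEq_const h0]
    simp only [_root_.zero_apply, abs_zero]
    exact mul_nonneg (Finset.sum_nonneg fun _ _ ↦ abs_nonneg _) (norm_nonneg _)

end Coordinates

/-! ### Compactly supported cutoff functions with bounded gradient -/

/-- If the Cauchy boundary lies in the open set `Ω`, then compact sets have compactly supported
smooth cutoff functions whose gradient is bounded outside `Ω` by a universal constant. Inside `Ω`
the gradient is not controlled. -/
theorem exists_smooth_cutoff (n : ℕ) (M : Type*) [EMetricSpace M]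
    [ChartedSpace (EuclideanSpace ℝ (Fin n)) M]
    [IsManifold (𝓡 n) ∞ M] [SecondCountableTopology M]
    [RiemannianBundle (fun x : M ↦ TangentSpace (𝓡 n) x)]
    [IsContMDiffRiemannianBundle (𝓡 n) ∞ (EuclideanSpace ℝ (Fin n))
      (fun x : M ↦ TangentSpace (𝓡 n) x)]
    [IsRiemannianManifold (𝓡 n) M] :
    ∃ K : ℝ, 0 ≤ K ∧ ∀ Ω : Set (UniformSpace.Completion M), IsOpen Ω → cauchyBoundary M ⊆ Ω →
      ∀ C : Set M, IsCompact C → ∃ χ : M → ℝ, ContMDiff (𝓡 n) 𝓘(ℝ) ∞ χ ∧ HasCompactSupport χ ∧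
        (∀ x, χ x ∈ Icc 0 1) ∧ (∀ x ∈ C, (x : UniformSpace.Completion M) ∉ Ω → χ x = 1) ∧
        ∀ x : M, (x : UniformSpace.Completion M) ∉ Ω →
          ∀ X, |mvfderiv (𝓡 n) χ x X| ≤ K * ‖X‖ := by
  classical
  have : LocallyCompactSpace M := ChartedSpace.locallyCompactSpace (EuclideanSpace ℝ (Fin n)) M
  -- `G` vanishes on `(-∞, 1/4]` and is `1` on `[3/4, ∞)`: this absorbs an error of `1/4` in the
  -- approximation of `h`
  let G : ℝ → ℝ := fun t ↦ Real.smoothTransition (2 * t - 1 / 2)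
  have hG : ContDiff ℝ ∞ G := Real.smoothTransition.contDiff.comp (by fun_prop)
  obtain ⟨K₁, hK₁⟩ := (isCompact_Icc (a := (-1 : ℝ)) (b := 2)).exists_bound_of_continuousOn
    (hG.continuous_deriv (by simp)).continuousOn
  have hK₁0 : 0 ≤ K₁ := (norm_nonneg _).trans (hK₁ 0 (by norm_num))
  refine ⟨K₁ * 5, by positivity, fun Ω hΩ hb C hC ↦ ?_⟩
  obtain ⟨O, hOΩ, hO⟩ := exists_subset_of_cauchyBoundary_subset hΩ hb
  obtain ⟨h, h01, hC1, hcpt, hlip⟩ := exists_lipschitz_cutoff (exists_edist_lt_edist_lt n) hO hC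
  -- it suffices to smooth `h` near the compact part of its support that lies outside `Ω`
  set Z : Set M := {x | (x : UniformSpace.Completion M) ∉ Ω} with hZ
  have hZcl : IsClosed Z := hΩ.isClosed_compl.preimage (UniformSpace.Completion.continuous_coe M)
  set S : Set M := closure {x | h x ≠ 0} ∩ Z
  have hS : IsCompact S := hcpt.inter_right hZcl
  have hex (p : M) : ∃ W, IsOpen W ∧ (p ∈ S → p ∈ W) ∧ IsCompact (closure W) ∧
      ∀ ε > 0, ∃ g : M → ℝ, ContMDiffOn (𝓡 n) 𝓘(ℝ) ∞ g W ∧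
      ∀ x ∈ W, |g x - h x| ≤ ε ∧ ∀ X, |mvfderiv (𝓡 n) g x X| ≤ 4 * ‖X‖ := by
    by_cases hp : p ∈ S
    · obtain ⟨W, hW, hpW, happ⟩ := exists_nhds_smooth_approx (n := n)
        (hlip p fun hpO ↦ hp.2 (hOΩ p hpO))
      obtain ⟨K', hK', hpK'⟩ := exists_compact_mem_nhds p
      refine ⟨W ∩ interior K', hW.inter isOpen_interior, fun _ ↦ ⟨hpW, mem_interior_iff_mem_nhds.2
        hpK'⟩, hK'.of_isClosed_subset isClosed_closure (closure_minimal
        (inter_subset_right.trans interior_subset) hK'.isClosed), fun ε hε ↦ ?_⟩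
      obtain ⟨g, hg, hgh⟩ := happ ε hε
      exact ⟨g, hg.mono inter_subset_left, fun x hx ↦ hgh x hx.1⟩
    · exact ⟨∅, isOpen_empty, fun h ↦ absurd h hp, by simp, fun ε _ ↦ ⟨0, by
        simp [ContMDiffOn], by simp⟩⟩
  choose W hWo hpW hWc hWapp using hex
  obtain ⟨t, ht⟩ := hS.elim_finite_subcover W hWo fun p hp ↦ mem_iUnion.2 ⟨p, hpW p hp⟩
  obtain ⟨φ, hφ⟩ := SmoothPartitionOfUnity.exists_isSubordinate (𝓡 n) hS.isClosed
    (fun i : t ↦ W i) (fun i ↦ hWo i) (by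
      intro x hx
      obtain ⟨p, hp⟩ := mem_iUnion.1 (ht hx)
      obtain ⟨hpt, hp⟩ := mem_iUnion.1 hp
      exact mem_iUnion.2 ⟨⟨p, hpt⟩, hp⟩)
  have hφs (i : t) : ContMDiff (𝓡 n) 𝓘(ℝ) ∞ (φ i) := (φ i).contMDiff
  have hφc (i : t) : HasCompactSupport (φ i) :=
    (hWc i).of_isClosed_subset (isClosed_tsupport _) ((hφ i).trans subset_closure)
  have hφsum {x : M} (hx : x ∈ S) : ∑ i, φ i x = 1 := by
    rw [← finsum_eq_sum_of_fintype]; exact φ.sum_eq_one hx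
  have hφle (x : M) : ∑ i, φ i x ≤ 1 := by
    rw [← finsum_eq_sum_of_fintype]; exact φ.sum_le_one x
  choose B hB0 hB using fun i ↦ exists_abs_mvfderiv_le (hφs i) (hφc i)
  -- the differentials of the `φ i` are only multiplied with `g i - h`, hence by at most `ε`
  obtain ⟨ε, hε0, hε4, hεB⟩ : ∃ ε > 0, ε ≤ 1 / 4 ∧ ε * ∑ i, B i ≤ 1 := by
    have hB0' : 0 ≤ ∑ i, B i := Finset.sum_nonneg fun i _ ↦ hB0 i
    refine ⟨min (1 / 4) (1 / (∑ i, B i + 1)), by positivity, min_le_left _ _, ?_⟩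
    calc min (1 / 4) (1 / (∑ i, B i + 1)) * ∑ i, B i
        ≤ (1 / (∑ i, B i + 1)) * (∑ i, B i + 1) := by
          gcongr
          · exact min_le_right _ _
          · linarith
      _ = 1 := by field_simp
  choose g hg hgh using fun i : t ↦ hWapp i ε hε0
  let f (i : t) : M → ℝ := fun x ↦ φ i x • g i x
  have hfs (i : t) : ContMDiff (𝓡 n) 𝓘(ℝ) ∞ (f i) := φ.contMDiff_smul fun x hx ↦
    (hg i).contMDiffAt ((hWo i).mem_nhds (hφ i hx))
  have hW0 {i : t} {x : M} (hx : x ∉ W i) : φ i x = 0 :=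
    image_eq_zero_of_notMem_tsupport fun h ↦ hx (hφ i h)
  let H : M → ℝ := ∑ i, f i
  have hHx (x : M) : H x = ∑ i, φ i x * g i x := by simp [H, f]
  have hHs : ContMDiff (𝓡 n) 𝓘(ℝ) ∞ H := by
    have : H = fun x ↦ ∑ i, f i x := by ext x; simp [H]
    rw [this]
    exact contMDiff_finsetSum fun i _ ↦ hfs i
  have happrox (x : M) : |H x - (∑ i, φ i x) * h x| ≤ ε := by
    rw [hHx, Finset.sum_mul, ← Finset.sum_sub_distrib]
    calc |∑ i, (φ i x * g i x - φ i x * h x)| ≤ ∑ i, φ i x * ε := by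
          refine (Finset.abs_sum_le_sum_abs _ _).trans (Finset.sum_le_sum fun i _ ↦ ?_)
          rw [← mul_sub, abs_mul, abs_of_nonneg (φ.nonneg i x)]
          by_cases hx : x ∈ W i
          · exact mul_le_mul_of_nonneg_left (hgh i x hx).1 (φ.nonneg i x)
          · simp [hW0 hx]
      _ ≤ ε := by
        rw [← Finset.sum_mul]
        exact mul_le_of_le_one_left hε0.le (hφle x)
  have hHS {x : M} (hx : x ∈ S) : |H x - h x| ≤ ε := by
    have := happrox x
    rwa [hφsum hx, one_mul] at this
  have hderiv (x : M) (X) : mvfderiv (𝓡 n) (G ∘ H) x X = deriv G (H x) * mvfderiv (𝓡 n) H x X := by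
    have hd1 : DifferentiableAt ℝ G (H x) := hG.differentiable (by simp) _
    have hd2 : MDifferentiableAt (𝓡 n) 𝓘(ℝ) H x := hHs.mdifferentiableAt (by simp)
    rw [mvfderiv, mfderiv_comp x hd1.mdifferentiableAt hd2, mfderiv_eq_fderiv]
    change fderiv ℝ G (H x) (mvfderiv (𝓡 n) H x X) = _
    rw [fderiv_eq_smul_deriv, smul_eq_mul, mul_comm]
  have hG0 {s : ℝ} (hs : s ≤ 1 / 4) : G s = 0 := Real.smoothTransition.zero_of_nonpos (by linarith)
  refine ⟨G ∘ H, hG.contMDiff.comp hHs, ?_, fun x ↦ ⟨Real.smoothTransition.nonneg _,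
    Real.smoothTransition.le_one _⟩, fun x hx hxΩ ↦ ?_, fun x hxΩ X ↦ ?_⟩
  · refine HasCompactSupport.of_support_subset_isCompact (isCompact_iUnion fun i ↦ hφc i) ?_
    intro x hx
    by_contra hx'
    refine hx (hG0 ?_)
    have : H x = 0 := by
      rw [hHx]
      refine Finset.sum_eq_zero fun i _ ↦ ?_
      rw [image_eq_zero_of_notMem_tsupport fun h ↦ hx' (mem_iUnion.2 ⟨i, h⟩), zero_mul]
    rw [this]; norm_num
  · have hxS : x ∈ S := ⟨subset_closure (by simp [hC1 x hx]), hxΩ⟩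
    have h1 := abs_le.1 (hHS hxS)
    rw [hC1 x hx] at h1
    exact Real.smoothTransition.one_of_one_le (by linarith)
  · rw [hderiv, abs_mul]
    by_cases hxS : x ∈ S
    · have hrange : H x ∈ Icc (-1 : ℝ) 2 := by
        have h1 := abs_le.1 (hHS hxS)
        have h2 := h01 x
        constructor <;> linarith [h2.1, h2.2]
      rw [mul_assoc]
      refine mul_le_mul (hK₁ _ hrange) ?_ (abs_nonneg _) hK₁0
      have hd (i : t) : MDifferentiableAt (𝓡 n) 𝓘(ℝ) (φ i) x := (hφs i).mdifferentiableAt (by simp)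
      -- `S` need not be a neighbourhood of `x`, but the sum of the `φ i` is maximal at `x`
      have hsum0 : ∑ i, mvfderiv (𝓡 n) (φ i) x X = 0 := by
        obtain ⟨h1, h2⟩ := mvfderiv_sum (n := n) Finset.univ (f := fun i ↦ ⇑(φ i)) (x := x)
          fun i _ ↦ hd i
        have h3 := mvfderiv_eq_zero_of_isLocalMax (n := n) h1 (Eventually.of_forall fun y ↦ by
          have := hφle y
          rw [← hφsum hxS] at this
          simpa only [Finset.sum_apply] using this)
        rw [h2] at h3
        simpa using congrArg (fun A ↦ A X) h3
      have hfd (i : t) : mvfderiv (𝓡 n) (f i) x X =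
          φ i x * (if x ∈ W i then mvfderiv (𝓡 n) (g i) x X else 0) +
            mvfderiv (𝓡 n) (φ i) x X * (if x ∈ W i then g i x else h x) := by
        split_ifs with hxW
        · have hgd : MDifferentiableAt (𝓡 n) 𝓘(ℝ) (g i) x :=
            ((hg i).contMDiffAt ((hWo i).mem_nhds hxW)).mdifferentiableAt (by simp)
          have h1 := congrArg (fun A ↦ A X) (mvfderiv_smul (hd i) hgd)
          exact h1
        · have hxt : x ∉ tsupport (φ i) := fun h ↦ hxW (hφ i h)
          have h1 := notMem_tsupport_iff_eventuallyEq.1 hxt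
          have h2 : f i =ᶠ[𝓝 x] fun _ ↦ 0 := by
            filter_upwards [h1] with y hy
            simp [f, hy]
          rw [mvfderiv_eq_zero_of_eventuallyEq_const h2,
            mvfderiv_eq_zero_of_eventuallyEq_const (c := 0) h1, hW0 hxW]
          simp
      have hHd : mvfderiv (𝓡 n) H x X = ∑ i, mvfderiv (𝓡 n) (f i) x X := by
        rw [(mvfderiv_sum (n := n) Finset.univ (f := f) (x := x)
          fun i _ ↦ (hfs i).mdifferentiableAt (by simp)).2]
        simp
      have hHd2 : mvfderiv (𝓡 n) H x X =
          ∑ i, (φ i x * (if x ∈ W i then mvfderiv (𝓡 n) (g i) x X else 0) +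
            mvfderiv (𝓡 n) (φ i) x X * ((if x ∈ W i then g i x else h x) - h x)) := by
        simp only [hHd, hfd, Finset.sum_add_distrib, mul_sub, Finset.sum_sub_distrib,
          ← Finset.sum_mul, hsum0]
        ring
      rw [hHd2]
      calc |∑ i, (φ i x * (if x ∈ W i then mvfderiv (𝓡 n) (g i) x X else 0) +
            mvfderiv (𝓡 n) (φ i) x X * ((if x ∈ W i then g i x else h x) - h x))|
          ≤ ∑ i, (φ i x * (4 * ‖X‖) + B i * ‖X‖ * ε) := by
            refine (Finset.abs_sum_le_sum_abs _ _).trans (Finset.sum_le_sum fun i _ ↦ ?_)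
            refine (abs_add_le _ _).trans (add_le_add ?_ ?_)
            · rw [abs_mul, abs_of_nonneg (φ.nonneg i x)]
              refine mul_le_mul_of_nonneg_left ?_ (φ.nonneg i x)
              split_ifs with hxW
              · exact (hgh i x hxW).2 X
              · simp
            · rw [abs_mul]
              refine mul_le_mul (hB i x X) ?_ (abs_nonneg _) (mul_nonneg (hB0 i) (norm_nonneg _))
              split_ifs with hxW
              · exact (hgh i x hxW).1
              · simp [hε0.le]
        _ = (∑ i, φ i x) * (4 * ‖X‖) + (ε * ∑ i, B i) * ‖X‖ := by
            rw [Finset.sum_add_distrib, Finset.sum_mul, Finset.mul_sum, Finset.sum_mul]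
            congr 1
            exact Finset.sum_congr rfl fun i _ ↦ by ring
        _ ≤ 1 * (4 * ‖X‖) + 1 * ‖X‖ := by
            gcongr
            exact hφle x
        _ = 5 * ‖X‖ := by ring
    · -- here `h` vanishes near `x`
      have hx0 : ∀ᶠ y in 𝓝 x, H y ≤ 1 / 4 := by
        have : (closure {x | h x ≠ 0})ᶜ ∈ 𝓝 x :=
          isClosed_closure.isOpen_compl.mem_nhds fun hx ↦ hxS ⟨hx, hxΩ⟩
        filter_upwards [this] with y hy
        have hy0 : h y = 0 := by
          by_contra h'
          exact hy (subset_closure h')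
        have := abs_le.1 (happrox y)
        rw [hy0, mul_zero] at this
        linarith
      have hconst : (G ∘ H) =ᶠ[𝓝 x] fun _ ↦ (0 : ℝ) := by
        filter_upwards [hx0] with y hy
        exact hG0 hy
      rw [← abs_mul, ← hderiv, mvfderiv_eq_zero_of_eventuallyEq_const hconst]
      simp only [_root_.zero_apply, abs_zero]
      positivity

/-! ### The volume density in charts -/

section
variable {n : ℕ} {M : Type*} [TopologicalSpace M] [ChartedSpace (EuclideanSpace ℝ (Fin n)) M]
  {F : Type*} [NormedAddCommGroup F] [NormedSpace ℝ F]
  {V : M → Type*} [TopologicalSpace (TotalSpace F V)] [∀ x, AddCommGroup (V x)]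
  [∀ x, Module ℝ (V x)] [∀ x, TopologicalSpace (V x)] [FiberBundle F V] [VectorBundle ℝ F V]
  [ContMDiffVectorBundle ∞ F V (𝓡 n)]

lemma contMDiffOn_symmL (e : Trivialization F (π F V)) [MemTrivializationAtlas e] (v : F) :
    ContMDiffOn (𝓡 n) ((𝓡 n).prod 𝓘(ℝ, F)) ∞ (fun x ↦ TotalSpace.mk' F x (e.symmL ℝ x v))
      e.baseSet := by
  have h : ContMDiffOn (𝓡 n) ((𝓡 n).prod 𝓘(ℝ, F)) ∞ (fun x : M ↦ (x, v)) e.baseSet :=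
    contMDiffOn_id.prodMk contMDiffOn_const
  refine ((e.contMDiffOn_symm (IB := 𝓡 n) (n := ∞)).comp h fun x hx ↦ ?_).congr fun x hx ↦ ?_
  · rw [Trivialization.target_eq]
    exact ⟨hx, mem_univ _⟩
  · rw [Trivialization.symmL_apply _ hx]
    exact e.mk_symm hx v

end

section Density
variable {n : ℕ} {M : Type*} [TopologicalSpace M] [ChartedSpace (EuclideanSpace ℝ (Fin n)) M]
  [IsManifold (𝓡 n) ∞ M]

/-- Change of coordinates for tangent vectors. -/
lemma symmL_tangentTriv_transition {p q : M} {y : EuclideanSpace ℝ (Fin n)}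
    (hy : y ∈ (extChartAt (𝓡 n) q).target)
    (hp : (extChartAt (𝓡 n) q).symm y ∈ (extChartAt (𝓡 n) p).source) :
    DifferentiableAt ℝ (extChartAt (𝓡 n) p ∘ (extChartAt (𝓡 n) q).symm) y ∧
    ∀ v, (tangentTriv n q).symmL ℝ ((extChartAt (𝓡 n) q).symm y) v =
      (tangentTriv n p).symmL ℝ ((extChartAt (𝓡 n) q).symm y)
        (fderiv ℝ (extChartAt (𝓡 n) p ∘ (extChartAt (𝓡 n) q).symm) y v) := by
  have hd : MDifferentiableAt 𝓘(ℝ, EuclideanSpace ℝ (Fin n)) (𝓡 n) (extChartAt (𝓡 n) q).symm y := by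
    have := mdifferentiableWithinAt_extChartAt_symm (I := 𝓡 n) hy
    rwa [ModelWithCorners.range_eq_univ, mdifferentiableWithinAt_univ] at this
  have hps : (extChartAt (𝓡 n) q).symm y ∈ (chartAt (EuclideanSpace ℝ (Fin n)) p).source := by
    rwa [← extChartAt_source (𝓡 n)]
  have hd1 : MDifferentiableAt (𝓡 n) 𝓘(ℝ, EuclideanSpace ℝ (Fin n)) (extChartAt (𝓡 n) p)
      ((extChartAt (𝓡 n) q).symm y) := mdifferentiableAt_extChartAt hps
  refine ⟨(hd1.comp y hd).differentiableAt, fun v ↦ ?_⟩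
  rw [← symmL_tangentTriv hy, ← mfderiv_eq_fderiv, mfderiv_comp y hd1 hd]
  have h1 := TangentBundle.continuousLinearMapAt_trivializationAt (I := 𝓡 n) hps
  have h2 : mfderiv (𝓡 n) 𝓘(ℝ, EuclideanSpace ℝ (Fin n)) (extChartAt (𝓡 n) p)
      ((extChartAt (𝓡 n) q).symm y) (mfderiv 𝓘(ℝ, EuclideanSpace ℝ (Fin n)) (𝓡 n)
        (extChartAt (𝓡 n) q).symm y v) = (tangentTriv n p).continuousLinearMapAt ℝ
      ((extChartAt (𝓡 n) q).symm y) (mfderiv 𝓘(ℝ, EuclideanSpace ℝ (Fin n)) (𝓡 n)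
        (extChartAt (𝓡 n) q).symm y v) :=
    (congrArg (fun A : TangentSpace (𝓡 n) _ →L[ℝ] EuclideanSpace ℝ (Fin n) ↦ A _) h1).symm
  refine Eq.trans ?_ (congrArg _ h2.symm)
  exact ((tangentTriv n p).symmL_continuousLinearMapAt (mem_baseSet_tangentTriv.2 hp) _).symm

lemma linearIndependent_symmL {p x : M} (hx : x ∈ (tangentTriv n p).baseSet) :
    LinearIndependent ℝ fun i : Fin n ↦ (tangentTriv n p).symmL ℝ x
      (EuclideanSpace.single i (1 : ℝ)) := by
  have h := (EuclideanSpace.basisFun (Fin n) ℝ).toBasis.linearIndependent.map'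
    ((tangentTriv n p).continuousLinearEquivAt ℝ x hx).symm.toLinearEquiv.toLinearMap
    (LinearEquiv.ker _)
  have h1 : (fun i : Fin n ↦ (tangentTriv n p).symmL ℝ x (EuclideanSpace.single i (1 : ℝ))) =
      (((tangentTriv n p).continuousLinearEquivAt ℝ x hx).symm ∘
        (EuclideanSpace.basisFun (Fin n) ℝ).toBasis) := by
    ext1 i
    simp [Trivialization.symmL_apply _ hx]
  rw [h1]
  exact h

variable [RiemannianBundle (fun x : M ↦ TangentSpace (𝓡 n) x)]

lemma chartGram_eq_gram {p : M} {y : EuclideanSpace ℝ (Fin n)}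
    (hy : y ∈ (extChartAt (𝓡 n) p).target) :
    chartGram n p y = Matrix.gram ℝ fun i ↦ (tangentTriv n p).symmL ℝ
      ((extChartAt (𝓡 n) p).symm y) (EuclideanSpace.single i (1 : ℝ)) := by
  ext i j
  simp only [chartGram, Matrix.of_apply, Matrix.gram_apply]
  rw [symmL_tangentTriv hy, symmL_tangentTriv hy]

lemma _root_.Matrix.det_gram_pos {E : Type*} [NormedAddCommGroup E] [InnerProductSpace ℝ E]
    {ι : Type*} [Fintype ι] [DecidableEq ι] {v : ι → E} (hv : LinearIndependent ℝ v) :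
    0 < (Matrix.gram ℝ v).det := (Matrix.posDef_gram_of_linearIndependent hv).det_pos

lemma chartGram_det_pos {p : M} {y : EuclideanSpace ℝ (Fin n)}
    (hy : y ∈ (extChartAt (𝓡 n) p).target) : 0 < (chartGram n p y).det := by
  rw [chartGram_eq_gram hy]
  exact Matrix.det_gram_pos (linearIndependent_symmL
    (mem_baseSet_tangentTriv.2 ((extChartAt (𝓡 n) p).map_target hy)))

/-- The volume density transforms with the Jacobian of the change of charts. -/
lemma chartGram_det_transition {p q : M} {y : EuclideanSpace ℝ (Fin n)}
    (hy : y ∈ (extChartAt (𝓡 n) q).target)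
    (hp : (extChartAt (𝓡 n) q).symm y ∈ (extChartAt (𝓡 n) p).source) :
    √(chartGram n q y).det =
      |(fderiv ℝ (extChartAt (𝓡 n) p ∘ (extChartAt (𝓡 n) q).symm) y).det| *
        √(chartGram n p ((extChartAt (𝓡 n) p) ((extChartAt (𝓡 n) q).symm y))).det := by
  set T := fderiv ℝ (extChartAt (𝓡 n) p ∘ (extChartAt (𝓡 n) q).symm) y
  set x := (extChartAt (𝓡 n) q).symm y
  have hT := (symmL_tangentTriv_transition hy hp).2
  let b := (EuclideanSpace.basisFun (Fin n) ℝ).toBasis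
  let J := LinearMap.toMatrix b b T.toLinearMap
  have hJ : J.det = T.det := LinearMap.det_toMatrix b _
  have hJa (k j : Fin n) : J k j = T (EuclideanSpace.single j 1) k := by
    simp [J, b, LinearMap.toMatrix_apply]
  have hcol (j : Fin n) : (tangentTriv n q).symmL ℝ x (EuclideanSpace.single j (1 : ℝ)) =
      ∑ k, J k j • (tangentTriv n p).symmL ℝ x (EuclideanSpace.single k (1 : ℝ)) := by
    rw [hT]
    have h1 : T (EuclideanSpace.single j 1) =
        ∑ k, J k j • EuclideanSpace.single k (1 : ℝ) := by
      conv_lhs => rw [← b.sum_repr (T (EuclideanSpace.single j 1))]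
      simp [b, hJa]
    refine (congrArg _ h1).trans ?_
    rw [map_sum]
    exact Finset.sum_congr rfl fun k _ ↦ map_smul _ _ _
  have hG : chartGram n q y = Jᵀ * chartGram n p (extChartAt (𝓡 n) p x) * J := by
    rw [chartGram_eq_gram hy, chartGram_eq_gram ((extChartAt (𝓡 n) p).map_source hp),
      (extChartAt (𝓡 n) p).left_inv hp]
    ext i j
    simp only [Matrix.mul_apply, Matrix.gram_apply, Matrix.transpose_apply]
    rw [hcol i, hcol j]
    simp only [sum_inner, inner_sum, real_inner_smul_left, real_inner_smul_right, Finset.sum_mul]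
    exact Finset.sum_congr rfl fun _ _ ↦ Finset.sum_congr rfl fun _ _ ↦ by
      rw [real_inner_comm]; ring
  rw [hG, Matrix.det_mul, Matrix.det_mul, Matrix.det_transpose, hJ, mul_right_comm,
    Real.sqrt_mul (mul_self_nonneg _), Real.sqrt_mul_self_eq_abs]

variable [IsContMDiffRiemannianBundle (𝓡 n) ∞ (EuclideanSpace ℝ (Fin n))
    (fun x : M ↦ TangentSpace (𝓡 n) x)]

lemma contDiffOn_sqrt_det_chartGram (p : M) :
    ContDiffOn ℝ ∞ (fun y ↦ √(chartGram n p y).det) (extChartAt (𝓡 n) p).target := by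
  have hent (i j : Fin n) : ContDiffOn ℝ ∞ (fun y ↦ chartGram n p y i j)
      (extChartAt (𝓡 n) p).target := by
    have h := (contMDiffOn_symmL (n := n) (tangentTriv n p) (EuclideanSpace.single i (1 : ℝ))).inner_bundle
      (contMDiffOn_symmL (n := n) (tangentTriv n p) (EuclideanSpace.single j (1 : ℝ)))
    have h2 := h.comp (contMDiffOn_extChartAt_symm p) fun y hy ↦
      mem_baseSet_tangentTriv.2 ((extChartAt (𝓡 n) p).map_target hy)
    refine (contMDiffOn_iff_contDiffOn.1 h2).congr fun y hy ↦ ?_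
    rw [chartGram_eq_gram hy]
    rfl
  refine ContDiffOn.sqrt ?_ fun y hy ↦ (chartGram_det_pos hy).ne'
  simp only [Matrix.det_apply]
  refine ContDiffOn.sum fun σ _ ↦ ?_
  refine ContDiffOn.const_smul _ (contDiffOn_prod fun i _ ↦ hent _ _)

end Density

/-! ### The Riemannian volume measure and integration by parts -/

section VolumeMeasure
variable {n : ℕ} {M : Type*} [TopologicalSpace M] [ChartedSpace (EuclideanSpace ℝ (Fin n)) M]
  [IsManifold (𝓡 n) ∞ M] [MeasurableSpace M] [BorelSpace M]
  [RiemannianBundle (fun x : M ↦ TangentSpace (𝓡 n) x)]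
  [IsContMDiffRiemannianBundle (𝓡 n) ∞ (EuclideanSpace ℝ (Fin n))
    (fun x : M ↦ TangentSpace (𝓡 n) x)]

lemma measurableSet_target_inter_preimage (p : M) {A : Set M} (hA : MeasurableSet A) :
    MeasurableSet ((extChartAt (𝓡 n) p).target ∩ (extChartAt (𝓡 n) p).symm ⁻¹' A) := by
  have ht : MeasurableSet (extChartAt (𝓡 n) p).target :=
    (isOpen_extChartAt_target (I := 𝓡 n) p).measurableSet
  have h := (continuousOn_extChartAt_symm (I := 𝓡 n) p).domRestrict.measurable hA
  have h2 := ht.subtype_image h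
  convert h2 using 1
  ext y
  simp [and_comm]

lemma chartVolume_apply (p : M) {A : Set M} (hA : MeasurableSet A) :
    chartVolume n p A = ∫⁻ y in (extChartAt (𝓡 n) p).target ∩ (extChartAt (𝓡 n) p).symm ⁻¹' A,
      ENNReal.ofReal √(chartGram n p y).det := by
  have ht : MeasurableSet (extChartAt (𝓡 n) p).target :=
    (isOpen_extChartAt_target (I := 𝓡 n) p).measurableSet
  have hm : AEMeasurable (extChartAt (𝓡 n) p).symm
      (volume.restrict (extChartAt (𝓡 n) p).target) :=
    (continuousOn_extChartAt_symm (I := 𝓡 n) p).aemeasurable ht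
  rw [chartVolume, Measure.map_apply_of_aemeasurable
    (hm.mono_ac (withDensity_absolutelyContinuous _ _)) hA, withDensity_apply',
    Measure.restrict_restrict' ht, inter_comm]

/-- The volume measures of two charts agree on the overlap. -/
lemma chartVolume_apply_eq (p q : M) {A : Set M} (hA : MeasurableSet A)
    (hAp : A ⊆ (extChartAt (𝓡 n) p).source) (hAq : A ⊆ (extChartAt (𝓡 n) q).source) :
    chartVolume n p A = chartVolume n q A := by
  set φ := extChartAt (𝓡 n) p
  set ψ := extChartAt (𝓡 n) q
  have hS := measurableSet_target_inter_preimage (n := n) q hA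
  set S := ψ.target ∩ ψ.symm ⁻¹' A
  have himg : (φ ∘ ψ.symm) '' S = φ.target ∩ φ.symm ⁻¹' A := by
    ext y
    constructor
    · rintro ⟨z, ⟨hz, hzA⟩, rfl⟩
      have : ψ.symm z ∈ A := hzA
      refine ⟨φ.map_source (hAp hzA), ?_⟩
      simpa [φ.left_inv (hAp hzA)] using hzA
    · rintro ⟨hy, hyA⟩
      have hyA' : φ.symm y ∈ A := hyA
      refine ⟨ψ (φ.symm y), ⟨ψ.map_source (hAq hyA), ?_⟩, ?_⟩
      · simpa [ψ.left_inv (hAq hyA)] using hyA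
      · simp [ψ.left_inv (hAq hyA), φ.right_inv hy]
  have hinj : InjOn (φ ∘ ψ.symm) S := by
    rintro y ⟨hy, hyA⟩ z ⟨hz, hzA⟩ hyz
    have h1 : ψ.symm y = ψ.symm z := φ.injOn (hAp hyA) (hAp hzA) hyz
    exact ψ.symm.injOn hy hz h1
  rw [chartVolume_apply p hA, chartVolume_apply q hA, ← himg,
    lintegral_image_eq_lintegral_abs_det_fderiv_mul volume hS (fun y hy ↦
      (symmL_tangentTriv_transition hy.1 (hAp hy.2)).1.hasFDerivAt.hasFDerivWithinAt) hinj]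
  refine setLIntegral_congr_fun hS fun y hy ↦ ?_
  simp only [Function.comp_apply]
  rw [← ENNReal.ofReal_mul (abs_nonneg _), ← chartGram_det_transition hy.1 (hAp hy.2)]

lemma chartVolume_apply_inter (p : M) {A : Set M} (hA : MeasurableSet A) :
    chartVolume n p (A ∩ (extChartAt (𝓡 n) p).source) = chartVolume n p A := by
  rw [chartVolume_apply p hA, chartVolume_apply p
    (hA.inter (isOpen_extChartAt_source (I := 𝓡 n) p).measurableSet)]
  congr 2
  ext y
  simp only [mem_inter_iff, mem_preimage]
  exact ⟨fun h ↦ ⟨h.1, h.2.1⟩, fun h ↦ ⟨h.1, h.2, (extChartAt (𝓡 n) p).map_target h.1⟩⟩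

/-- The Riemannian volume measure restricts to `√(det g_{ij}) dy¹ ⋯ dyⁿ` on each chart. -/
theorem riemannianVolume_restrict (p : M) :
    (riemannianVolume n M).restrict (extChartAt (𝓡 n) p).source = chartVolume n p := by
  have hU : MeasurableSet (extChartAt (𝓡 n) p).source :=
    (isOpen_extChartAt_source (I := 𝓡 n) p).measurableSet
  set U := (extChartAt (𝓡 n) p).source
  -- the right-hand side dominates every chart measure: the top measure takes care of what lies
  -- outside the chart at `p`
  have hle : riemannianVolume n M ≤ chartVolume n p + (⊤ : Measure M).restrict Uᶜ := by
    refine iSup_le fun q ↦ Measure.le_iff.2 fun A hA ↦ ?_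
    rw [Measure.add_apply, Measure.restrict_apply hA,
      ← measure_inter_add_sdiff (μ := chartVolume n q) A hU]
    refine add_le_add ?_ ?_
    · rw [← chartVolume_apply_inter q (hA.inter hU), chartVolume_apply_eq q p
        ((hA.inter hU).inter (isOpen_extChartAt_source (I := 𝓡 n) q).measurableSet)
        inter_subset_right (inter_subset_left.trans inter_subset_right)]
      exact measure_mono (inter_subset_left.trans inter_subset_left)
    · rw [sdiff_eq]
      exact (le_top : chartVolume n q ≤ ⊤) _
  refine le_antisymm (Measure.le_iff.2 fun A hA ↦ ?_) (Measure.le_iff.2 fun A hA ↦ ?_)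
  · rw [Measure.restrict_apply hA]
    refine (hle _).trans ?_
    rw [Measure.add_apply, Measure.restrict_apply (hA.inter hU), inter_assoc, inter_compl_self,
      inter_empty, measure_empty, add_zero]
    exact measure_mono inter_subset_left
  · rw [Measure.restrict_apply hA, ← chartVolume_apply_inter p hA]
    exact le_iSup (fun q : M ↦ chartVolume n q) p _

lemma setIntegral_source_riemannianVolume (p : M) {f : M → ℝ}
    (hf : AEStronglyMeasurable f ((riemannianVolume n M).restrict (extChartAt (𝓡 n) p).source)) :
    ∫ x in (extChartAt (𝓡 n) p).source, f x ∂(riemannianVolume n M) =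
      ∫ y in (extChartAt (𝓡 n) p).target,
        √(chartGram n p y).det * f ((extChartAt (𝓡 n) p).symm y) := by
  have ht : MeasurableSet (extChartAt (𝓡 n) p).target :=
    (isOpen_extChartAt_target (I := 𝓡 n) p).measurableSet
  have hm : AEMeasurable (extChartAt (𝓡 n) p).symm
      (volume.restrict (extChartAt (𝓡 n) p).target) :=
    (continuousOn_extChartAt_symm (I := 𝓡 n) p).aemeasurable ht
  rw [riemannianVolume_restrict] at hf ⊢
  have hρ : AEMeasurable (fun y ↦ ENNReal.ofReal √(chartGram n p y).det)
      (volume.restrict (extChartAt (𝓡 n) p).target) :=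
    ((contDiffOn_sqrt_det_chartGram p).continuousOn.aemeasurable ht).ennreal_ofReal
  rw [chartVolume, integral_map (hm.mono_ac (withDensity_absolutelyContinuous _ _)) hf,
    integral_withDensity_eq_integral_toReal_smul₀ hρ (ae_of_all _ fun _ ↦ ENNReal.ofReal_lt_top)]
  simp [ENNReal.toReal_ofReal (Real.sqrt_nonneg _)]

instance : IsLocallyFiniteMeasure (riemannianVolume n M) where
  finiteAtNhds p := by
    set φ := extChartAt (𝓡 n) p
    obtain ⟨r, hr, hball⟩ := Metric.nhds_basis_closedBall.mem_iff.1
      (extChartAt_target_mem_nhds (I := 𝓡 n) p)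
    have hO : IsOpen (φ.source ∩ φ ⁻¹' Metric.ball (φ p) r) :=
      isOpen_extChartAt_preimage' p Metric.isOpen_ball
    refine ⟨φ.source ∩ φ ⁻¹' Metric.ball (φ p) r, hO.mem_nhds
      ⟨mem_extChartAt_source p, Metric.mem_ball_self hr⟩, ?_⟩
    rw [← Measure.restrict_eq_self _ inter_subset_left, riemannianVolume_restrict,
      chartVolume_apply p hO.measurableSet]
    have hint : IntegrableOn (fun y ↦ √(chartGram n p y).det) (Metric.closedBall (φ p) r) :=
      ((contDiffOn_sqrt_det_chartGram p).continuousOn.mono hball).integrableOn_compact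
        (isCompact_closedBall _ _)
    refine (lintegral_mono_set fun y hy ↦ ?_).trans_lt hint.lintegral_lt_top
    have h1 : φ (φ.symm y) ∈ Metric.ball (φ p) r := hy.2.2
    rw [φ.right_inv hy.1] at h1
    exact Metric.ball_subset_closedBall h1

instance : Measure.IsOpenPosMeasure (riemannianVolume n M) where
  open_pos U hU hne := by
    obtain ⟨p, hp⟩ := hne
    set φ := extChartAt (𝓡 n) p
    have hO : IsOpen (φ.target ∩ φ.symm ⁻¹' U) :=
      (continuousOn_extChartAt_symm p).isOpen_inter_preimage (isOpen_extChartAt_target p) hU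
    have hpos : 0 < chartVolume n p U := by
      rw [chartVolume_apply p hU.measurableSet, pos_iff_ne_zero]
      intro h0
      have hρ : AEMeasurable (fun y ↦ ENNReal.ofReal √(chartGram n p y).det)
          (volume.restrict (φ.target ∩ φ.symm ⁻¹' U)) :=
        (((contDiffOn_sqrt_det_chartGram p).continuousOn.mono inter_subset_left).aemeasurable
          hO.measurableSet).ennreal_ofReal
      rw [lintegral_eq_zero_iff' hρ, Filter.EventuallyEq, ae_restrict_iff' hO.measurableSet] at h0
      have hnull : volume (φ.target ∩ φ.symm ⁻¹' U) = 0 := by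
        refine measure_mono_null (fun y hy ↦ ?_) (ae_iff.1 h0)
        intro h
        have h1 := h hy
        simp only [Pi.zero_apply, ENNReal.ofReal_eq_zero] at h1
        exact absurd (Real.sqrt_pos.2 (chartGram_det_pos hy.1)) h1.not_gt
      refine (hO.measure_pos volume ⟨φ p, mem_extChartAt_target p, ?_⟩).ne' hnull
      rw [mem_preimage, extChartAt_to_inv]
      exact hp
    exact (hpos.trans_le (le_iSup (fun q : M ↦ chartVolume n q) p U)).ne'

/-- Integration by parts for coordinate vector fields: the divergence of `∂_v` is the logarithmic
derivative of the volume density. -/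
theorem exists_integral_mvfderiv_eq (p : M) (v : EuclideanSpace ℝ (Fin n)) :
    ∃ κ : M → ℝ, ContinuousOn κ (extChartAt (𝓡 n) p).source ∧
      ∀ f : M → ℝ, ContMDiff (𝓡 n) 𝓘(ℝ) ∞ f → HasCompactSupport f →
        tsupport f ⊆ (extChartAt (𝓡 n) p).source →
        ∫ x, mvfderiv (𝓡 n) f x ((tangentTriv n p).symmL ℝ x v) ∂(riemannianVolume n M) =
          - ∫ x, κ x * f x ∂(riemannianVolume n M) := by
  set φ := extChartAt (𝓡 n) p
  have ht : IsOpen φ.target := isOpen_extChartAt_target (I := 𝓡 n) p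
  have hs : IsOpen φ.source := isOpen_extChartAt_source (I := 𝓡 n) p
  let ρ : EuclideanSpace ℝ (Fin n) → ℝ := fun y ↦ √(chartGram n p y).det
  have hρ : ContDiffOn ℝ ∞ ρ φ.target := contDiffOn_sqrt_det_chartGram p
  have hρ0 {y} (hy : y ∈ φ.target) : 0 < ρ y := Real.sqrt_pos.2 (chartGram_det_pos hy)
  let k : EuclideanSpace ℝ (Fin n) → ℝ := fun y ↦ fderiv ℝ ρ y v / ρ y
  have hk' : ContinuousOn (fun y ↦ fderiv ℝ ρ y v) φ.target :=
    (hρ.continuousOn_fderiv_of_isOpen ht (by simp)).clm_apply continuousOn_const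
  have hk : ContinuousOn k φ.target :=
    hk'.div hρ.continuousOn fun y hy ↦ (hρ0 hy).ne'
  have hκ : ContinuousOn (k ∘ φ) φ.source :=
    hk.comp (continuousOn_extChartAt p) fun x hx ↦ φ.map_source hx
  refine ⟨k ∘ φ, hκ, fun f hf hfc hfs ↦ ?_⟩
  -- the coordinate expression of `f`, extended by zero
  let g : EuclideanSpace ℝ (Fin n) → ℝ := φ.target.indicator (f ∘ φ.symm)
  set K : Set (EuclideanSpace ℝ (Fin n)) := φ '' tsupport f with hK
  have hKc : IsCompact K := hfc.isCompact.image_of_continuousOn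
    ((continuousOn_extChartAt p).mono hfs)
  have hKt : K ⊆ φ.target := by
    rintro _ ⟨x, hx, rfl⟩
    exact φ.map_source (hfs hx)
  have hg0 {y} (hy : y ∉ K) : g y = 0 := by
    by_cases hyt : y ∈ φ.target
    · refine (indicator_of_mem hyt _).trans ?_
      exact image_eq_zero_of_notMem_tsupport (f := f)
        fun h ↦ hy ⟨φ.symm y, h, φ.right_inv hyt⟩
    · exact indicator_of_notMem hyt _
  have hgsupp : tsupport g ⊆ K := closure_minimal (fun y hy ↦ by
    by_contra h
    exact hy (hg0 h)) hKc.isClosed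
  have hgc : HasCompactSupport g := hKc.of_isClosed_subset (isClosed_tsupport _) hgsupp
  have hgeq {y} (hy : y ∈ φ.target) : g =ᶠ[𝓝 y] f ∘ φ.symm := by
    filter_upwards [ht.mem_nhds hy] with z hz
    exact indicator_of_mem hz _
  have hgs : ContDiff ℝ ∞ g := by
    rw [contDiff_iff_contDiffAt]
    intro y
    by_cases hy : y ∈ K
    · exact ((contDiffOn_comp_extChartAt_symm hf p).contDiffAt (ht.mem_nhds (hKt hy)))
        |>.congr_of_eventuallyEq (hgeq (hKt hy))
    · refine contDiffAt_const (c := (0 : ℝ)) |>.congr_of_eventuallyEq ?_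
      filter_upwards [hKc.isClosed.isOpen_compl.mem_nhds hy] with z hz using hg0 hz
  have hgd {y} (hy : y ∈ φ.target) : fderiv ℝ g y v =
      mvfderiv (𝓡 n) f (φ.symm y) ((tangentTriv n p).symmL ℝ (φ.symm y) v) := by
    rw [(hgeq hy).fderiv_eq]
    exact fderiv_comp_extChartAt_symm hy (hf.mdifferentiableAt (by simp)) v
  have hgd0 {y} (hy : y ∉ K) : fderiv ℝ g y v = 0 := by
    have : g =ᶠ[𝓝 y] fun _ ↦ (0 : ℝ) := by
      filter_upwards [hKc.isClosed.isOpen_compl.mem_nhds hy] with z hz using hg0 hz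
    rw [this.fderiv_eq]
    simp
  have hgd' : Continuous fun y ↦ fderiv ℝ g y v :=
    (hgs.continuous_fderiv (by simp)).clm_apply continuous_const
  -- continuous functions on the target times functions supported in `K` are integrable
  have hint (a b : EuclideanSpace ℝ (Fin n) → ℝ) (ha : ContinuousOn a φ.target)
      (hb : Continuous b) (hbK : ∀ y ∉ K, b y = 0) : Integrable (fun y ↦ a y * b y) := by
    have h1 : IntegrableOn (fun y ↦ a y * b y) K :=
      ((ha.mono hKt).mul hb.continuousOn).integrableOn_compact hKc
    refine (integrableOn_iff_integrable_of_support_subset fun y hy ↦ ?_).1 h1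
    by_contra h
    exact hy (by simp [hbK y h])
  have hibp := integral_mul_fderiv_eq_neg_fderiv_mul_of_integrable (μ := volume) (f := ρ) (g := g)
    (v := v) (hint _ _ hk' hgs.continuous fun y hy ↦ hg0 hy)
    (hint _ _ hρ.continuousOn hgd' fun y hy ↦ hgd0 hy)
    (hint _ _ hρ.continuousOn hgs.continuous fun y hy ↦ hg0 hy)
    (fun y hy ↦ (hρ.contDiffAt (ht.mem_nhds (hKt (hgsupp hy)))).differentiableAt (by simp))
    (fun y _ ↦ hgs.differentiable (by simp) y)
  have key (A : M → ℝ) (b : EuclideanSpace ℝ (Fin n) → ℝ) (hb : ContinuousOn b φ.target)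
      (hA : ∀ x ∈ φ.source, A x = b (φ x)) (hA0 : ∀ x ∉ tsupport f, A x = 0)
      (hb0 : ∀ y ∉ K, b y = 0) : ∫ x, A x ∂(riemannianVolume n M) = ∫ y, ρ y * b y := by
    have hAc : ContinuousOn A φ.source :=
      (hb.comp (continuousOn_extChartAt p) fun x hx ↦ φ.map_source hx).congr hA
    rw [← setIntegral_eq_integral_of_forall_compl_eq_zero (s := φ.source)
      fun x hx ↦ hA0 x fun h ↦ hx (hfs h), setIntegral_source_riemannianVolume p
      (hAc.aestronglyMeasurable hs.measurableSet),
      ← setIntegral_eq_integral_of_forall_compl_eq_zero (f := fun y ↦ ρ y * b y) (s := φ.target)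
        fun y hy ↦ by rw [hb0 y fun h ↦ hy (hKt h), mul_zero]]
    refine setIntegral_congr_fun ht.measurableSet fun y hy ↦ ?_
    simp only [ρ]
    rw [hA _ (φ.map_target hy), φ.right_inv hy]
  have hf0 {x : M} (hx : x ∉ tsupport f) : f x = 0 := image_eq_zero_of_notMem_tsupport hx
  have hL : ∫ x, mvfderiv (𝓡 n) f x ((tangentTriv n p).symmL ℝ x v) ∂(riemannianVolume n M) =
      ∫ y, ρ y * fderiv ℝ g y v := by
    refine key _ _ hgd'.continuousOn (fun x hx ↦ ?_) (fun x hx ↦ ?_) fun y hy ↦ hgd0 hy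
    · rw [hgd (φ.map_source hx), φ.left_inv hx]
    · rw [mvfderiv_eq_zero_of_eventuallyEq_const (c := 0)
        (notMem_tsupport_iff_eventuallyEq.1 hx)]
      rfl
  have hR : ∫ x, (k ∘ φ) x * f x ∂(riemannianVolume n M) = ∫ y, fderiv ℝ ρ y v * g y := by
    rw [key (fun x ↦ (k ∘ φ) x * f x) (fun y ↦ k y * g y) (hk.mul hgs.continuous.continuousOn)
      (fun x hx ↦ ?_) (fun x hx ↦ by rw [hf0 hx, mul_zero]) fun y hy ↦ by rw [hg0 hy, mul_zero]]
    · refine integral_congr_ae (ae_of_all _ fun y ↦ ?_)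
      by_cases hy : y ∈ φ.target
      · have := (hρ0 hy).ne'
        simp only [k]
        field_simp
      · simp [hg0 fun h ↦ hy (hKt h)]
    · have : g (φ x) = f (φ.symm (φ x)) := indicator_of_mem (φ.map_source hx) _
      rw [this, φ.left_inv hx]
      rfl
  rw [hL, hR, hibp]

end VolumeMeasure

/-! ### Norms and square integrable sections -/

section Field
variable {𝕜 : Type*} [RCLike 𝕜] {M : Type*} [MeasurableSpace M] {μ : Measure M}
  {W : M → Type*} [∀ x, NormedAddCommGroup (W x)] [∀ x, InnerProductSpace 𝕜 (W x)]

lemma MeasurableField.norm_sq_le_of_ae_le {S : MeasurableField 𝕜 μ W} {s : S.L2Section} {g : M → ℝ}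
    (hg : Integrable g μ) (h : ∀ᵐ x ∂μ, ‖s x‖ ^ 2 ≤ g x) : ‖s‖ ^ 2 ≤ ∫ x, g x ∂μ := by
  rw [S.norm_sq]
  exact integral_mono_ae s.mem.2 hg h

lemma MeasurableField.mem_squareIntegrable_of_le {S : MeasurableField 𝕜 μ W} {s : Π x, W x}
    (hs : s ∈ S.sections) {g : M → ℝ} (hg : Integrable g μ) (h : ∀ᵐ x ∂μ, ‖s x‖ ^ 2 ≤ g x) :
    s ∈ S.squareIntegrable :=
  ⟨hs, hg.mono' ((S.aestronglyMeasurable_norm s hs).pow 2) <| by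
    filter_upwards [h] with x hx
    simpa using hx⟩

lemma MeasurableField.mk_eq_mk_iff {S : MeasurableField 𝕜 μ W} {s t : S.L2Section} :
    (SeparationQuotient.mk s : S.L2) = SeparationQuotient.mk t ↔ ∀ᵐ x ∂μ, s x = t x := by
  have hint : Integrable (fun x ↦ ‖s x - t x‖ ^ 2) μ := (s - t).mem.2
  rw [SeparationQuotient.mk_eq_mk, Metric.inseparable_iff, ← sq_eq_zero_iff, S.dist_sq,
    integral_eq_zero_iff_of_nonneg (fun x ↦ sq_nonneg _) hint]
  refine eventually_congr (Eventually.of_forall fun x ↦ ?_)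
  simp [sub_eq_zero]

lemma MeasurableField.mem_squareIntegrable_of_isCompact [TopologicalSpace M] [T2Space M]
    [OpensMeasurableSpace M] [IsFiniteMeasureOnCompacts μ] {S : MeasurableField 𝕜 μ W}
    {s : Π x, W x} (hs : s ∈ S.sections) {K : Set M} (hK : IsCompact K) (h0 : ∀ x ∉ K, s x = 0)
    (hb : ∀ p ∈ K, ∃ C, ∀ᶠ x in 𝓝 p, ‖s x‖ ≤ C) : s ∈ S.squareIntegrable := by
  obtain ⟨C, hC⟩ : ∃ C, ∀ x ∈ K, ‖s x‖ ≤ C := by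
    refine hK.induction_on (p := fun K ↦ ∃ C, ∀ x ∈ K, ‖s x‖ ≤ C) ⟨0, by simp⟩
      (fun A B hAB ⟨C, hC⟩ ↦ ⟨C, fun x hx ↦ hC x (hAB hx)⟩)
      (fun A B ⟨C, hC⟩ ⟨D, hD⟩ ↦ ⟨max C D, fun x hx ↦ ?_⟩) fun p hp ↦ ?_
    · rcases hx with hx | hx
      · exact (hC x hx).trans (le_max_left _ _)
      · exact (hD x hx).trans (le_max_right _ _)
    · obtain ⟨C, hC⟩ := hb p hp
      exact ⟨_, mem_nhdsWithin_of_mem_nhds hC, C, fun x hx ↦ hx⟩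
  refine mem_squareIntegrable_of_le hs (g := K.indicator fun _ ↦ C ^ 2)
    ((integrable_indicator_iff hK.measurableSet).2 (integrableOn_const hK.measure_ne_top))
    (ae_of_all _ fun x ↦ ?_)
  by_cases hx : x ∈ K
  · rw [indicator_of_mem hx]
    have := hC x hx
    gcongr
  · rw [indicator_of_notMem hx, h0 x hx]
    simp

end Field

/-- Real and complex inner products that induce the same norm. -/
lemma real_inner_eq_re_inner' (𝕜 : Type*) [RCLike 𝕜] {E : Type*} [NormedAddCommGroup E]
    [InnerProductSpace ℝ E] [InnerProductSpace 𝕜 E] (x y : E) :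
    inner ℝ x y = RCLike.re (inner 𝕜 x y) := by
  have h1 := norm_add_sq_real x y
  have h2 := norm_add_sq (𝕜 := 𝕜) x y
  linarith

section CotangentNorm
variable {n : ℕ} {M : Type*} [TopologicalSpace M] [ChartedSpace (EuclideanSpace ℝ (Fin n)) M]
  [RiemannianBundle (fun x : M ↦ TangentSpace (𝓡 n) x)]
  {V : M → Type*} [∀ x, NormedAddCommGroup (V x)] [∀ x, InnerProductSpace ℝ (V x)] {x : M}

lemma CotangentTensor.norm_apply_le (A : CotangentTensor n V x) (X : TangentSpace (𝓡 n) x) :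
    ‖A.toCLM X‖ ≤ ‖A‖ * ‖X‖ := by
  set e := stdOrthonormalBasis ℝ (TangentSpace (𝓡 n) x)
  refine le_of_sq_le_sq ?_ (by positivity)
  have h1 : A.toCLM X = ∑ i, inner ℝ (e i) X • A.toCLM (e i) := by
    conv_lhs => rw [← e.sum_repr' X]
    rw [map_sum]
    exact Finset.sum_congr rfl fun i _ ↦ map_smul _ _ _
  have h2 : ‖A.toCLM X‖ ≤ ∑ i, |inner ℝ (e i) X| * ‖A.toCLM (e i)‖ := by
    rw [h1]
    refine (norm_sum_le _ _).trans (Finset.sum_le_sum fun i _ ↦ ?_)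
    rw [norm_smul, Real.norm_eq_abs]
  have h3 := Finset.sum_mul_sq_le_sq_mul_sq Finset.univ (fun i ↦ |inner ℝ (e i) X|)
    fun i ↦ ‖A.toCLM (e i)‖
  have h4 : ∑ i, |inner ℝ (e i) X| ^ 2 = ‖X‖ ^ 2 := by
    simp only [← Real.norm_eq_abs]
    exact e.sum_sq_norm_inner_right X
  rw [h4, ← A.norm_sq] at h3
  calc ‖A.toCLM X‖ ^ 2 ≤ (∑ i, |inner ℝ (e i) X| * ‖A.toCLM (e i)‖) ^ 2 := by gcongr
    _ ≤ _ := h3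
    _ = _ := by ring

/-- The Hilbert–Schmidt norm of `T*M ⊗ V` is at most `√n` times the operator norm. -/
lemma CotangentTensor.norm_le_of_forall_apply_le (A : CotangentTensor n V x) {C : ℝ} (hC : 0 ≤ C)
    (h : ∀ X, ‖A.toCLM X‖ ≤ C * ‖X‖) : ‖A‖ ≤ √n * C := by
  refine le_of_sq_le_sq ?_ (by positivity)
  rw [A.norm_sq, mul_pow, Real.sq_sqrt (by positivity)]
  calc ∑ i, ‖A.toCLM (stdOrthonormalBasis ℝ (TangentSpace (𝓡 n) x) i)‖ ^ 2
      ≤ ∑ i : Fin (Module.finrank ℝ (TangentSpace (𝓡 n) x)), C ^ 2 := by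
        refine Finset.sum_le_sum fun i _ ↦ ?_
        have := h (stdOrthonormalBasis ℝ (TangentSpace (𝓡 n) x) i)
        rw [(stdOrthonormalBasis ℝ (TangentSpace (𝓡 n) x)).norm_eq_one i, mul_one] at this
        gcongr
    _ = n * C ^ 2 := by
      have : Module.finrank ℝ (TangentSpace (𝓡 n) x) = n :=
        finrank_euclideanSpace_fin (𝕜 := ℝ) (n := n)
      simp [this]

lemma CotangentTensor.norm_smulRight (a : CotangentTensor n (Bundle.Trivial M ℝ) x) (v : V x) :
    ‖CotangentTensor.ofCLM (a.toCLM.smulRight v)‖ = ‖a‖ * ‖v‖ := by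
  rw [← sq_eq_sq₀ (norm_nonneg _) (by positivity), CotangentTensor.norm_sq, mul_pow,
    CotangentTensor.norm_sq, Finset.sum_mul]
  refine Finset.sum_congr rfl fun i _ ↦ ?_
  rw [← mul_pow, ← norm_smul]
  rfl

end CotangentNorm

section Smooth

lemma isMeasurableSection_of_continuous {M : Type*} [TopologicalSpace M]
    [SecondCountableTopology M] [MeasurableSpace M] [BorelSpace M] {μ : Measure M}
    {F : Type*} [NormedAddCommGroup F]
    {V : M → Type*} [TopologicalSpace (TotalSpace F V)] [∀ x, TopologicalSpace (V x)] [FiberBundle F V]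
    {s : Π x, V x} (hs : Continuous fun x ↦ TotalSpace.mk' F x (s x)) :
    IsMeasurableSection μ F s := by
  intro e _
  refine ContinuousOn.aestronglyMeasurable ?_ e.open_baseSet.measurableSet
  exact continuous_snd.comp_continuousOn (e.continuousOn.comp hs.continuousOn fun x hx ↦
    e.mem_source.2 hx)

variable {n : ℕ} {M : Type*} [TopologicalSpace M]
  [ChartedSpace (EuclideanSpace ℝ (Fin n)) M] [IsManifold (𝓡 n) ∞ M]
  {F : Type*} [NormedAddCommGroup F] [NormedSpace ℝ F]
  {V : M → Type*} [TopologicalSpace (TotalSpace F V)]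
  [∀ x, NormedAddCommGroup (V x)] [∀ x, InnerProductSpace ℝ (V x)] [FiberBundle F V]
  [VectorBundle ℝ F V]

lemma continuous_norm_of_continuous [IsContinuousRiemannianBundle F V] {s : Π x, V x}
    (hs : Continuous fun x ↦ TotalSpace.mk' F x (s x)) : Continuous fun x ↦ ‖s x‖ := by
  simp only [norm_eq_sqrt_real_inner]
  exact (hs.inner_bundle hs).sqrt

variable [RiemannianBundle (fun x : M ↦ TangentSpace (𝓡 n) x)]
  [IsContinuousRiemannianBundle (EuclideanSpace ℝ (Fin n)) (fun x : M ↦ TangentSpace (𝓡 n) x)]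
  [IsContinuousRiemannianBundle F V]

/-- Continuous sections of `T*M ⊗ V` are locally bounded. -/
lemma exists_eventually_norm_form_le {α : Π x : M, CotangentTensor n V x}
    (hα : Continuous fun x ↦ TotalSpace.mk' (E := fun x ↦ TangentSpace (𝓡 n) x →L[ℝ] V x)
      (EuclideanSpace ℝ (Fin n) →L[ℝ] F) x (α x).toCLM) (p : M) :
    ∃ C, ∀ᶠ x in 𝓝 p, ‖α x‖ ≤ C := by
  obtain ⟨C₁, hC₁, h1⟩ := eventually_norm_trivializationAt_lt (EuclideanSpace ℝ (Fin n))
    (fun x : M ↦ TangentSpace (𝓡 n) x) p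
  obtain ⟨C₂, hC₂, h2⟩ := eventually_norm_symmL_trivializationAt_lt F V p
  set e₁ := tangentTriv n p
  set e₂ := trivializationAt F V p
  let e := e₁.continuousLinearMap (RingHom.id ℝ) e₂
  have he : e.baseSet = e₁.baseSet ∩ e₂.baseSet := rfl
  have hpe : p ∈ e.baseSet := ⟨FiberBundle.mem_baseSet_trivializationAt' p,
    FiberBundle.mem_baseSet_trivializationAt' p⟩
  have hcont : ContinuousAt (fun x ↦ ‖(e ⟨x, (α x).toCLM⟩).2‖) p :=
    ((continuous_snd.comp_continuousOn (e.continuousOn.comp hα.continuousOn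
      (s := e.baseSet) fun x hx ↦ e.mem_source.2 hx)).continuousAt
      (e.open_baseSet.mem_nhds hpe)).norm
  have h3 : ∀ᶠ x in 𝓝 p, ‖(e ⟨x, (α x).toCLM⟩).2‖ < ‖(e ⟨p, (α p).toCLM⟩).2‖ + 1 :=
    hcont.eventually (gt_mem_nhds (lt_add_one _))
  set C₃ := ‖(e ⟨p, (α p).toCLM⟩).2‖ + 1
  have hC₃ : 0 < C₃ := by positivity
  refine ⟨√n * (C₂ * (C₃ * C₁)), ?_⟩
  filter_upwards [h1, h2, h3, e.open_baseSet.mem_nhds hpe] with x hx1 hx2 hx3 hx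
  refine (α x).norm_le_of_forall_apply_le (by positivity) fun X ↦ ?_
  have h4 : (α x).toCLM X = e₂.symmL ℝ x ((e ⟨x, (α x).toCLM⟩).2
      (e₁.continuousLinearMapAt ℝ x X)) := by
    change (α x).toCLM X = e₂.symmL ℝ x (e₂.continuousLinearMapAt ℝ x ((α x).toCLM
      (e₁.symmL ℝ x (e₁.continuousLinearMapAt ℝ x X))))
    rw [e₁.symmL_continuousLinearMapAt hx.1, e₂.symmL_continuousLinearMapAt hx.2]
  rw [h4]
  refine (ContinuousLinearMap.le_of_opNorm_le _ hx2.le _).trans ?_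
  rw [mul_assoc]
  gcongr
  refine (ContinuousLinearMap.le_of_opNorm_le _ hx3.le _).trans ?_
  rw [mul_assoc]
  gcongr
  exact ContinuousLinearMap.le_of_opNorm_le _ hx1.le _

end Smooth

/-! ### Graphs of the connection operators -/

section Operators
variable {𝕜 : Type*} [RCLike 𝕜] {n : ℕ} {M : Type*} [TopologicalSpace M]
  [ChartedSpace (EuclideanSpace ℝ (Fin n)) M] [IsManifold (𝓡 n) ∞ M]
  [SecondCountableTopology M] [MeasurableSpace M] [BorelSpace M]
  [RiemannianBundle (fun x : M ↦ TangentSpace (𝓡 n) x)]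
  [IsContMDiffRiemannianBundle (𝓡 n) ∞ (EuclideanSpace ℝ (Fin n))
    (fun x : M ↦ TangentSpace (𝓡 n) x)]
  {F : Type*} [NormedAddCommGroup F] [NormedSpace ℝ F] [NormedSpace 𝕜 F] [IsScalarTower ℝ 𝕜 F]
  [FiniteDimensional ℝ F]
  {V : M → Type*} [TopologicalSpace (TotalSpace F V)] [∀ x, NormedAddCommGroup (V x)]
  [∀ x, InnerProductSpace ℝ (V x)] [∀ x, InnerProductSpace 𝕜 (V x)]
  [∀ x, IsScalarTower ℝ 𝕜 (V x)]
  [FiberBundle F V] [VectorBundle ℝ F V] [VectorBundle 𝕜 F V]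
  [IsContMDiffRiemannianBundle (𝓡 n) ∞ F V]

/-- The covariant derivative `∇u` as a section of `T*M ⊗ V`. -/
def covForm (cov : CovariantDerivative (𝓡 n) F V) (u : Π x, V x) (x : M) : CotangentTensor n V x :=
  CotangentTensor.ofCLM (cov u x)

lemma mem_sections_of_smooth {u : Π x, V x} (hu : u ∈ smoothSections 𝕜 n F V) {μ : Measure M} :
    u ∈ (sectionField 𝕜 n μ F V).sections :=
  isMeasurableSection_of_continuous (ContMDiff.continuous hu)

variable (cov : CovariantDerivative (𝓡 n) F V)

/-- The volume measure has full support, so a class in `L²(V)` has at most one smooth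
representative. -/
lemma eq_of_mk_eq_mk [T2Space M] {u v : (sectionField 𝕜 n (riemannianVolume n M) F V).L2Section}
    (hu : (u : Π x, V x) ∈ smoothSections 𝕜 n F V) (hv : (v : Π x, V x) ∈ smoothSections 𝕜 n F V)
    (h : (SeparationQuotient.mk u : L2Sections 𝕜 n F V) = SeparationQuotient.mk v) : u = v := by
  have := isContinuousRiemannianBundle n F V
  have hc : Continuous fun x ↦ ‖(u - v) x‖ := continuous_norm_of_continuous (F := F)
    (ContMDiff.continuous (Submodule.sub_mem _ hu hv))
  have h0 : (fun x ↦ ‖(u - v) x‖) =ᵐ[riemannianVolume n M] fun _ ↦ 0 := by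
    filter_upwards [MeasurableField.mk_eq_mk_iff.1 h] with x hx
    simp [hx]
  have h1 := Continuous.ae_eq_iff_eq _ hc continuous_const |>.1 h0
  ext x
  simpa [sub_eq_zero] using congrFun h1 x

section Graph
variable [IsLinearConnection 𝕜 n cov]

/-- The graph of `∇` on smooth sections is the graph of an operator. -/
lemma eq_zero_of_mem_connectionGraph [T2Space M] {D : Submodule 𝕜 (Π x, V x)}
    {p : L2Sections 𝕜 n F V × L2Forms 𝕜 n F V} (hp : p ∈ connectionGraph 𝕜 n cov D)
    (h0 : p.1 = 0) : p.2 = 0 := by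
  obtain ⟨u, α, hu, -, hα, rfl⟩ := hp
  have hu0 : u = 0 := eq_of_mk_eq_mk hu (Submodule.zero_mem _) h0
  have hα0 : α = 0 := by
    ext x
    change (α x).toCLM = 0
    rw [hα x, hu0]
    exact congrFun cov.zero x
  change SeparationQuotient.mk α = _
  rw [hα0]
  rfl

lemma nablaC_graph [T2Space M] : (nablaC 𝕜 n cov).graph =
    connectionGraph 𝕜 n cov (compactlySupportedSections 𝕜 V) :=
  Submodule.toLinearPMap_graph_eq _ fun _ hp h0 ↦ eq_zero_of_mem_connectionGraph cov hp h0

lemma nabla2_graph [T2Space M] : (nabla2 𝕜 n cov).graph = connectionGraph 𝕜 n cov ⊤ :=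
  Submodule.toLinearPMap_graph_eq _ fun _ hp h0 ↦ eq_zero_of_mem_connectionGraph cov hp h0

end Graph

variable [ContMDiffVectorBundle ∞ F V (𝓡 n)] [cov.ContMDiffCovariantDerivative ∞]

lemma contMDiff_cov {u : Π x, V x} (hu : u ∈ smoothSections 𝕜 n F V) :
    ContMDiff (𝓡 n) ((𝓡 n).prod 𝓘(ℝ, EuclideanSpace ℝ (Fin n) →L[ℝ] F)) ∞
      fun x ↦ TotalSpace.mk' (E := fun x ↦ TangentSpace (𝓡 n) x →L[ℝ] V x)
        (EuclideanSpace ℝ (Fin n) →L[ℝ] F) x (cov u x) := by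
  have h := ‹cov.ContMDiffCovariantDerivative ∞›.contMDiff.contMDiff (σ := u)
    (ContMDiff.contMDiffOn hu)
  exact contMDiffOn_univ.1 h

lemma covForm_mem_sections {u : Π x, V x} (hu : u ∈ smoothSections 𝕜 n F V) {μ : Measure M} :
    covForm cov u ∈ (formField 𝕜 n μ F V).sections :=
  isMeasurableSection_of_continuous (contMDiff_cov cov hu).continuous

variable (𝕜) in
lemma cov_eq_zero {u : Π x, V x} (hu : u ∈ smoothSections 𝕜 n F V) {x : M}
    (hx : x ∉ closure {x | u x ≠ 0}) : cov u x = 0 := by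
  have h1 : ∀ᶠ y in 𝓝 x, u y = (0 : Π x, V x) y := by
    filter_upwards [isClosed_closure.isOpen_compl.mem_nhds hx] with y hy
    by_contra h
    exact hy (subset_closure h)
  rw [cov.isCovariantDerivativeOnUniv.congr_of_eventuallyEq ((ContMDiff.mdifferentiable hu
    (by simp)) x) (mdifferentiableAt_zeroSection ..) univ_mem h1]
  exact congrFun cov.zero x

lemma mem_squareIntegrable_of_hasCompactSupport [T2Space M] {u : Π x, V x}
    (hu : u ∈ smoothSections 𝕜 n F V) (hc : u ∈ compactlySupportedSections 𝕜 V) :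
    u ∈ (sectionField 𝕜 n (riemannianVolume n M) F V).squareIntegrable := by
  have := isContinuousRiemannianBundle n F V
  refine MeasurableField.mem_squareIntegrable_of_isCompact (mem_sections_of_smooth hu) hc
    (fun x hx ↦ ?_) fun p _ ↦ ⟨‖u p‖ + 1, ?_⟩
  · by_contra h
    exact hx (subset_closure h)
  · have hcont := continuous_norm_of_continuous (F := F) (ContMDiff.continuous hu)
    filter_upwards [hcont.continuousAt.eventually (gt_mem_nhds (lt_add_one ‖u p‖))] with x hx
      using le_of_lt hx

lemma covForm_mem_squareIntegrable_of_hasCompactSupport [T2Space M] {u : Π x, V x}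
    (hu : u ∈ smoothSections 𝕜 n F V) (hc : u ∈ compactlySupportedSections 𝕜 V) :
    covForm cov u ∈ (formField 𝕜 n (riemannianVolume n M) F V).squareIntegrable := by
  have := isContinuousRiemannianBundle n F V
  have := isContinuousRiemannianBundle n (EuclideanSpace ℝ (Fin n))
    (fun x : M ↦ TangentSpace (𝓡 n) x)
  exact MeasurableField.mem_squareIntegrable_of_isCompact (covForm_mem_sections cov hu) hc
    (fun x hx ↦ cov_eq_zero 𝕜 cov hu hx) fun p _ ↦ exists_eventually_norm_form_le
      (contMDiff_cov cov hu).continuous p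

end Operators

/-! ### Density of the compactly supported sections -/

section Operators
variable {𝕜 : Type*} [RCLike 𝕜] {n : ℕ} {M : Type*} [TopologicalSpace M]
  [ChartedSpace (EuclideanSpace ℝ (Fin n)) M] [IsManifold (𝓡 n) ∞ M]
  [SecondCountableTopology M] [MeasurableSpace M] [BorelSpace M]
  [RiemannianBundle (fun x : M ↦ TangentSpace (𝓡 n) x)]
  [IsContMDiffRiemannianBundle (𝓡 n) ∞ (EuclideanSpace ℝ (Fin n))
    (fun x : M ↦ TangentSpace (𝓡 n) x)]
  {F : Type*} [NormedAddCommGroup F] [NormedSpace ℝ F] [NormedSpace 𝕜 F] [IsScalarTower ℝ 𝕜 F]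
  [FiniteDimensional ℝ F]
  {V : M → Type*} [TopologicalSpace (TotalSpace F V)] [∀ x, NormedAddCommGroup (V x)]
  [∀ x, InnerProductSpace ℝ (V x)] [∀ x, InnerProductSpace 𝕜 (V x)]
  [∀ x, IsScalarTower ℝ 𝕜 (V x)]
  [FiberBundle F V] [VectorBundle ℝ F V] [VectorBundle 𝕜 F V]
  [IsContMDiffRiemannianBundle (𝓡 n) ∞ F V] [T2Space M] [ContMDiffVectorBundle ∞ F V (𝓡 n)]

variable (𝕜) in
lemma smul_mem_smoothSections {f : M → ℝ} (hf : ContMDiff (𝓡 n) 𝓘(ℝ) ∞ f) {u : Π x, V x}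
    (hu : u ∈ smoothSections 𝕜 n F V) : (fun x ↦ f x • u x) ∈ smoothSections 𝕜 n F V :=
  ContMDiff.smul_section hf hu

variable (𝕜) in
lemma smul_mem_compactlySupportedSections {f : M → ℝ} (hf : HasCompactSupport f) (u : Π x, V x) :
    (fun x ↦ f x • u x) ∈ compactlySupportedSections 𝕜 V :=
  hf.isCompact.of_isClosed_subset isClosed_closure <| closure_mono fun x hx h ↦ hx (by simp [h])

lemma integrable_real_inner (s t : (sectionField 𝕜 n (riemannianVolume n M) F V).L2Section) :
    Integrable (fun x ↦ inner ℝ (s x) (t x)) (riemannianVolume n M) := by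
  simp only [real_inner_eq_re_inner' 𝕜]
  exact (MeasurableField.integrable_inner _ s t).re

/-- A square integrable section is determined by its integrals against the smooth compactly
supported sections. -/
theorem ae_eq_zero_of_forall_integral_inner_eq_zero
    {s : (sectionField 𝕜 n (riemannianVolume n M) F V).L2Section}
    (h : ∀ τ ∈ smoothSections 𝕜 n F V, τ ∈ compactlySupportedSections 𝕜 V →
      ∫ x, inner ℝ (τ x) (s x) ∂(riemannianVolume n M) = 0) :
    ∀ᵐ x ∂(riemannianVolume n M), s x = 0 := by
  have : LocallyCompactSpace M := ChartedSpace.locallyCompactSpace (EuclideanSpace ℝ (Fin n)) M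
  refine measure_null_of_locally_null _ fun p _ ↦ ?_
  set e := trivializationAt F V p
  have hpe : p ∈ e.baseSet := FiberBundle.mem_baseSet_trivializationAt' p
  obtain ⟨ψ, -, hψ⟩ := (SmoothBumpFunction.nhds_basis_tsupport (I := 𝓡 n) p).mem_iff.1
    (e.open_baseSet.mem_nhds hpe)
  -- smooth sections with compact support that are a frame near `p`
  let T (w : F) : Π x, V x := (ψ : M → ℝ) • fun x ↦ e.symmL ℝ x w
  have hTs (w : F) : T w ∈ smoothSections 𝕜 n F V :=
    ContMDiffOn.smul_section_of_tsupport ψ.contMDiff.contMDiffOn e.open_baseSet hψ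
      (contMDiffOn_symmL e w)
  have hTc (w : F) : T w ∈ compactlySupportedSections 𝕜 V :=
    smul_mem_compactlySupportedSections 𝕜 ψ.hasCompactSupport _
  have hTae (w : F) : ∀ᵐ x ∂(riemannianVolume n M), inner ℝ (T w x) (s x) = 0 := by
    refine ae_eq_zero_of_integral_contMDiff_smul_eq_zero (𝓡 n) (Integrable.locallyIntegrable
      (integrable_real_inner (MeasurableField.ofMem _ _
        (mem_squareIntegrable_of_hasCompactSupport (hTs w) (hTc w))) s)) fun g hg hgc ↦ ?_
    rw [← h _ (smul_mem_smoothSections 𝕜 hg (hTs w))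
      (smul_mem_compactlySupportedSections 𝕜 hgc _)]
    refine integral_congr_ae (ae_of_all _ fun x ↦ ?_)
    simp [real_inner_smul_left]
  let b := Module.finBasis ℝ F
  have hae : ∀ᵐ x ∂(riemannianVolume n M), ∀ k, inner ℝ (T (b k) x) (s x) = 0 :=
    ae_all_iff.2 fun k ↦ hTae (b k)
  refine ⟨_, inter_mem self_mem_nhdsWithin (mem_nhdsWithin_of_mem_nhds (inter_mem
    (e.open_baseSet.mem_nhds hpe) ψ.eventuallyEq_one)),
    measure_mono_null (fun x hx ↦ ?_) (ae_iff.1 hae)⟩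
  intro hxT
  obtain ⟨hsx, hxe, hx1⟩ := hx
  have hx1' : ψ x = 1 := hx1
  have hT (k) : inner ℝ (e.symmL ℝ x (b k)) (s x) = 0 := by
    simpa [T, hx1'] using hxT k
  refine hsx ?_
  have h1 : s x = ∑ k, b.repr (e.continuousLinearMapAt ℝ x (s x)) k • e.symmL ℝ x (b k) := by
    conv_lhs => rw [← e.symmL_continuousLinearMapAt (R := ℝ) hxe (s x),
      ← b.sum_repr (e.continuousLinearMapAt ℝ x (s x)), map_sum]
    exact Finset.sum_congr rfl fun k _ ↦ map_smul _ _ _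
  change s x = 0
  rw [← inner_self_eq_zero (𝕜 := ℝ)]
  nth_rewrite 1 [h1]
  simp [sum_inner, real_inner_smul_left, hT]

variable (cov : CovariantDerivative (𝓡 n) F V) [cov.ContMDiffCovariantDerivative ∞]
  [IsLinearConnection 𝕜 n cov]

lemma mem_connectionGraph {D : Submodule 𝕜 (Π x, V x)} {u : Π x, V x}
    (hu : u ∈ smoothSections 𝕜 n F V) (huD : u ∈ D)
    (h1 : u ∈ (sectionField 𝕜 n (riemannianVolume n M) F V).squareIntegrable)
    (h2 : covForm cov u ∈ (formField 𝕜 n (riemannianVolume n M) F V).squareIntegrable) :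
    ((SeparationQuotient.mk (MeasurableField.ofMem _ u h1),
      SeparationQuotient.mk (MeasurableField.ofMem _ _ h2)) :
      L2Sections 𝕜 n F V × L2Forms 𝕜 n F V) ∈ connectionGraph 𝕜 n cov D :=
  ⟨MeasurableField.ofMem _ u h1, MeasurableField.ofMem _ _ h2, hu, huD, fun _ ↦ rfl, rfl⟩

/-- Smooth compactly supported sections are dense in `L²(V)`. -/
theorem dense_domain_nablaC : Dense ((nablaC 𝕜 n cov).domain : Set (L2Sections 𝕜 n F V)) := by
  rw [Submodule.dense_iff_topologicalClosure_eq_top, Submodule.topologicalClosure_eq_top_iff,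
    Submodule.eq_bot_iff]
  intro y hy
  obtain ⟨s, rfl⟩ := SeparationQuotient.surjective_mk y
  change SeparationQuotient.mk s = SeparationQuotient.mk 0
  rw [MeasurableField.mk_eq_mk_iff]
  refine ae_eq_zero_of_forall_integral_inner_eq_zero fun τ hτ hτc ↦ ?_
  have h1 := mem_squareIntegrable_of_hasCompactSupport hτ hτc
  have hmem : SeparationQuotient.mk (MeasurableField.ofMem _ τ h1) ∈ (nablaC 𝕜 n cov).domain :=
    ⟨_, mem_connectionGraph cov hτ hτc h1
      (covForm_mem_squareIntegrable_of_hasCompactSupport cov hτ hτc), rfl⟩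
  have h2 := hy _ hmem
  rw [SeparationQuotient.inner_mk_mk, MeasurableField.inner_def] at h2
  simp only [real_inner_eq_re_inner' 𝕜]
  have h3 := integral_re (MeasurableField.integrable_inner _ (MeasurableField.ofMem _ τ h1) s)
  rw [h2, map_zero] at h3
  exact h3

end Operators

/-! ### Closability of the connection -/

section Operators
variable {𝕜 : Type*} [RCLike 𝕜] {n : ℕ} {M : Type*} [TopologicalSpace M]
  [ChartedSpace (EuclideanSpace ℝ (Fin n)) M] [IsManifold (𝓡 n) ∞ M]
  [SecondCountableTopology M] [MeasurableSpace M] [BorelSpace M]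
  [RiemannianBundle (fun x : M ↦ TangentSpace (𝓡 n) x)]
  [IsContMDiffRiemannianBundle (𝓡 n) ∞ (EuclideanSpace ℝ (Fin n))
    (fun x : M ↦ TangentSpace (𝓡 n) x)]
  {F : Type*} [NormedAddCommGroup F] [NormedSpace ℝ F] [NormedSpace 𝕜 F] [IsScalarTower ℝ 𝕜 F]
  [FiniteDimensional ℝ F]
  {V : M → Type*} [TopologicalSpace (TotalSpace F V)] [∀ x, NormedAddCommGroup (V x)]
  [∀ x, InnerProductSpace ℝ (V x)] [∀ x, InnerProductSpace 𝕜 (V x)]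
  [∀ x, IsScalarTower ℝ 𝕜 (V x)]
  [FiberBundle F V] [VectorBundle ℝ F V] [VectorBundle 𝕜 F V]
  [IsContMDiffRiemannianBundle (𝓡 n) ∞ F V] [T2Space M] [ContMDiffVectorBundle ∞ F V (𝓡 n)]

variable (cov : CovariantDerivative (𝓡 n) F V) [cov.ContMDiffCovariantDerivative ∞]
  [IsLinearConnection 𝕜 n cov]

local notation "μ" => riemannianVolume n M

lemma abs_integral_real_inner_le (s t : (sectionField 𝕜 n μ F V).L2Section) :
    |∫ x, inner ℝ (s x) (t x) ∂μ| ≤ ‖s‖ * ‖t‖ := by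
  simp only [real_inner_eq_re_inner' 𝕜]
  rw [show ∫ x, RCLike.re (inner 𝕜 (s x) (t x)) ∂μ = RCLike.re (inner 𝕜 s t) from
    integral_re (MeasurableField.integrable_inner _ s t)]
  exact (RCLike.abs_re_le_norm _).trans (norm_inner_le_norm _ _)

lemma smul_mem_sections {f : M → ℝ} (hf : AEStronglyMeasurable f μ) {s : Π x, V x}
    (hs : s ∈ (sectionField 𝕜 n μ F V).sections) :
    (fun x ↦ f x • s x) ∈ (sectionField 𝕜 n μ F V).sections := fun e _ ↦ by
  refine (hf.restrict.smul (hs e)).congr ?_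
  filter_upwards [ae_restrict_mem e.open_baseSet.measurableSet] with x hx
  exact ((e.linear ℝ hx).map_smul (f x) (s x)).symm

/-- The contraction of a measurable form with a coordinate vector field is measurable. (Outside the
chart, `symmL` is zero.) -/
lemma contract_mem_sections {β : Π x : M, CotangentTensor n V x}
    (hβ : β ∈ (formField 𝕜 n μ F V).sections) (p : M) (v : EuclideanSpace ℝ (Fin n)) :
    (fun x ↦ (β x).toCLM ((tangentTriv n p).symmL ℝ x v)) ∈ (sectionField 𝕜 n μ F V).sections := by
  intro e _
  have hU := (tangentTriv n p).open_baseSet.measurableSet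
  have h1 := (ContinuousLinearMap.apply ℝ F v).continuous.comp_aestronglyMeasurable
    ((isMeasurableForm_iff β).1 hβ (tangentTriv n p) e)
  rw [← Measure.restrict_restrict hU, ← aestronglyMeasurable_indicator_iff hU] at h1
  refine h1.congr ?_
  filter_upwards [ae_restrict_mem e.open_baseSet.measurableSet] with x hx
  by_cases hxU : x ∈ (tangentTriv n p).baseSet
  · rw [indicator_of_mem hxU]
    exact congrFun (e.coe_linearMapAt_of_mem (R := ℝ) hx) _
  · rw [indicator_of_notMem hxU]
    have : (tangentTriv n p).symmL ℝ x v = 0 := (tangentTriv n p).symmL_apply_of_notMem hxU v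
    rw [this, map_zero]
    exact ((e.linear ℝ hx).map_zero).symm

/-- A smooth cutoff function supported in the chart at `p`. -/
lemma exists_bump (p : M) : ∃ ψ : M → ℝ, ContMDiff (𝓡 n) 𝓘(ℝ) ∞ ψ ∧ HasCompactSupport ψ ∧
    tsupport ψ ⊆ (extChartAt (𝓡 n) p).source ∧ ∀ᶠ x in 𝓝 p, ψ x = 1 := by
  obtain ⟨ψ, -, hψ⟩ := (SmoothBumpFunction.nhds_basis_tsupport (I := 𝓡 n) p).mem_iff.1
    (extChartAt_source_mem_nhds (I := 𝓡 n) p)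
  exact ⟨ψ, ψ.contMDiff, ψ.hasCompactSupport, hψ, ψ.eventuallyEq_one⟩

lemma continuousOn_norm_symmL (p : M) (v : EuclideanSpace ℝ (Fin n)) :
    ContinuousOn (fun x ↦ ‖(tangentTriv n p).symmL ℝ x v‖) (extChartAt (𝓡 n) p).source := by
  have := isContinuousRiemannianBundle n (EuclideanSpace ℝ (Fin n))
    (fun x : M ↦ TangentSpace (𝓡 n) x)
  have h := (contMDiffOn_symmL (n := n) (tangentTriv n p) v).continuousOn
  simp only [norm_eq_sqrt_real_inner]
  exact (h.inner_bundle h).sqrt.mono fun x hx ↦ mem_baseSet_tangentTriv.2 hx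

lemma exists_contract_le {ψ : M → ℝ} (hψ : Continuous ψ) (hψc : HasCompactSupport ψ) {p : M}
    (hψs : tsupport ψ ⊆ (extChartAt (𝓡 n) p).source) (v : EuclideanSpace ℝ (Fin n)) :
    ∃ C, 0 ≤ C ∧ ∀ (x : M) (A : CotangentTensor n V x),
      ‖ψ x • A.toCLM ((tangentTriv n p).symmL ℝ x v)‖ ≤ C * ‖A‖ := by
  obtain ⟨C, hC⟩ := hψc.isCompact.exists_bound_of_continuousOn
    (hψ.continuousOn.mul ((continuousOn_norm_symmL p v).mono hψs))
  refine ⟨|C|, abs_nonneg _, fun x A ↦ ?_⟩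
  by_cases hx : x ∈ tsupport ψ
  · rw [norm_smul]
    have h1 := (hC x hx).trans (le_abs_self C)
    rw [Pi.mul_apply, norm_mul, norm_norm] at h1
    calc ‖ψ x‖ * ‖A.toCLM ((tangentTriv n p).symmL ℝ x v)‖
        ≤ ‖ψ x‖ * (‖A‖ * ‖(tangentTriv n p).symmL ℝ x v‖) := by
          gcongr
          exact A.norm_apply_le _
      _ = (‖ψ x‖ * ‖(tangentTriv n p).symmL ℝ x v‖) * ‖A‖ := by ring
      _ ≤ _ := by gcongr
  · rw [image_eq_zero_of_notMem_tsupport hx, zero_smul, norm_zero]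
    positivity

/-- A square integrable form, cut off and contracted with a coordinate vector field. -/
lemma contract_mem_squareIntegrable {ψ : M → ℝ} (hψ : Continuous ψ) (hψc : HasCompactSupport ψ)
    {p : M} (hψs : tsupport ψ ⊆ (extChartAt (𝓡 n) p).source) (v : EuclideanSpace ℝ (Fin n))
    (β : (formField 𝕜 n μ F V).L2Section) :
    (fun x ↦ ψ x • (β x).toCLM ((tangentTriv n p).symmL ℝ x v)) ∈
      (sectionField 𝕜 n μ F V).squareIntegrable := by
  obtain ⟨C, hC0, hC⟩ := exists_contract_le (V := V) hψ hψc hψs v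
  refine MeasurableField.mem_squareIntegrable_of_le
    (smul_mem_sections hψ.aestronglyMeasurable (contract_mem_sections β.mem.1 p v))
    (β.mem.2.const_mul (C ^ 2)) (ae_of_all _ fun x ↦ ?_)
  rw [← mul_pow]
  have := hC x (β x)
  gcongr

/-- Weak formulation of `∇u`: integration by parts against `τ` along a coordinate vector field. -/
lemma exists_integral_inner_contract_eq (hcov : cov.IsMetricCompatible) {ψ : M → ℝ}
    (hψ : ContMDiff (𝓡 n) 𝓘(ℝ) ∞ ψ) (hψc : HasCompactSupport ψ)
    {p : M} (hψs : tsupport ψ ⊆ (extChartAt (𝓡 n) p).source) (v : EuclideanSpace ℝ (Fin n))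
    {τ : Π x, V x} (hτ : τ ∈ smoothSections 𝕜 n F V) (hτc : τ ∈ compactlySupportedSections 𝕜 V) :
    ∃ η : (sectionField 𝕜 n μ F V).L2Section, ∀ (u : (sectionField 𝕜 n μ F V).L2Section)
      (α : (formField 𝕜 n μ F V).L2Section), (u : Π x, V x) ∈ smoothSections 𝕜 n F V →
      (∀ x, (α x).toCLM = cov u x) →
      ∫ x, inner ℝ (τ x) (ψ x • (α x).toCLM ((tangentTriv n p).symmL ℝ x v)) ∂μ =
        ∫ x, inner ℝ (η x) (u x) ∂μ := by
  have := isContinuousRiemannianBundle n F V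
  have := isContinuousRiemannianBundle n (EuclideanSpace ℝ (Fin n))
    (fun x : M ↦ TangentSpace (𝓡 n) x)
  obtain ⟨κ, hκ, hibp⟩ := exists_integral_mvfderiv_eq (n := n) p v
  have hs := isOpen_extChartAt_source (I := 𝓡 n) p
  let X (x : M) : TangentSpace (𝓡 n) x := (tangentTriv n p).symmL ℝ x v
  let σ : Π x, V x := fun x ↦ ψ x • τ x
  have hσ : σ ∈ smoothSections 𝕜 n F V := smul_mem_smoothSections 𝕜 hψ hτ
  have hσc : σ ∈ compactlySupportedSections 𝕜 V := smul_mem_compactlySupportedSections 𝕜 hψc τ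
  have hσs : closure {x | σ x ≠ 0} ⊆ tsupport ψ :=
    closure_mono fun x hx h ↦ hx (by simp [σ, h])
  -- the two parts of the formal adjoint of `ψ ∇_X`, applied to `τ`
  have hκψ : Continuous fun x ↦ κ x * ψ x := by
    refine ContinuousOn.continuous_of_tsupport_subset (hκ.mul hψ.continuous.continuousOn) hs ?_
    exact (tsupport_mul_subset_right (f := κ) (g := ψ)).trans hψs
  have hτ2 := mem_squareIntegrable_of_hasCompactSupport hτ hτc
  have h1 : (fun x ↦ (κ x * ψ x) • τ x) ∈ (sectionField 𝕜 n μ F V).squareIntegrable := by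
    obtain ⟨C, hC⟩ := (hψc.isCompact).exists_bound_of_continuousOn hκψ.continuousOn
    refine MeasurableField.mem_squareIntegrable_of_le
      (smul_mem_sections hκψ.aestronglyMeasurable hτ2.1) (hτ2.2.const_mul (C ^ 2))
      (ae_of_all _ fun x ↦ ?_)
    rw [norm_smul, mul_pow]
    by_cases hx : x ∈ tsupport ψ
    · have := hC x hx
      gcongr
    · rw [image_eq_zero_of_notMem_tsupport hx, mul_zero, norm_zero, zero_pow two_ne_zero, zero_mul]
      positivity
  have h2 : (fun x ↦ (covForm cov σ x).toCLM (X x)) ∈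
      (sectionField 𝕜 n μ F V).squareIntegrable := by
    refine MeasurableField.mem_squareIntegrable_of_isCompact
      (contract_mem_sections (covForm_mem_sections cov hσ) p v) hψc.isCompact (fun x hx ↦ ?_)
      fun q hq ↦ ?_
    · change cov σ x (X x) = 0
      rw [cov_eq_zero 𝕜 cov hσ fun h ↦ hx (hσs h)]
      rfl
    · obtain ⟨C, hC⟩ := exists_eventually_norm_form_le (contMDiff_cov cov hσ).continuous q
      have hX := ((continuousOn_norm_symmL p v).continuousAt (hs.mem_nhds (hψs hq))).eventually
        (gt_mem_nhds (lt_add_one _))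
      refine ⟨C * (‖X q‖ + 1), ?_⟩
      filter_upwards [hC, hX] with x hx hxX
      refine ((covForm cov σ x).norm_apply_le (X x)).trans ?_
      have : 0 ≤ C := (norm_nonneg _).trans hx
      exact mul_le_mul hx hxX.le (norm_nonneg _) this
  refine ⟨- MeasurableField.ofMem _ _ h1 - MeasurableField.ofMem _ _ h2, fun u α hu hα ↦ ?_⟩
  have hf := (ContMDiff.inner_bundle (IB := 𝓡 n) (F := F) (n := ∞) (v := σ) (w := u) hσ hu)
  have hfσ : tsupport (fun x ↦ inner ℝ (σ x) (u x)) ⊆ tsupport ψ :=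
    closure_mono fun x hx h ↦ hx (by simp [σ, h])
  have hfc : HasCompactSupport (fun x ↦ inner ℝ (σ x) (u x)) :=
    hψc.isCompact.of_isClosed_subset (isClosed_tsupport _) hfσ
  have h3 := hibp _ hf hfc (hfσ.trans hψs)
  have h4 (x : M) : mvfderiv (𝓡 n) (fun x ↦ inner ℝ (σ x) (u x)) x (X x) =
      inner ℝ (MeasurableField.ofMem _ _ h2 x) (u x) +
        inner ℝ (τ x) (ψ x • (α x).toCLM (X x)) := by
    rw [hα, hcov.mvfderiv_inner_eq X (ContMDiff.mdifferentiable hσ (by simp) x)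
      (ContMDiff.mdifferentiable hu (by simp) x)]
    simp only [σ, real_inner_smul_left, real_inner_smul_right]
    rfl
  have hS := contract_mem_squareIntegrable hψ.continuous hψc hψs v α
  have i1 := integrable_real_inner (MeasurableField.ofMem _ _ h1) u
  have i2 := integrable_real_inner (MeasurableField.ofMem _ _ h2) u
  have i3 := integrable_real_inner (MeasurableField.ofMem _ _ hτ2) (MeasurableField.ofMem _ _ hS)
  have h5 : ∫ x, mvfderiv (𝓡 n) (fun x ↦ inner ℝ (σ x) (u x)) x (X x) ∂μ =
      ∫ x, inner ℝ (MeasurableField.ofMem _ _ h2 x) (u x) ∂μ +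
        ∫ x, inner ℝ (τ x) (ψ x • (α x).toCLM (X x)) ∂μ := by
    simp_rw [h4]
    exact integral_add i2 i3
  have h6 : ∫ x, κ x * inner ℝ (σ x) (u x) ∂μ =
      ∫ x, inner ℝ (MeasurableField.ofMem _ _ h1 x) (u x) ∂μ := by
    refine integral_congr_ae (ae_of_all _ fun x ↦ ?_)
    simp only [σ, real_inner_smul_left, MeasurableField.ofMem_apply]
    ring
  have h7 : ∫ x, inner ℝ ((- MeasurableField.ofMem _ _ h1 - MeasurableField.ofMem _ _ h2 :
      (sectionField 𝕜 n μ F V).L2Section) x) (u x) ∂μ =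
      - ∫ x, inner ℝ (MeasurableField.ofMem _ _ h1 x) (u x) ∂μ -
        ∫ x, inner ℝ (MeasurableField.ofMem _ _ h2 x) (u x) ∂μ := by
    have := integral_sub i1.neg i2
    simp only [Pi.neg_apply] at this
    rw [← integral_neg, ← this]
    refine integral_congr_ae (ae_of_all _ fun x ↦ ?_)
    simp only [MeasurableField.sub_apply, inner_sub_left]
    congr 1
    exact inner_neg_left _ _
  rw [h7]
  rw [h5, h6] at h3
  linarith

/-- The connection `∇_2` is closable: if `u_j → 0` and `∇u_j → b`, then in the weak formulation of
`∇u_j` the limit gives `b(∂_v) = 0` for all coordinate vector fields. -/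
theorem isClosable_nabla2 (hcov : cov.IsMetricCompatible) : (nabla2 𝕜 n cov).IsClosable := by
  refine ⟨((nabla2 𝕜 n cov).graph.topologicalClosure).toLinearPMap,
    (Submodule.toLinearPMap_graph_eq _ ?_).symm⟩
  rintro ⟨y, z⟩ hyz (rfl : y = 0)
  obtain ⟨b, rfl⟩ := SeparationQuotient.surjective_mk z
  change SeparationQuotient.mk b = SeparationQuotient.mk 0
  rw [MeasurableField.mk_eq_mk_iff]
  -- cut off contractions of `b` vanish
  have hzero {ψ : M → ℝ} (hψ : ContMDiff (𝓡 n) 𝓘(ℝ) ∞ ψ) (hψc : HasCompactSupport ψ)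
      {p : M} (hψs : tsupport ψ ⊆ (extChartAt (𝓡 n) p).source) (v : EuclideanSpace ℝ (Fin n)) :
      ∀ᵐ x ∂μ, ψ x • (b x).toCLM ((tangentTriv n p).symmL ℝ x v) = 0 := by
    have hS (β : (formField 𝕜 n μ F V).L2Section) :=
      contract_mem_squareIntegrable hψ.continuous hψc hψs v β
    obtain ⟨C, hC0, hC⟩ := exists_contract_le (V := V) hψ.continuous hψc hψs v
    refine ae_eq_zero_of_forall_integral_inner_eq_zero (s := MeasurableField.ofMem _ _ (hS b))
      fun τ hτ hτc ↦ ?_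
    obtain ⟨η, hη⟩ := exists_integral_inner_contract_eq cov hcov hψ hψc hψs v hτ hτc
    let t : (sectionField 𝕜 n μ F V).L2Section := MeasurableField.ofMem _ τ
      (mem_squareIntegrable_of_hasCompactSupport hτ hτc)
    rw [← abs_nonpos_iff]
    refine le_of_forall_pos_le_add fun ε hε ↦ ?_
    obtain ⟨δ, hδ, hδε⟩ : ∃ δ > 0, δ * (‖t‖ * C + ‖η‖) ≤ ε := by
      refine ⟨ε / (‖t‖ * C + ‖η‖ + 1), by positivity, ?_⟩
      rw [div_mul_eq_mul_div, div_le_iff₀ (by positivity)]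
      exact mul_le_mul_of_nonneg_left (by linarith) hε.le
    obtain ⟨q, hq, hqδ⟩ := Metric.mem_closure_iff.1 hyz δ hδ
    rw [SetLike.mem_coe, nabla2_graph] at hq
    obtain ⟨u, α, hu, -, hα, rfl⟩ := hq
    rw [Prod.dist_eq, max_lt_iff] at hqδ
    have hu1 : ‖u‖ < δ := by
      have := hqδ.1
      rwa [dist_comm, dist_zero_right, SeparationQuotient.norm_mk] at this
    have hα1 : ‖b - α‖ < δ := by
      have := hqδ.2
      rwa [SeparationQuotient.dist_mk, dist_eq_norm] at this
    have h1 : ‖MeasurableField.ofMem _ _ (hS (b - α))‖ ≤ C * ‖b - α‖ := by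
      refine le_of_sq_le_sq ?_ (by positivity)
      rw [mul_pow, (formField 𝕜 n μ F V).norm_sq, ← integral_const_mul]
      refine MeasurableField.norm_sq_le_of_ae_le ((b - α).mem.2.const_mul _)
        (ae_of_all _ fun x ↦ ?_)
      rw [← mul_pow]
      exact pow_le_pow_left₀ (norm_nonneg _) (hC x ((b - α) x)) 2
    have h2 : ∫ x, inner ℝ (τ x) (ψ x • (b x).toCLM ((tangentTriv n p).symmL ℝ x v)) ∂μ =
        ∫ x, inner ℝ (t x) (MeasurableField.ofMem _ _ (hS (b - α)) x) ∂μ +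
          ∫ x, inner ℝ (η x) (u x) ∂μ := by
      rw [← hη u α hu hα]
      have := integral_add (integrable_real_inner t (MeasurableField.ofMem _ _ (hS (b - α))))
        (integrable_real_inner t (MeasurableField.ofMem _ _ (hS α)))
      refine Eq.trans ?_ this
      refine integral_congr_ae (ae_of_all _ fun x ↦ ?_)
      simp only [MeasurableField.ofMem_apply]
      rw [← inner_add_right, ← smul_add]
      congr 2
      change _ = ((b x).toCLM - (α x).toCLM) _ + _
      simp
    change |∫ x, inner ℝ (τ x) (ψ x • (b x).toCLM ((tangentTriv n p).symmL ℝ x v)) ∂μ| ≤ _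
    rw [h2, zero_add]
    calc _ ≤ ‖t‖ * (C * ‖b - α‖) + ‖η‖ * ‖u‖ := by
          refine (abs_add_le _ _).trans (add_le_add ((abs_integral_real_inner_le _ _).trans ?_)
            (abs_integral_real_inner_le _ _))
          gcongr
      _ ≤ ‖t‖ * (C * δ) + ‖η‖ * δ := by gcongr
      _ = δ * (‖t‖ * C + ‖η‖) := by ring
      _ ≤ ε := hδε
  refine measure_null_of_locally_null _ fun p _ ↦ ?_
  obtain ⟨ψ, hψ, hψc, hψs, hψ1⟩ := exists_bump (n := n) p
  have hae : ∀ᵐ x ∂μ, ∀ i : Fin n, ψ x • (b x).toCLM ((tangentTriv n p).symmL ℝ x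
      (EuclideanSpace.single i (1 : ℝ))) = 0 := ae_all_iff.2 fun i ↦ hzero hψ hψc hψs _
  refine ⟨_, inter_mem self_mem_nhdsWithin (mem_nhdsWithin_of_mem_nhds (inter_mem
    (extChartAt_source_mem_nhds (I := 𝓡 n) p) hψ1)),
    measure_mono_null (fun x hx ↦ ?_) (ae_iff.1 hae)⟩
  intro hxT
  obtain ⟨hbx, hxs, hx1⟩ := hx
  have hx1' : ψ x = 1 := hx1
  have hT (i : Fin n) : (b x).toCLM ((tangentTriv n p).symmL ℝ x
      (EuclideanSpace.single i (1 : ℝ))) = 0 := by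
    have := hxT i
    rwa [hx1', one_smul] at this
  refine hbx ?_
  have h0 : (b x).toCLM.comp ((tangentTriv n p).symmL ℝ x) = 0 := by
    refine ContinuousLinearMap.coe_injective ((EuclideanSpace.basisFun (Fin n) ℝ).toBasis.ext
      fun i ↦ ?_)
    simpa using hT i
  change (b x).toCLM = 0
  ext X
  have h1 := congrArg (fun A : EuclideanSpace ℝ (Fin n) →L[ℝ] V x ↦
    A ((tangentTriv n p).continuousLinearMapAt ℝ x X)) h0
  simp only [ContinuousLinearMap.comp_apply] at h1
  rwa [(tangentTriv n p).symmL_continuousLinearMapAt (mem_baseSet_tangentTriv.2 hxs)] at h1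

end Operators

/-! ### The Leibniz rule -/

section Leibniz
variable {𝕜 : Type*} [RCLike 𝕜] {n : ℕ} {M : Type*} [TopologicalSpace M]
  [ChartedSpace (EuclideanSpace ℝ (Fin n)) M] [IsManifold (𝓡 n) ∞ M]
  [SecondCountableTopology M] [MeasurableSpace M] [BorelSpace M]
  [RiemannianBundle (fun x : M ↦ TangentSpace (𝓡 n) x)]
  [IsContMDiffRiemannianBundle (𝓡 n) ∞ (EuclideanSpace ℝ (Fin n))
    (fun x : M ↦ TangentSpace (𝓡 n) x)]
  {F : Type*} [NormedAddCommGroup F] [NormedSpace ℝ F] [NormedSpace 𝕜 F] [IsScalarTower ℝ 𝕜 F]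
  [FiniteDimensional ℝ F]
  {V : M → Type*} [TopologicalSpace (TotalSpace F V)] [∀ x, NormedAddCommGroup (V x)]
  [∀ x, InnerProductSpace ℝ (V x)] [∀ x, InnerProductSpace 𝕜 (V x)]
  [∀ x, IsScalarTower ℝ 𝕜 (V x)]
  [FiberBundle F V] [VectorBundle ℝ F V] [VectorBundle 𝕜 F V]
  [IsContMDiffRiemannianBundle (𝓡 n) ∞ F V] [ContMDiffVectorBundle ∞ F V (𝓡 n)]

instance (μ : Measure M) : CompleteSpace (formField 𝕜 n μ F V).L2Section := by
  have (x : M) : CompleteSpace (CotangentTensor n V x) := by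
    have := finiteDimensional_fiber F (V := V) x
    have : FiniteDimensional ℝ (CotangentTensor n V x) :=
      inferInstanceAs (FiniteDimensional ℝ (TangentSpace (𝓡 n) x →L[ℝ] V x))
    exact FiniteDimensional.complete ℝ _
  infer_instance

/-- The differential of a function, as a form with values in the trivial line bundle. -/
def dForm (n : ℕ) {M : Type*} [TopologicalSpace M]
    [ChartedSpace (EuclideanSpace ℝ (Fin n)) M] [IsManifold (𝓡 n) ∞ M]
    [RiemannianBundle (fun x : M ↦ TangentSpace (𝓡 n) x)] (f : M → ℝ) (x : M) :
    CotangentTensor n (Bundle.Trivial M ℝ) x :=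
  covForm (trivialConnection n M) f x

lemma norm_dForm_le {f : M → ℝ} {x : M} {C : ℝ} (hC : 0 ≤ C)
    (h : ∀ X, |mvfderiv (𝓡 n) f x X| ≤ C * ‖X‖) : ‖dForm n f x‖ ≤ √n * C :=
  CotangentTensor.norm_le_of_forall_apply_le _ hC h

lemma dForm_comp {f : M → ℝ} (hf : ContMDiff (𝓡 n) 𝓘(ℝ) ∞ f) {φ : ℝ → ℝ} {φ' : ℝ} {x : M}
    (hφ : HasDerivAt φ φ' (f x)) : dForm n (fun x ↦ φ (f x)) x = φ' • dForm n f x := by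
  change mvfderiv (𝓡 n) (φ ∘ f) x = φ' • mvfderiv (𝓡 n) f x
  ext X
  rw [mvfderiv, mfderiv_comp x hφ.differentiableAt.mdifferentiableAt (hf.mdifferentiable (by simp) x),
    mfderiv_eq_fderiv, hφ.hasFDerivAt.fderiv]
  exact mul_comm _ _

lemma norm_covForm_smul_le (cov : CovariantDerivative (𝓡 n) F V) {f : M → ℝ}
    (hf : ContMDiff (𝓡 n) 𝓘(ℝ) ∞ f) {u : Π x, V x} (hu : u ∈ smoothSections 𝕜 n F V) (x : M) :
    ‖covForm cov (fun x ↦ f x • u x) x‖ ≤ |f x| * ‖covForm cov u x‖ + ‖dForm n f x‖ * ‖u x‖ := by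
  have h : covForm cov (fun x ↦ f x • u x) x =
      f x • covForm cov u x +
        CotangentTensor.ofCLM ((dForm n f x).toCLM.smulRight (u x)) :=
    cov.isCovariantDerivativeOnUniv.leibniz (ContMDiff.mdifferentiable hu (by simp) x)
      (hf.mdifferentiable (by simp) x)
  rw [h]
  refine (norm_add_le _ _).trans (add_le_add ?_ (CotangentTensor.norm_smulRight _ _).le)
  rw [norm_smul, Real.norm_eq_abs]

end Leibniz

/-- A smooth function that passes from `1` at `0` to `0` at `1`. -/
def profile (t : ℝ) : ℝ := (1 + Real.cos (Real.pi * t)) / 2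

lemma profile_mem (t : ℝ) : profile t ∈ Icc 0 1 := by
  have := Real.neg_one_le_cos (Real.pi * t)
  have := Real.cos_le_one (Real.pi * t)
  constructor <;> rw [profile] <;> linarith

lemma profile_zero : profile 0 = 1 := by norm_num [profile]

lemma profile_one : profile 1 = 0 := by norm_num [profile]

lemma contDiff_profile : ContDiff ℝ ∞ profile := by
  unfold profile
  fun_prop

lemma exists_hasDerivAt_profile (t : ℝ) : ∃ d, |d| ≤ 2 ∧ HasDerivAt profile d t := by
  refine ⟨(-Real.sin (Real.pi * t) * (Real.pi * 1)) / 2, ?_,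
    ((((hasDerivAt_id t).const_mul Real.pi).cos).const_add 1).div_const 2⟩
  rw [abs_div, abs_mul, abs_neg, mul_one, abs_of_pos Real.pi_pos, abs_two]
  have := Real.abs_sin_le_one (Real.pi * t)
  have := Real.pi_le_four
  nlinarith [Real.pi_pos]

lemma abs_profile_sub_le (s t : ℝ) : |profile s - profile t| ≤ 2 * |s - t| := by
  choose d hd hd' using exists_hasDerivAt_profile
  have := convex_univ.norm_image_sub_le_of_norm_hasDerivWithin_le (f := profile) (f' := d) (C := 2)
    (fun x _ ↦ (hd' x).hasDerivWithinAt) (fun x _ ↦ hd x) (mem_univ t) (mem_univ s)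
  exact this

/-! ### Truncation of sections -/

section Truncation
variable {𝕜 : Type*} [RCLike 𝕜] {n : ℕ} {M : Type*} [TopologicalSpace M] [T2Space M]
  [ChartedSpace (EuclideanSpace ℝ (Fin n)) M] [IsManifold (𝓡 n) ∞ M]
  [SecondCountableTopology M] [MeasurableSpace M] [BorelSpace M]
  [RiemannianBundle (fun x : M ↦ TangentSpace (𝓡 n) x)]
  [IsContMDiffRiemannianBundle (𝓡 n) ∞ (EuclideanSpace ℝ (Fin n))
    (fun x : M ↦ TangentSpace (𝓡 n) x)]
  {F : Type*} [NormedAddCommGroup F] [NormedSpace ℝ F] [NormedSpace 𝕜 F] [IsScalarTower ℝ 𝕜 F]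
  [FiniteDimensional ℝ F]
  {V : M → Type*} [TopologicalSpace (TotalSpace F V)] [∀ x, NormedAddCommGroup (V x)]
  [∀ x, InnerProductSpace ℝ (V x)] [∀ x, InnerProductSpace 𝕜 (V x)]
  [∀ x, IsScalarTower ℝ 𝕜 (V x)]
  [FiberBundle F V] [VectorBundle ℝ F V] [VectorBundle 𝕜 F V]
  [IsContMDiffRiemannianBundle (𝓡 n) ∞ F V] [ContMDiffVectorBundle ∞ F V (𝓡 n)]
  (cov : CovariantDerivative (𝓡 n) F V) [cov.ContMDiffCovariantDerivative ∞]

lemma norm_dForm_norm_sq_le (hcov : cov.IsMetricCompatible) {u : Π x, V x}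
    (hu : u ∈ smoothSections 𝕜 n F V) (x : M) :
    ‖dForm n (fun x ↦ ‖u x‖ ^ 2) x‖ ≤ √n * (2 * (‖u x‖ * ‖covForm cov u x‖)) := by
  refine norm_dForm_le (by positivity) fun X ↦ ?_
  have hd := ContMDiff.mdifferentiable hu (by simp) x
  have h := hcov.mvfderiv_inner_eq (x := x) (fun _ ↦ (X : EuclideanSpace ℝ (Fin n))) hd hd
  simp only [real_inner_self_eq_norm_sq] at h
  rw [h]
  have h1 : ‖(covForm cov u x).toCLM X‖ ≤ ‖covForm cov u x‖ * ‖X‖ :=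
    CotangentTensor.norm_apply_le _ X
  refine (abs_add_le _ _).trans ?_
  have h2 := abs_real_inner_le_norm ((covForm cov u x).toCLM X) (u x)
  have h3 := abs_real_inner_le_norm (u x) ((covForm cov u x).toCLM X)
  have h4 := mul_le_mul_of_nonneg_left h1 (norm_nonneg (u x))
  calc _ ≤ ‖(covForm cov u x).toCLM X‖ * ‖u x‖ + ‖u x‖ * ‖(covForm cov u x).toCLM X‖ :=
        add_le_add h2 h3
    _ ≤ _ := by linarith

lemma contMDiff_norm_sq {u : Π x, V x} (hu : u ∈ smoothSections 𝕜 n F V) :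
    ContMDiff (𝓡 n) 𝓘(ℝ) ∞ fun x ↦ ‖u x‖ ^ 2 := by
  have := ContMDiff.inner_bundle (IB := 𝓡 n) (F := F) (n := ∞) (v := u) (w := u) hu hu
  simpa only [real_inner_self_eq_norm_sq] using this

/-- The truncation of `u` at height `R`: a smooth substitute for the radial projection onto the ball
of radius `R`. -/
def truncate (R : ℝ) (u : Π x, V x) (x : M) : V x := (R ^ 2 / (R ^ 2 + ‖u x‖ ^ 2)) • u x

lemma truncate_mem_smoothSections {R : ℝ} (hR : 0 < R) {u : Π x, V x}
    (hu : u ∈ smoothSections 𝕜 n F V) : truncate R u ∈ smoothSections 𝕜 n F V := by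
  refine smul_mem_smoothSections 𝕜 ?_ hu
  refine (contMDiff_const).div₀ (contMDiff_const.add (contMDiff_norm_sq hu)) fun x ↦ ?_
  positivity

lemma norm_truncate_le {R : ℝ} (hR : 0 < R) (u : Π x, V x) (x : M) : ‖truncate R u x‖ ≤ R := by
  have h := norm_nonneg (u x)
  rw [truncate, norm_smul, Real.norm_of_nonneg (by positivity), div_mul_eq_mul_div,
    div_le_iff₀ (by positivity)]
  nlinarith [sq_nonneg (R - ‖u x‖), mul_nonneg hR.le h]

lemma norm_truncate_le_norm {R : ℝ} (hR : 0 < R) (u : Π x, V x) (x : M) :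
    ‖truncate R u x‖ ≤ ‖u x‖ := by
  rw [truncate, norm_smul, Real.norm_of_nonneg (by positivity)]
  refine mul_le_of_le_one_left (norm_nonneg _) ?_
  rw [div_le_one (by positivity)]
  nlinarith [sq_nonneg ‖u x‖]

lemma norm_truncate_sub_le {R : ℝ} (hR : 0 < R) (u : Π x, V x) (x : M) :
    ‖truncate R u x - u x‖ ≤ ‖u x‖ ∧ ‖truncate R u x - u x‖ ≤ ‖u x‖ ^ 3 / R ^ 2 := by
  have h : truncate R u x - u x = (-(‖u x‖ ^ 2 / (R ^ 2 + ‖u x‖ ^ 2))) • u x := by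
    rw [truncate]
    nth_rewrite 3 [← one_smul ℝ (u x)]
    rw [← sub_smul]
    congr 1
    field_simp
    ring
  rw [h, norm_smul, norm_neg, Real.norm_of_nonneg (by positivity)]
  constructor
  · refine mul_le_of_le_one_left (norm_nonneg _) ?_
    rw [div_le_one (by positivity)]
    nlinarith [sq_nonneg R]
  · calc _ ≤ ‖u x‖ ^ 2 / R ^ 2 * ‖u x‖ := by
          gcongr
          nlinarith [sq_nonneg ‖u x‖]
      _ = _ := by ring

/-- Truncation does not increase `∇u` by more than a constant factor that is independent of `R`.
Metric compatibility bounds the differential of `‖u‖²` in terms of `u` and `∇u`. -/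
lemma norm_covForm_truncate_le (hcov : cov.IsMetricCompatible) {R : ℝ} (hR : 0 < R) {u : Π x, V x}
    (hu : u ∈ smoothSections 𝕜 n F V) (x : M) :
    ‖covForm cov (truncate R u) x‖ ≤ (1 + 2 * √n) * ‖covForm cov u x‖ := by
  set N : M → ℝ := fun x ↦ ‖u x‖ ^ 2
  have hN0 : 0 ≤ N x := sq_nonneg _
  have hN : ContMDiff (𝓡 n) 𝓘(ℝ) ∞ N := contMDiff_norm_sq hu
  have hpos : 0 < R ^ 2 + N x := by positivity
  have hd : HasDerivAt (fun t ↦ R ^ 2 / (R ^ 2 + t)) (-(R ^ 2 / (R ^ 2 + N x) ^ 2)) (N x) := by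
    have := (hasDerivAt_const (N x) (R ^ 2)).div ((hasDerivAt_id (N x)).const_add (R ^ 2)) hpos.ne'
    exact this.congr_deriv (by simp [neg_div])
  have ha : ContMDiff (𝓡 n) 𝓘(ℝ) ∞ fun x ↦ R ^ 2 / (R ^ 2 + N x) :=
    (contMDiff_const).div₀ (contMDiff_const.add hN) fun x ↦ by positivity
  refine (norm_covForm_smul_le (𝕜 := 𝕜) cov ha hu x).trans ?_
  rw [dForm_comp hN hd, norm_smul, norm_neg, Real.norm_of_nonneg (by positivity),
    abs_of_nonneg (by positivity)]
  have h1 : R ^ 2 / (R ^ 2 + N x) ≤ 1 := by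
    rw [div_le_one (by positivity)]
    linarith
  have h2 : R ^ 2 / (R ^ 2 + N x) ^ 2 * N x ≤ 1 := by
    rw [div_mul_eq_mul_div, div_le_one (by positivity)]
    nlinarith [sq_nonneg R, sq_nonneg (R ^ 2), sq_nonneg (N x)]
  have h3 := norm_dForm_norm_sq_le cov hcov hu x
  calc _ ≤ 1 * ‖covForm cov u x‖ +
        R ^ 2 / (R ^ 2 + N x) ^ 2 * (√n * (2 * (‖u x‖ * ‖covForm cov u x‖))) * ‖u x‖ := by gcongr
    _ = ‖covForm cov u x‖ + (R ^ 2 / (R ^ 2 + N x) ^ 2 * N x) * (2 * √n * ‖covForm cov u x‖) := by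
        simp only [N]
        ring
    _ ≤ ‖covForm cov u x‖ + 1 * (2 * √n * ‖covForm cov u x‖) := by gcongr
    _ = _ := by ring

/-- The truncations converge to `u` in `L²`. -/
lemma tendsto_integral_norm_truncate_sub {u : Π x, V x} (hu : u ∈ smoothSections 𝕜 n F V)
    (h2 : u ∈ (sectionField 𝕜 n (riemannianVolume n M) F V).squareIntegrable) :
    Tendsto (fun k : ℕ ↦ ∫ x, ‖truncate ((k : ℝ) + 1) u x - u x‖ ^ 2 ∂(riemannianVolume n M)) atTop (𝓝 0) := by
  have hR (k : ℕ) : 0 < (k : ℝ) + 1 := by positivity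
  rw [← integral_zero M ℝ (μ := riemannianVolume n M)]
  refine tendsto_integral_of_dominated_convergence (fun x ↦ ‖u x‖ ^ 2) (fun k ↦ ?_) h2.2
    (fun k ↦ ae_of_all _ fun x ↦ ?_) (ae_of_all _ fun x ↦ ?_)
  · exact ((sectionField 𝕜 n (riemannianVolume n M) F V).aestronglyMeasurable_norm _ (mem_sections_of_smooth
      (Submodule.sub_mem _ (truncate_mem_smoothSections (hR k) hu) hu))).pow 2
  · rw [norm_pow, norm_norm]
    have := (norm_truncate_sub_le (hR k) u x).1
    gcongr
  · have h : Tendsto (fun k : ℕ ↦ ‖u x‖ ^ 3 / ((k : ℝ) + 1) ^ 2) atTop (𝓝 0) :=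
      tendsto_const_nhds.div_atTop ((tendsto_pow_atTop two_ne_zero).comp
        (tendsto_atTop_add_const_right _ _ tendsto_natCast_atTop_atTop))
    have h' := squeeze_zero (fun _ ↦ norm_nonneg _)
      (fun k ↦ (norm_truncate_sub_le (hR k) u x).2) h
    simpa using h'.pow 2

end Truncation

lemma exists_isCompact_setIntegral_compl_lt {M : Type*} [TopologicalSpace M] [T2Space M]
    [SigmaCompactSpace M] [WeaklyLocallyCompactSpace M] [MeasurableSpace M] [BorelSpace M]
    {ν : Measure M} {f : M → ℝ}
    (hf : Integrable f ν) {ε : ℝ} (hε : 0 < ε) : ∃ C, IsCompact C ∧ ∫ x in Cᶜ, f x ∂ν < ε := by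
  let K := CompactExhaustion.choice M
  have h : Tendsto (fun k ↦ ∫ x in (K k)ᶜ, f x ∂ν) atTop (𝓝 0) := by
    rw [← integral_zero M ℝ (μ := ν)]
    simp_rw [← integral_indicator (K.isCompact _).measurableSet.compl]
    refine tendsto_integral_of_dominated_convergence (fun x ↦ ‖f x‖)
      (fun k ↦ hf.1.indicator (K.isCompact k).measurableSet.compl) hf.norm
      (fun k ↦ ae_of_all _ fun x ↦ norm_indicator_le_norm_self _ _) (ae_of_all _ fun x ↦ ?_)
    refine tendsto_const_nhds.congr' ?_
    obtain ⟨k, hk⟩ := K.exists_mem x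
    filter_upwards [eventually_ge_atTop k] with m hm
    rw [indicator_of_notMem]
    exact fun h ↦ h (K.subset hm hk)
  obtain ⟨k, hk⟩ := (h.eventually (gt_mem_nhds hε)).exists
  exact ⟨K k, K.isCompact k, hk⟩

/-! ### Polar sets and smooth test functions -/

lemma graph_closure_le {𝕜 H K : Type*} [RCLike 𝕜] [NormedAddCommGroup H]
    [InnerProductSpace 𝕜 H] [NormedAddCommGroup K] [InnerProductSpace 𝕜 K] (A : H →ₗ.[𝕜] K) :
    A.closure.graph ≤ A.graph.topologicalClosure := by
  by_cases h : A.IsClosable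
  · exact h.graph_closure_eq_closure_graph.ge
  · rw [LinearPMap.closure_def' h]
    exact A.graph.le_topologicalClosure

section Approximation
variable {𝕜 : Type*} [RCLike 𝕜] {n : ℕ} {M : Type*} [EMetricSpace M]
  [ChartedSpace (EuclideanSpace ℝ (Fin n)) M] [IsManifold (𝓡 n) ∞ M]
  [SecondCountableTopology M] [MeasurableSpace M] [BorelSpace M]
  [RiemannianBundle (fun x : M ↦ TangentSpace (𝓡 n) x)]
  [IsContMDiffRiemannianBundle (𝓡 n) ∞ (EuclideanSpace ℝ (Fin n))
    (fun x : M ↦ TangentSpace (𝓡 n) x)]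
  {F : Type*} [NormedAddCommGroup F] [NormedSpace ℝ F] [NormedSpace 𝕜 F] [IsScalarTower ℝ 𝕜 F]
  [FiniteDimensional ℝ F]
  {V : M → Type*} [TopologicalSpace (TotalSpace F V)] [∀ x, NormedAddCommGroup (V x)]
  [∀ x, InnerProductSpace ℝ (V x)] [∀ x, InnerProductSpace 𝕜 (V x)]
  [∀ x, IsScalarTower ℝ 𝕜 (V x)]
  [FiberBundle F V] [VectorBundle ℝ F V] [VectorBundle 𝕜 F V]
  [IsContMDiffRiemannianBundle (𝓡 n) ∞ F V] [ContMDiffVectorBundle ∞ F V (𝓡 n)]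
  (cov : CovariantDerivative (𝓡 n) F V) [cov.ContMDiffCovariantDerivative ∞]
  [IsLinearConnection 𝕜 n cov]

/-- A function on `M` as a section of the trivial line bundle. -/
def funSection (f : M → ℝ) : Π x, Bundle.Trivial M ℝ x := f

lemma funSection_mem_smoothSections {f : M → ℝ} (hf : ContMDiff (𝓡 n) 𝓘(ℝ) ∞ f) :
    funSection f ∈ smoothSections ℝ n ℝ (Bundle.Trivial M ℝ) := fun x ↦
  (contMDiffAt_section x).2 (hf x)

lemma contMDiff_of_mem_smoothSections {u : Π x, Bundle.Trivial M ℝ x}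
    (hu : u ∈ smoothSections ℝ n ℝ (Bundle.Trivial M ℝ)) :
    ContMDiff (𝓡 n) 𝓘(ℝ) ∞ (fun x ↦ (u x : ℝ)) := fun x ↦
  (contMDiffAt_section x).1 (hu x)

lemma norm_dForm_mul_le {f g : M → ℝ} (hf : ContMDiff (𝓡 n) 𝓘(ℝ) ∞ f)
    (hg : ContMDiff (𝓡 n) 𝓘(ℝ) ∞ g) (x : M) :
    ‖dForm n (fun x ↦ f x * g x) x‖ ≤ |f x| * ‖dForm n g x‖ + ‖dForm n f x‖ * |g x| :=
  norm_covForm_smul_le (𝕜 := ℝ) (trivialConnection n M) hf (funSection_mem_smoothSections hg) x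

local notation "L²(M)" => (sectionField ℝ n (riemannianVolume n M) ℝ (Bundle.Trivial M ℝ))
local notation "L²(T*M)" => (formField ℝ n (riemannianVolume n M) ℝ (Bundle.Trivial M ℝ))

/-- A polar set has neighbourhoods with test functions of small norm, and these are limits of smooth
functions of small norm. -/
lemma exists_smooth_test {A : Set (UniformSpace.Completion M)} (hA : IsPolar n A) {δ : ℝ}
    (hδ : 0 < δ) : ∃ Ω, IsOpen Ω ∧ A ⊆ Ω ∧ ∃ e : (L²(M)).L2Section,
      (∀ᵐ x : M ∂(riemannianVolume n M), (x : UniformSpace.Completion M) ∈ Ω → (e x : ℝ) = 1) ∧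
      ∀ η > 0, ∃ f : M → ℝ, ContMDiff (𝓡 n) 𝓘(ℝ) ∞ f ∧
        ∃ (h1 : funSection f ∈ (L²(M)).squareIntegrable)
          (h2 : dForm n f ∈ (L²(T*M)).squareIntegrable),
          ‖(L²(M)).ofMem _ h1 - e‖ < η ∧ ‖(L²(M)).ofMem _ h1‖ < δ ∧ ‖(L²(T*M)).ofMem _ h2‖ < δ := by
  have hlt : capacity n A < ENNReal.ofReal (δ ^ 2) := by
    rw [show capacity n A = 0 from hA]
    exact ENNReal.ofReal_pos.2 (by positivity)
  simp only [capacity, capacityOpen, iInf_lt_iff] at hlt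
  obtain ⟨Ω, hΩ, hAΩ, u, ⟨e, heu, -, he1⟩, hu⟩ := hlt
  rw [ENNReal.ofReal_lt_ofReal_iff (by positivity)] at hu
  have hu1 : ‖e‖ < δ := by
    rw [← heu, SeparationQuotient.norm_mk] at hu
    refine lt_of_pow_lt_pow_left₀ 2 hδ.le ?_
    linarith [sq_nonneg ‖dN n u‖]
  have hu2 : ‖dN n u‖ < δ := by
    refine lt_of_pow_lt_pow_left₀ 2 hδ.le ?_
    linarith [sq_nonneg ‖(u : L2Sections ℝ n ℝ (Bundle.Trivial M ℝ))‖]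
  refine ⟨Ω, hΩ, hAΩ, e, he1, fun η hη ↦ ?_⟩
  have hcl : ((u : L2Sections ℝ n ℝ (Bundle.Trivial M ℝ)), dN n u) ∈
      closure ((nabla2 ℝ n (trivialConnection n M)).graph : Set _) :=
    graph_closure_le _ (LinearPMap.mem_graph (dN n) u)
  obtain ⟨q, hq, hqd⟩ := Metric.mem_closure_iff.1 hcl (min η (min (δ - ‖e‖) (δ - ‖dN n u‖)))
    (lt_min hη (lt_min (by linarith) (by linarith)))
  rw [SetLike.mem_coe, nabla2_graph] at hq
  obtain ⟨g, β, hg, -, hβ, rfl⟩ := hq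
  rw [lt_min_iff, lt_min_iff, Prod.dist_eq] at hqd
  obtain ⟨hd1, hd2, hd3⟩ := hqd
  rw [max_lt_iff] at hd1 hd2 hd3
  rw [← heu] at hd1 hd2
  simp only [SeparationQuotient.dist_mk] at hd1 hd2
  have hf2 : dForm n (fun x ↦ (g x : ℝ)) = β := funext fun x ↦ (hβ x).symm
  have h2 : dForm n (fun x ↦ (g x : ℝ)) ∈ (L²(T*M)).squareIntegrable := hf2 ▸ β.mem
  refine ⟨fun x ↦ g x, contMDiff_of_mem_smoothSections hg, g.mem, h2, ?_, ?_, ?_⟩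
  · change ‖g - e‖ < η
    rw [← dist_eq_norm, dist_comm]
    exact hd1.1
  · change ‖g‖ < δ
    have := norm_le_norm_add_norm_sub' g e
    have h := hd2.1
    rw [dist_comm, dist_eq_norm] at h
    linarith
  · have : (L²(T*M)).ofMem _ h2 = β := MeasurableField.L2Section.ext fun x ↦ congrFun hf2 x
    rw [this]
    have h := hd3.2
    rw [dist_comm, dist_eq_norm] at h
    have h3 := norm_le_norm_add_norm_sub' (SeparationQuotient.mk β) (dN n u)
    rw [SeparationQuotient.norm_mk] at h3
    linarith

end Approximation

/-! ### Compactly supported sections as a core -/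

section Approximation
variable {𝕜 : Type*} [RCLike 𝕜] {n : ℕ} {M : Type*} [EMetricSpace M]
  [ChartedSpace (EuclideanSpace ℝ (Fin n)) M] [IsManifold (𝓡 n) ∞ M]
  [SecondCountableTopology M] [MeasurableSpace M] [BorelSpace M]
  [RiemannianBundle (fun x : M ↦ TangentSpace (𝓡 n) x)]
  [IsContMDiffRiemannianBundle (𝓡 n) ∞ (EuclideanSpace ℝ (Fin n))
    (fun x : M ↦ TangentSpace (𝓡 n) x)]
  {F : Type*} [NormedAddCommGroup F] [NormedSpace ℝ F] [NormedSpace 𝕜 F] [IsScalarTower ℝ 𝕜 F]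
  [FiniteDimensional ℝ F]
  {V : M → Type*} [TopologicalSpace (TotalSpace F V)] [∀ x, NormedAddCommGroup (V x)]
  [∀ x, InnerProductSpace ℝ (V x)] [∀ x, InnerProductSpace 𝕜 (V x)]
  [∀ x, IsScalarTower ℝ 𝕜 (V x)]
  [FiberBundle F V] [VectorBundle ℝ F V] [VectorBundle 𝕜 F V]
  [IsContMDiffRiemannianBundle (𝓡 n) ∞ F V] [ContMDiffVectorBundle ∞ F V (𝓡 n)]
  (cov : CovariantDerivative (𝓡 n) F V) [cov.ContMDiffCovariantDerivative ∞]
  [IsLinearConnection 𝕜 n cov]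

/-- The pointwise `L²` estimate: for the function `profile`, written `φ` here, `χ φ(f) v` differs
from `v` only where `χ ≠ 1`, or where `f` or `f - e` is not small. Where `χ ≠ 1`, either `v` is
bounded by `i` or the test function `e` is `1`. -/
lemma norm_cutoff_smul_sub_sq_le {E : Type*} [NormedAddCommGroup E] [NormedSpace ℝ E] {v : E}
    {R χ f e i : ℝ} (hv : ‖v‖ ≤ R) (hχ : χ ∈ Icc 0 1) (hi : 0 ≤ i)
    (h : χ = 1 ∨ ‖v‖ ≤ i ∨ e = 1) :
    ‖(χ * profile f) • v - v‖ ^ 2 ≤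
      3 * (i ^ 2 + 4 * R ^ 2 * ‖f - e‖ ^ 2 + 4 * R ^ 2 * ‖f‖ ^ 2) := by
  have hp := profile_mem f
  have hv0 := norm_nonneg v
  have h1 : ‖(χ * profile f) • v - v‖ ≤ i + 2 * R * ‖f - e‖ + 2 * R * ‖f‖ := by
    have h2 : 1 - profile f ≤ 2 * ‖f‖ := by
      have := (le_abs_self _).trans (abs_profile_sub_le 0 f)
      rwa [profile_zero, zero_sub, abs_neg] at this
    have h3 : (1 - χ) * profile f * ‖v‖ ≤ i + 2 * R * ‖f - e‖ := by
      have h4 : (1 - χ) * profile f ≤ profile f :=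
        mul_le_of_le_one_left hp.1 (by linarith [hχ.1])
      have h5 : 0 ≤ 2 * R * ‖f - e‖ := by
        have := norm_nonneg (f - e)
        have : 0 ≤ R := hv0.trans hv
        positivity
      rcases h with h | h | h
      · rw [h]
        linarith
      · have := mul_le_of_le_one_left hv0 (h4.trans hp.2)
        linarith
      · have h6 : profile f ≤ 2 * ‖f - e‖ := by
          have := (le_abs_self _).trans (abs_profile_sub_le f e)
          rwa [h, profile_one, sub_zero, ← h] at this
        calc _ ≤ (2 * ‖f - e‖) * R := by
              refine mul_le_mul (h4.trans h6) hv hv0 (by positivity)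
          _ ≤ _ := by linarith
    have h7 : (χ * profile f) • v - v = (-((1 - χ) * profile f + (1 - profile f))) • v := by
      module
    have h8 : 0 ≤ (1 - χ) * profile f + (1 - profile f) :=
      add_nonneg (mul_nonneg (by linarith [hχ.2]) hp.1) (by linarith [hp.2])
    rw [h7, norm_smul, norm_neg, Real.norm_of_nonneg h8, add_mul]
    have h9 : (1 - profile f) * ‖v‖ ≤ 2 * ‖f‖ * R :=
      mul_le_mul h2 hv hv0 (by positivity)
    linarith
  have hsq (a b c : ℝ) : (a + b + c) ^ 2 ≤ 3 * (a ^ 2 + b ^ 2 + c ^ 2) := by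
    nlinarith [sq_nonneg (a - b), sq_nonneg (b - c), sq_nonneg (a - c)]
  calc _ ≤ (i + 2 * R * ‖f - e‖ + 2 * R * ‖f‖) ^ 2 := by gcongr
    _ ≤ _ := hsq _ _ _
    _ = _ := by ring

/-- The pointwise gradient estimate for `χ φ(f) v`, where `e` stands for the value at `x` of a test
function near `f`: either `dχ` is bounded by `K` at `x`, or `e = 1`, and then `φ(f)` is small enough
there to compensate for `dχ`. -/
lemma norm_covForm_cutoff_smul_sq_le {v : Π x, V x} (hv : v ∈ smoothSections 𝕜 n F V)
    {R : ℝ} (hvR : ∀ x, ‖v x‖ ≤ R) {χ f : M → ℝ} (hχ : ContMDiff (𝓡 n) 𝓘(ℝ) ∞ χ)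
    (hf : ContMDiff (𝓡 n) 𝓘(ℝ) ∞ f) (hχ1 : ∀ x, χ x ∈ Icc 0 1) {x : M} {e B K : ℝ} (hB : 0 ≤ B)
    (hK : 0 ≤ K) (hχB : ‖dForm n χ x‖ ≤ B) (h : ‖dForm n χ x‖ ≤ K ∨ e = 1) :
    ‖covForm cov (fun x ↦ (χ x * profile (f x)) • v x) x‖ ^ 2 ≤
      4 * (‖covForm cov v x‖ ^ 2 + K ^ 2 * ‖v x‖ ^ 2 + (2 * B * R) ^ 2 * ‖f x - e‖ ^ 2 +
        4 * R ^ 2 * ‖dForm n f x‖ ^ 2) := by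
  have hpf : ContMDiff (𝓡 n) 𝓘(ℝ) ∞ fun x ↦ profile (f x) := contDiff_profile.contMDiff.comp hf
  obtain ⟨d, hd2, hd⟩ := exists_hasDerivAt_profile (f x)
  have hp := profile_mem (f x)
  have hv0 := norm_nonneg (v x)
  have hR : 0 ≤ R := hv0.trans (hvR x)
  have hχp : ContMDiff (𝓡 n) 𝓘(ℝ) ∞ fun x ↦ χ x * profile (f x) := hχ.mul hpf
  have h1 := norm_covForm_smul_le cov hχp hv x
  have h2 := norm_dForm_mul_le hχ hpf x
  rw [dForm_comp hf hd, norm_smul, Real.norm_eq_abs, abs_of_nonneg (hχ1 x).1,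
    abs_of_nonneg hp.1] at h2
  have h3 : ‖dForm n χ x‖ * profile (f x) * ‖v x‖ ≤ K * ‖v x‖ + 2 * B * R * ‖f x - e‖ := by
    rcases h with h | h
    · have h4 : ‖dForm n χ x‖ * profile (f x) * ‖v x‖ ≤ K * 1 * ‖v x‖ := by
        have := hp.1
        have := hp.2
        gcongr
      have : 0 ≤ 2 * B * R * ‖f x - e‖ := by positivity
      linarith
    · have h6 : profile (f x) ≤ 2 * ‖f x - e‖ := by
        have := (le_abs_self _).trans (abs_profile_sub_le (f x) e)
        rwa [h, profile_one, sub_zero, ← h] at this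
      have h7 : ‖dForm n χ x‖ * profile (f x) * ‖v x‖ ≤ B * (2 * ‖f x - e‖) * R := by
        have := hvR x
        have := hp.1
        gcongr
      have : 0 ≤ K * ‖v x‖ := by positivity
      linarith
  have h4 : |χ x * profile (f x)| * ‖covForm cov v x‖ ≤ ‖covForm cov v x‖ := by
    refine mul_le_of_le_one_left (norm_nonneg _) ?_
    rw [abs_of_nonneg (mul_nonneg (hχ1 x).1 hp.1)]
    exact mul_le_one₀ (hχ1 x).2 hp.1 hp.2
  have h5 : χ x * (|d| * ‖dForm n f x‖) * ‖v x‖ ≤ 2 * R * ‖dForm n f x‖ := by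
    calc _ ≤ 1 * (2 * ‖dForm n f x‖) * R := by
          have := hvR x
          have := (hχ1 x).1
          have := (hχ1 x).2
          gcongr
      _ = _ := by ring
  have h6 : ‖covForm cov (fun x ↦ (χ x * profile (f x)) • v x) x‖ ≤
      ‖covForm cov v x‖ + K * ‖v x‖ + 2 * B * R * ‖f x - e‖ + 2 * R * ‖dForm n f x‖ := by
    have h7 := mul_le_mul_of_nonneg_right h2 hv0
    refine h1.trans ?_
    linarith
  have hsq (a b c d : ℝ) : (a + b + c + d) ^ 2 ≤ 4 * (a ^ 2 + b ^ 2 + c ^ 2 + d ^ 2) := by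
    nlinarith [sq_nonneg (a - b), sq_nonneg (b - c), sq_nonneg (a - c), sq_nonneg (a - d),
      sq_nonneg (b - d), sq_nonneg (c - d)]
  calc _ ≤ (‖covForm cov v x‖ + K * ‖v x‖ + 2 * B * R * ‖f x - e‖ +
        2 * R * ‖dForm n f x‖) ^ 2 := by gcongr
    _ ≤ _ := hsq _ _ _ _
    _ = _ := by ring

/-- If the Cauchy boundary is polar, then a bounded smooth section `v` with `v` and `∇v` square
integrable is an `L²` limit of smooth compactly supported sections with bounded `∇`. -/
theorem exists_mem_graph_nablaC_of_bounded [IsRiemannianManifold (𝓡 n) M]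
    (hpolar : IsPolar n (cauchyBoundary M)) {v : Π x, V x} (hv : v ∈ smoothSections 𝕜 n F V)
    {R : ℝ} (hvR : ∀ x, ‖v x‖ ≤ R) (hR : 0 ≤ R)
    (h1 : v ∈ (sectionField 𝕜 n (riemannianVolume n M) F V).squareIntegrable)
    (h2 : covForm cov v ∈ (formField 𝕜 n (riemannianVolume n M) F V).squareIntegrable) :
    ∃ C, ∀ ε > 0, ∃ p ∈ (nablaC 𝕜 n cov).graph,
      ‖p.1 - SeparationQuotient.mk (MeasurableField.ofMem _ v h1)‖ < ε ∧ ‖p.2‖ ≤ C := by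
  have : LocallyCompactSpace M := ChartedSpace.locallyCompactSpace (EuclideanSpace ℝ (Fin n)) M
  obtain ⟨K, hK0, hK⟩ := exists_smooth_cutoff n M
  set v' := MeasurableField.ofMem (sectionField 𝕜 n (riemannianVolume n M) F V) v h1
  set D := MeasurableField.ofMem (formField 𝕜 n (riemannianVolume n M) F V) _ h2
  -- the bound must not depend on `ε`, and so not on the bound for `dχ` on `Ω`, which gets absorbed in
  -- the summand `1`
  refine ⟨√(4 * (‖D‖ ^ 2 + (√n * K) ^ 2 * ‖v'‖ ^ 2 + 1 + 4 * R ^ 2)), fun ε hε ↦ ?_⟩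
  obtain ⟨C, hC, hCε⟩ := exists_isCompact_setIntegral_compl_lt h1.2
    (show 0 < ε ^ 2 / 12 by positivity)
  set δ := min 1 (ε / (10 * (R + 1)))
  have hδ : 0 < δ := lt_min one_pos (by positivity)
  obtain ⟨Ω, hΩ, hAΩ, e, he, hsmooth⟩ := exists_smooth_test hpolar hδ
  obtain ⟨χ, hχ, hχc, hχ1, hχC, hχΩ⟩ := hK Ω hΩ hAΩ C hC
  obtain ⟨B, hB0, hB⟩ := exists_abs_mvfderiv_le hχ hχc
  -- the function `f` is chosen after `χ`, whose differential is not under control on `Ω`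
  obtain ⟨f, hf, hf1, hf2, hfe, hfδ, hdfδ⟩ := hsmooth (min δ (1 / (2 * (√n * B) * R + 1)))
    (lt_min hδ (by positivity))
  set f' := MeasurableField.ofMem _ _ hf1
  set d := f' - e
  set df := MeasurableField.ofMem _ _ hf2
  have hp : ContMDiff (𝓡 n) 𝓘(ℝ) ∞ fun x ↦ χ x * profile (f x) :=
    hχ.mul (contDiff_profile.contMDiff.comp hf)
  have hpc : HasCompactSupport fun x ↦ χ x * profile (f x) := hχc.mul_right
  have hw := smul_mem_smoothSections 𝕜 hp hv
  have hwc := smul_mem_compactlySupportedSections 𝕜 hpc v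
  have hw1 := mem_squareIntegrable_of_hasCompactSupport hw hwc
  have hw2 := covForm_mem_squareIntegrable_of_hasCompactSupport cov hw hwc
  have hmem := mem_connectionGraph cov hw hwc hw1 hw2
  rw [← nablaC_graph] at hmem
  have hd2 : Integrable (fun x ↦ ‖d x‖ ^ 2) (riemannianVolume n M) := d.mem.2
  have hf2' : Integrable (fun x ↦ ‖f' x‖ ^ 2) (riemannianVolume n M) := f'.mem.2
  have hdf2 : Integrable (fun x ↦ ‖df x‖ ^ 2) (riemannianVolume n M) := df.mem.2
  have hv2 : Integrable (fun x ↦ ‖v' x‖ ^ 2) (riemannianVolume n M) := v'.mem.2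
  have hD2 : Integrable (fun x ↦ ‖D x‖ ^ 2) (riemannianVolume n M) := D.mem.2
  refine ⟨_, hmem, ?_, ?_⟩
  · have hi2 : Integrable (Cᶜ.indicator fun x ↦ ‖v x‖ ^ 2) (riemannianVolume n M) :=
      hv2.indicator hC.measurableSet.compl
    have hle : ‖MeasurableField.ofMem _ _ hw1 - v'‖ ^ 2 ≤
        3 * ((∫ x in Cᶜ, ‖v x‖ ^ 2 ∂(riemannianVolume n M)) + 4 * R ^ 2 * ‖d‖ ^ 2 +
          4 * R ^ 2 * ‖f'‖ ^ 2) := by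
      have hi3 : Integrable (fun x ↦ Cᶜ.indicator (fun x ↦ ‖v x‖ ^ 2) x + 4 * R ^ 2 * ‖d x‖ ^ 2)
        (riemannianVolume n M) := hi2.add (hd2.const_mul _)
      rw [MeasurableField.norm_sq _ d, MeasurableField.norm_sq _ f',
        ← integral_indicator hC.measurableSet.compl, ← integral_const_mul, ← integral_const_mul,
        ← integral_add hi2 (hd2.const_mul _), ← integral_add hi3 (hf2'.const_mul _),
        ← integral_const_mul]
      refine MeasurableField.norm_sq_le_of_ae_le ((hi3.add (hf2'.const_mul _)).const_mul _) ?_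
      filter_upwards [he] with x hx
      have hind : Cᶜ.indicator (fun x ↦ ‖v x‖ ^ 2) x = (Cᶜ.indicator (fun x ↦ ‖v x‖) x) ^ 2 := by
        by_cases hxC : x ∈ Cᶜ <;> simp [hxC]
      rw [hind]
      refine norm_cutoff_smul_sub_sq_le (hvR x) (hχ1 x) (indicator_nonneg (fun x _ ↦ norm_nonneg _) x)
        ?_
      by_cases hxΩ : (x : UniformSpace.Completion M) ∈ Ω
      · exact Or.inr (Or.inr (hx hxΩ))
      · by_cases hxC : x ∈ C
        · exact Or.inl (hχC x hxC hxΩ)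
        · refine Or.inr (Or.inl ?_)
          rw [indicator_of_mem (show x ∈ Cᶜ from hxC)]
    have hδ1 : (R + 1) * δ ≤ ε / 10 := by
      calc (R + 1) * δ ≤ (R + 1) * (ε / (10 * (R + 1))) := by
            gcongr
            exact min_le_right _ _
        _ = ε / 10 := by field_simp
    have hRd : R * ‖d‖ ≤ ε / 10 := by
      refine (mul_le_mul (by linarith) (hfe.le.trans (min_le_left _ _)) (norm_nonneg _)
        (by positivity)).trans hδ1
    have hRf : R * ‖f'‖ ≤ ε / 10 := by
      refine (mul_le_mul (by linarith) hfδ.le (norm_nonneg _) (by positivity)).trans hδ1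
    have h3 : (R * ‖d‖) ^ 2 ≤ (ε / 10) ^ 2 := by gcongr
    have h4 : (R * ‖f'‖) ^ 2 ≤ (ε / 10) ^ 2 := by gcongr
    change ‖(SeparationQuotient.mk (MeasurableField.ofMem _ _ hw1 - v') : L2Sections 𝕜 n F V)‖ < ε
    rw [SeparationQuotient.norm_mk]
    refine lt_of_pow_lt_pow_left₀ 2 hε.le ?_
    have : 0 < ε ^ 2 := by positivity
    nlinarith
  · rw [SeparationQuotient.norm_mk]
    refine Real.le_sqrt_of_sq_le ?_
    have hle : ‖MeasurableField.ofMem _ _ hw2‖ ^ 2 ≤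
        4 * (‖D‖ ^ 2 + (√n * K) ^ 2 * ‖v'‖ ^ 2 + (2 * (√n * B) * R) ^ 2 * ‖d‖ ^ 2 +
          4 * R ^ 2 * ‖df‖ ^ 2) := by
      have hi3 : Integrable (fun x ↦ ‖D x‖ ^ 2 + (√n * K) ^ 2 * ‖v' x‖ ^ 2)
        (riemannianVolume n M) := hD2.add (hv2.const_mul _)
      have hi4 : Integrable (fun x ↦ ‖D x‖ ^ 2 + (√n * K) ^ 2 * ‖v' x‖ ^ 2 +
        (2 * (√n * B) * R) ^ 2 * ‖d x‖ ^ 2) (riemannianVolume n M) := hi3.add (hd2.const_mul _)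
      rw [MeasurableField.norm_sq _ d, MeasurableField.norm_sq _ D, MeasurableField.norm_sq _ v',
        MeasurableField.norm_sq _ df, ← integral_const_mul, ← integral_const_mul,
        ← integral_const_mul, ← integral_add hD2 (hv2.const_mul _),
        ← integral_add hi3 (hd2.const_mul _), ← integral_add hi4 (hdf2.const_mul _),
        ← integral_const_mul]
      refine MeasurableField.norm_sq_le_of_ae_le ((hi4.add (hdf2.const_mul _)).const_mul _) ?_
      filter_upwards [he] with x hx
      refine norm_covForm_cutoff_smul_sq_le cov hv hvR hχ hf hχ1 (by positivity) (by positivity)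
        (norm_dForm_le hB0 (hB x)) ?_
      by_cases hxΩ : (x : UniformSpace.Completion M) ∈ Ω
      · exact Or.inr (hx hxΩ)
      · exact Or.inl (norm_dForm_le hK0 (hχΩ x hxΩ))
    refine hle.trans ?_
    have hd1 : 2 * (√n * B) * R * ‖d‖ ≤ 1 := by
      calc 2 * (√n * B) * R * ‖d‖ ≤
            (2 * (√n * B) * R + 1) * (1 / (2 * (√n * B) * R + 1)) := by
            refine mul_le_mul (by linarith) (hfe.le.trans (min_le_right _ _)) (norm_nonneg _)
              (by positivity)
        _ = 1 := by field_simp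
    have hdf1 : ‖df‖ ≤ 1 := hdfδ.le.trans (min_le_left _ _)
    have h3 : (2 * (√n * B) * R) ^ 2 * ‖d‖ ^ 2 ≤ 1 := by
      rw [← mul_pow]
      exact pow_le_one₀ (by positivity) hd1
    have h4 : 4 * R ^ 2 * ‖df‖ ^ 2 ≤ 4 * R ^ 2 * 1 := by
      gcongr
      exact pow_le_one₀ (norm_nonneg _) hdf1
    linarith

/-- If the Cauchy boundary is polar, then the smooth compactly supported sections are a core for
`∇_N`. -/
theorem nablaN_eq_closure_nablaC [IsRiemannianManifold (𝓡 n) M] (hcov : cov.IsMetricCompatible)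
    (hpolar : IsPolar n (cauchyBoundary M)) :
    (nablaC 𝕜 n cov).IsClosable ∧ nablaN 𝕜 n cov = (nablaC 𝕜 n cov).closure := by
  have hcl := isClosable_nabla2 (𝕜 := 𝕜) cov hcov
  have hle : nablaC 𝕜 n cov ≤ nabla2 𝕜 n cov := by
    refine LinearPMap.le_of_le_graph ?_
    rw [nablaC_graph, nabla2_graph]
    rintro _ ⟨u, α, hu, -, hα, rfl⟩
    exact ⟨u, α, hu, Submodule.mem_top, hα, rfl⟩
  have hclC : (nablaC 𝕜 n cov).IsClosable := hcl.leIsClosable hle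
  refine ⟨hclC, ?_⟩
  set G := (nablaC 𝕜 n cov).graph.topologicalClosure
  have hG : IsClosed (G : Set (L2Sections 𝕜 n F V × L2Forms 𝕜 n F V)) :=
    Submodule.isClosed_topologicalClosure _
  have hN : (nablaN 𝕜 n cov).graph = (nabla2 𝕜 n cov).graph.topologicalClosure :=
    hcl.graph_closure_eq_closure_graph.symm
  have hGN : G ≤ (nablaN 𝕜 n cov).graph := by
    rw [hN]
    exact Submodule.topologicalClosure_mono (LinearPMap.le_graph_of_le hle)
  -- weak compactness: it is enough to approximate `u` while `∇` stays bounded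
  have key {u : Π x, V x} (hu : u ∈ smoothSections 𝕜 n F V)
      (h1 : u ∈ (sectionField 𝕜 n (riemannianVolume n M) F V).squareIntegrable)
      (h2 : covForm cov u ∈ (formField 𝕜 n (riemannianVolume n M) F V).squareIntegrable) {C : ℝ}
      (h : ∀ ε > 0, ∃ p ∈ G, ‖p.1 - SeparationQuotient.mk (MeasurableField.ofMem _ u h1)‖ < ε ∧
        ‖p.2‖ ≤ C) : ((SeparationQuotient.mk (MeasurableField.ofMem _ u h1),
          SeparationQuotient.mk (MeasurableField.ofMem _ _ h2)) :
          L2Sections 𝕜 n F V × L2Forms 𝕜 n F V) ∈ G := by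
    obtain ⟨y, hy⟩ := exists_mem_of_forall_norm_le hG h
    have hmem := mem_connectionGraph cov (D := ⊤) hu Submodule.mem_top h1 h2
    rw [← nabla2_graph] at hmem
    have hmem' := LinearPMap.le_graph_of_le (nabla2 𝕜 n cov).le_closure hmem
    rwa [LinearPMap.mem_graph_snd_inj _ (hGN hy) hmem' rfl] at hy
  have hbdd {u : Π x, V x} (hu : u ∈ smoothSections 𝕜 n F V)
      (h1 : u ∈ (sectionField 𝕜 n (riemannianVolume n M) F V).squareIntegrable)
      (h2 : covForm cov u ∈ (formField 𝕜 n (riemannianVolume n M) F V).squareIntegrable) {R : ℝ}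
      (hR : 0 ≤ R) (huR : ∀ x, ‖u x‖ ≤ R) : ((SeparationQuotient.mk (MeasurableField.ofMem _ u h1),
          SeparationQuotient.mk (MeasurableField.ofMem _ _ h2)) :
          L2Sections 𝕜 n F V × L2Forms 𝕜 n F V) ∈ G := by
    obtain ⟨C, hC⟩ := exists_mem_graph_nablaC_of_bounded cov hpolar hu huR hR h1 h2
    refine key hu h1 h2 (C := C) fun ε hε ↦ ?_
    obtain ⟨p, hp, hp'⟩ := hC ε hε
    exact ⟨p, Submodule.le_topologicalClosure _ hp, hp'⟩
  have h2G : (nabla2 𝕜 n cov).graph ≤ G := by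
    rw [nabla2_graph]
    rintro _ ⟨u, α, hu, -, hα, rfl⟩
    have hα' : covForm cov u = α := funext fun x ↦ (hα x).symm
    have h2 : covForm cov u ∈ (formField 𝕜 n (riemannianVolume n M) F V).squareIntegrable :=
      hα' ▸ α.mem
    have hα2 : α = MeasurableField.ofMem _ _ h2 :=
      MeasurableField.L2Section.ext fun x ↦ (congrFun hα' x).symm
    rw [hα2]
    refine key hu u.mem h2 (C := (1 + 2 * √n) * ‖α‖) fun ε hε ↦ ?_
    have hlim := tendsto_integral_norm_truncate_sub hu u.mem
    obtain ⟨k, hk⟩ := (hlim.eventually (gt_mem_nhds (show 0 < ε ^ 2 by positivity))).exists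
    have hR : 0 < (k : ℝ) + 1 := by positivity
    have ht := truncate_mem_smoothSections hR hu
    have ht1 : truncate ((k : ℝ) + 1) u ∈
        (sectionField 𝕜 n (riemannianVolume n M) F V).squareIntegrable := by
      refine MeasurableField.mem_squareIntegrable_of_le (mem_sections_of_smooth ht) u.mem.2
        (ae_of_all _ fun x ↦ ?_)
      have := norm_truncate_le_norm hR u x
      gcongr
    have hle (x : M) : ‖covForm cov (truncate ((k : ℝ) + 1) u) x‖ ^ 2 ≤
        (1 + 2 * √n) ^ 2 * ‖α x‖ ^ 2 := by
      rw [← mul_pow, ← hα']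
      have := norm_covForm_truncate_le cov hcov hR hu x
      gcongr
    have ht2 : covForm cov (truncate ((k : ℝ) + 1) u) ∈
        (formField 𝕜 n (riemannianVolume n M) F V).squareIntegrable :=
      MeasurableField.mem_squareIntegrable_of_le (covForm_mem_sections cov ht)
        (α.mem.2.const_mul _) (ae_of_all _ hle)
    refine ⟨_, hbdd ht ht1 ht2 hR.le (norm_truncate_le hR u), ?_, ?_⟩
    · change ‖(SeparationQuotient.mk (MeasurableField.ofMem _ _ ht1 - u) : L2Sections 𝕜 n F V)‖ < ε
      rw [SeparationQuotient.norm_mk]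
      refine lt_of_pow_lt_pow_left₀ 2 hε.le ?_
      rw [MeasurableField.norm_sq]
      exact hk
    · rw [SeparationQuotient.norm_mk]
      refine le_of_sq_le_sq ?_ (by positivity)
      rw [mul_pow, MeasurableField.norm_sq _ α, ← integral_const_mul]
      exact MeasurableField.norm_sq_le_of_ae_le (α.mem.2.const_mul _) (ae_of_all _ hle)
  refine LinearPMap.eq_of_eq_graph ?_
  rw [← hclC.graph_closure_eq_closure_graph]
  refine le_antisymm ?_ hGN
  rw [hN]
  exact Submodule.topologicalClosure_minimal _ h2G hG

/-- If the Cauchy boundary is polar, then the Gaffney Laplacian is self-adjoint. -/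
theorem isSelfAdjoint_gaffneyLaplacian [IsRiemannianManifold (𝓡 n) M]
    (hcov : cov.IsMetricCompatible) (hpolar : IsPolar n (cauchyBoundary M)) :
    IsSelfAdjoint (gaffneyLaplacian 𝕜 n cov) := by
  obtain ⟨hcl, hN⟩ := nablaN_eq_closure_nablaC (𝕜 := 𝕜) cov hcov hpolar
  rw [gaffneyLaplacian, hN]
  exact isSelfAdjoint_compUnbounded_adjoint_closure (dense_domain_nablaC cov) hcl

end Approximation

end GaffneyLap
end

theorem corollary4p3 {𝕜 : Type*} [RCLike 𝕜]
    -- the Riemannian manifold `M`, with its Riemannian distance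
    {n : ℕ} {M : Type*} [EMetricSpace M] [ChartedSpace (EuclideanSpace ℝ (Fin n)) M]
    [IsManifold (𝓡 n) ∞ M] [SecondCountableTopology M] [MeasurableSpace M] [BorelSpace M]
    [RiemannianBundle (fun x : M ↦ TangentSpace (𝓡 n) x)]
    [IsContMDiffRiemannianBundle (𝓡 n) ∞ (EuclideanSpace ℝ (Fin n))
      (fun x : M ↦ TangentSpace (𝓡 n) x)]
    [IsRiemannianManifold (𝓡 n) M]
    -- the smooth real (`𝕜 = ℝ`) or complex (`𝕜 = ℂ`) vector bundle `V` with its smooth metric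
    {F : Type*} [NormedAddCommGroup F] [NormedSpace ℝ F] [NormedSpace 𝕜 F] [IsScalarTower ℝ 𝕜 F]
    [FiniteDimensional ℝ F]
    {V : M → Type*} [TopologicalSpace (TotalSpace F V)] [∀ x, NormedAddCommGroup (V x)]
    [∀ x, InnerProductSpace ℝ (V x)] [∀ x, InnerProductSpace 𝕜 (V x)]
    [∀ x, IsScalarTower ℝ 𝕜 (V x)]
    [FiberBundle F V] [VectorBundle ℝ F V] [VectorBundle 𝕜 F V]
    [ContMDiffVectorBundle ∞ F V (𝓡 n)] [IsContMDiffRiemannianBundle (𝓡 n) ∞ F V]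
    -- the smooth connection, compatible with the metric of `V`
    (cov : CovariantDerivative (𝓡 n) F V) [cov.ContMDiffCovariantDerivative ∞]
    [GaffneyLap.IsLinearConnection 𝕜 n cov] (hcov : cov.IsMetricCompatible)
    -- the Cauchy boundary is polar
    (hpolar : GaffneyLap.IsPolar n (GaffneyLap.cauchyBoundary M)) :
    IsSelfAdjoint (GaffneyLap.gaffneyLaplacian 𝕜 n cov) :=
  GaffneyLap.isSelfAdjoint_gaffneyLaplacian cov hcov hpolar
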